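/- Let $\mathbb D=\{|z|<1\}$, $\mathbb T=\{|z|=1\}$, $\mathbb E=\{|z|>1\}$ in $\mathbb C$. A polynomial $p\in\mathbb C[z,w]$ has degree $(n,m)$ if it has degree $n$ in $z$ and $m$ in $w$, and degree at most $(n,m)$ if it has degree at most $n$ in $z$ and at most $m$ in $w$. It defines a distinguished variety if its zero set $V=\{(z,w)\in\mathbb C^2:p(z,w)=0\}$ satisfies $V\subset\mathbb D^2\cup\mathbb T^2\cup\mathbb E^2$. **Theorem.** Let $p\in\mathbb C[z,w]$ be a polynomial of degree $(n,m)$ that defines a distinguished variety, with zero set $V\subset\mathbb C^2$, and let $a,b\ge 0$ be real numbers, not both zero. Then there exist a $\mathbb C^n$-valued vector polynomial $\vec P$, each of whose entries has degree at most $(n-1,m)$, and a $\mathbb C^m$-valued vector polynomial $\vec Q$, each of whose entries has degree at most $(n,m-1)$, such that for all $(z,w)\in\mathbb C^2$ $$(bm-an)\,|p(z,w)|^2+2\,\mathrm{Re}\!\left[\bigl(a z p_z(z,w)-b w p_w(z,w)\bigr)\overline{p(z,w)}\right]+(1-|z|^2)\,|\vec P(z,w)|^2=(1-|w|^2)\,|\vec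 Q(z,w)|^2 ,$$ where $p_z=\partial p/\partial z$, $p_w=\partial p/\partial w$ and $|\cdot|$ is the Euclidean length of a vector. Moreover, every such pair $\vec P,\vec Q$ has the following properties. 1. If $p$ is squarefree (a product of distinct irreducible factors), then no entry of $\vec P$ and no entry of $\vec Q$ vanishes identically on $V$. 2. For all $(z,w),(Z,W)\in V$ (whether or not $p$ is squarefree), $$(1-z\bar Z)\,\langle\vec P(z,w),\vec P(Z,W)\rangle=(1-w\bar W)\,\langle\vec Q(z,w),\vec Q(Z,W)\rangle ,$$ where $\langle x,y\rangle=\sum_j x_j\overline{y_j}$. -/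

import Mathlib

open MvPolynomial

/-- Two-variable polynomials over the complex numbers; the variable with index `0` is `z` and
the variable with index `1` is `w`. -/
abbrev Poly2 : Type := MvPolynomial (Fin 2) ℂ

/-- The value `p(z, w)`. -/
noncomputable def Poly2.at (p : Poly2) (z w : ℂ) : ℂ := MvPolynomial.eval ![z, w] p

/-- `p` has degree `(n, m)`: degree exactly `n` in `z` and exactly `m` in `w`. -/
def Poly2.HasDegree (p : Poly2) (n m : ℕ) : Prop :=
  p.degreeOf 0 = n ∧ p.degreeOf 1 = m

/-- `p` has degree at most `(n, m)`: degree at most `n` in `z` and at most `m` in `w`. -/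
def Poly2.HasDegreeAtMost (p : Poly2) (n m : ℕ) : Prop :=
  p.degreeOf 0 ≤ n ∧ p.degreeOf 1 ≤ m

/-- The partial derivative `∂p/∂z`. -/
noncomputable def Poly2.dz (p : Poly2) : Poly2 := MvPolynomial.pderiv 0 p

/-- The partial derivative `∂p/∂w`. -/
noncomputable def Poly2.dw (p : Poly2) : Poly2 := MvPolynomial.pderiv 1 p

/-- The zero set of `p` in `ℂ²`. -/
def Poly2.zeroSet (p : Poly2) : Set (ℂ × ℂ) := {x | p.at x.1 x.2 = 0}

/-- The open unit disk `𝔻`. -/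
def openDisk : Set ℂ := {z | ‖z‖ < 1}

/-- The unit circle `𝕋`. -/
def unitTorus : Set ℂ := {z | ‖z‖ = 1}

/-- The exterior `𝔼` of the closed unit disk. -/
def exteriorDisk : Set ℂ := {z | 1 < ‖z‖}

/-- `p` defines a distinguished variety: its zero set in `ℂ²` is contained in
`𝔻² ∪ 𝕋² ∪ 𝔼²`. -/
def Poly2.DefinesDistinguishedVariety (p : Poly2) : Prop :=
  p.zeroSet ⊆ openDisk ×ˢ openDisk ∪ unitTorus ×ˢ unitTorus ∪ exteriorDisk ×ˢ exteriorDisk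

/-- `⟨A(z,w), A(Z,W)⟩ = ∑ j, A_j(z,w) * conj (A_j(Z,W))` for a vector polynomial `A`. -/
noncomputable def vecInner {k : ℕ} (A : Fin k → Poly2) (z w Z W : ℂ) : ℂ :=
  ∑ j, (A j).at z w * (starRingEnd ℂ) ((A j).at Z W)

/-- `|A(z,w)|² = ∑ j, |A_j(z,w)|²` for a vector polynomial `A`. -/
noncomputable def vecNormSq {k : ℕ} (A : Fin k → Poly2) (z w : ℂ) : ℝ :=
  ∑ j, ‖(A j).at z w‖ ^ 2

/-- The pair of vector polynomials `P` (with `n` entries, of degree at most `(n-1, m)`) and `Q`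
(with `m` entries, of degree at most `(n, m-1)`) satisfies the sum of squares formula for `p`
with weights `a, b` on all of `ℂ²`. If `n = 0`, then `P` has no entries and the truncated
difference `n - 1` is not used; likewise for `m` and `Q`. -/
def IsSOSPair (p : Poly2) (n m : ℕ) (a b : ℝ) (P : Fin n → Poly2) (Q : Fin m → Poly2) : Prop :=
  (∀ i, (P i).HasDegreeAtMost (n - 1) m) ∧
  (∀ j, (Q j).HasDegreeAtMost n (m - 1)) ∧
  ∀ z w : ℂ,
    (b * m - a * n) * ‖p.at z w‖ ^ 2
      + 2 * (((a : ℂ) * z * p.dz.at z w - (b : ℂ) * w * p.dw.at z w)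
          * (starRingEnd ℂ) (p.at z w)).re
      + (1 - ‖z‖ ^ 2) * vecNormSq P z w
    = (1 - ‖w‖ ^ 2) * vecNormSq Q z w

/-! Existence is obtained by differentiating a family of sum of squares formulas for stable
polynomials, that is, polynomials without zeros on the closed bidisk.

For stable `q` with reflection `q~`, one has `|q|² - |q~|² = (1-|z|²)|P|² + (1-|w|²)|Q|²`. To prove
it, embed polynomials in `L²` of the torus by `f ↦ f/q`. The decisive fact is that every polynomial
in `box (n+1) m` orthogonal to `box n m` is orthogonal to all of `box n (m+1)`
(`Stable.inner_eq_zero`). Orthonormal bases of `box n m` and of its complements in the two larger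
boxes, together with `q~`, then form an orthonormal basis of `box (n+1) (m+1)`. Reflection is
antiunitary, so it preserves the diagonal of each reproducing kernel; comparing the kernels of the
four boxes gives the formula (`Stable.exists_sum_of_squares`).

If `p` defines a distinguished variety, its leading coefficient in `w` has no zeros on the closed
disk, and `p` equals its own reflection up to a unimodular constant. Hence `(βw)^m p(αz, 1/(βw))` is
stable for `0 < α, β ≤ 1` not both `1`, and its reflection is again built from `p`. With `α =
e^{-at}`, `β = e^{-bt}`, the difference of squares vanishes at `t = 0`; divided by `2t` it tends to
minus the weighted form of the theorem. The vector polynomials stay bounded because `1-|z|²` and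
`|w|²-1` are both positive on a suitable grid, so a subsequence converges.

The formula on `V` is the polarization of the identity. For nonvanishing, choose a generic `w` on
the circle: `p(·, w)` has `n` distinct zeros, all on the circle. The formula on `V` makes the values
of `P` there pairwise orthogonal, and a derivative at the torus shows that they are nonzero. They
therefore span `ℂⁿ`, so no entry of `P` vanishes at all of them. Exchanging the variables treats
`Q`. -/

open MeasureTheory Filter Topology

/-! ### Integration on the torus and decay of Fourier coefficients -/

/-- The circle as an additive group, carrying its Haar probability measure. -/
abbrev Ang : Type := AddCircle (2 * Real.pi)

instance fact_two_pi_pos : Fact (0 < 2 * Real.pi) := ⟨Real.two_pi_pos⟩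

/-- The normalized Haar measure on the torus. -/
noncomputable abbrev torusMeasure : Measure (Ang × Ang) :=
  (AddCircle.haarAddCircle (T := 2 * Real.pi)).prod (AddCircle.haarAddCircle (T := 2 * Real.pi))

/-- The point of the unit circle with a given angle. -/
noncomputable def circlePt (x : Ang) : ℂ := (AddCircle.toCircle x : ℂ)

@[fun_prop]
theorem continuous_circlePt : Continuous circlePt := by
  unfold circlePt
  exact continuous_subtype_val.comp AddCircle.continuous_toCircle

@[simp] theorem norm_circlePt (x : Ang) : ‖circlePt x‖ = 1 := Circle.norm_coe _

theorem circlePt_ne_zero (x : Ang) : circlePt x ≠ 0 := Circle.coe_ne_zero _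

theorem conj_circlePt (x : Ang) : (starRingEnd ℂ) (circlePt x) = (circlePt x)⁻¹ := by
  unfold circlePt
  rw [← Circle.coe_inv_eq_conj, Circle.coe_inv]

theorem circlePt_surj {z : ℂ} (hz : ‖z‖ = 1) : ∃ x, circlePt x = z := by
  refine ⟨((Complex.arg z : ℝ) : Ang), ?_⟩
  unfold circlePt
  rw [AddCircle.toCircle_apply_mk, Circle.coe_exp]
  have h := Complex.norm_mul_exp_arg_mul_I z
  rw [hz, Complex.ofReal_one, one_mul] at h
  have : (2 * Real.pi / (2 * Real.pi) * Complex.arg z : ℝ) = Complex.arg z := by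
    field_simp
  rw [this, h]

theorem integral_circlePt (f : ℂ → ℂ) :
    ∫ x, f (circlePt x) ∂AddCircle.haarAddCircle = Real.circleAverage f 0 1 := by
  have h1 := AddCircle.intervalIntegral_preimage (2 * Real.pi) 0 (fun x => f (circlePt x))
  rw [AddCircle.volume_eq_smul_haarAddCircle, integral_smul_measure] at h1
  rw [Real.circleAverage]
  have h2 : ∫ θ in (0:ℝ)..2 * Real.pi, f (circleMap 0 1 θ)
      = ∫ a in (0:ℝ)..0 + 2 * Real.pi, f (circlePt (a : Ang)) := by
    rw [zero_add]
    congr 1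
    ext a
    congr 1
    unfold circlePt
    rw [AddCircle.toCircle_apply_mk, Circle.coe_exp]
    have : (2 * Real.pi / (2 * Real.pi) * a : ℝ) = a := by
      field_simp
    rw [this]
    simp [circleMap]
  rw [h2, h1, ENNReal.toReal_ofReal Real.two_pi_pos.le, smul_smul, inv_mul_cancel₀ (by positivity), one_smul]

/-- The mean value property; the vanishing of integrals against `1/q` below comes from it. -/
theorem integral_circlePt_of_diffContOnCl {f : ℂ → ℂ} (hf : DiffContOnCl ℂ f (Metric.ball 0 1)) :
    ∫ x, f (circlePt x) ∂AddCircle.haarAddCircle = f 0 := by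
  rw [integral_circlePt]
  exact DiffContOnCl.circleAverage (by simpa using hf)

theorem integrable_torus {F : Ang × Ang → ℂ} (hF : Continuous F) : Integrable F torusMeasure :=
  hF.integrable_of_hasCompactSupport (HasCompactSupport.of_compactSpace F)

/-- The Fourier coefficients of a square integrable function tend to zero: continuous version
in the first variable of the torus. -/
theorem tendsto_integral_circlePt_zpow (F : C(Ang × Ang, ℂ)) :
    Filter.Tendsto (fun l : ℤ => ∫ x, F x * (circlePt x.1) ^ l ∂torusMeasure)
      Filter.cofinite (nhds 0) := by
  let v : ℤ → Lp ℂ 2 torusMeasure := fun l =>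
    ContinuousMap.toLp 2 torusMeasure ℂ ⟨fun x => (circlePt x.1) ^ (-l), by
      refine Continuous.zpow₀ (by fun_prop) _ fun x => Or.inl (circlePt_ne_zero _)⟩
  have hv : Orthonormal ℂ v := by
    rw [orthonormal_iff_ite]
    intro i j
    simp only [v]
    rw [ContinuousMap.inner_toLp]
    have h1 : ∀ x : Ang × Ang, (circlePt x.1) ^ (-j) * (starRingEnd ℂ) ((circlePt x.1) ^ (-i))
        = fourier (i - j) x.1 := by
      intro x
      rw [map_zpow₀, conj_circlePt, inv_zpow', neg_neg, ← zpow_add₀ (circlePt_ne_zero _),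
        fourier_apply, AddCircle.toCircle_zsmul]
      simp [circlePt, sub_eq_neg_add]
    have h2 : ∫ x : Ang × Ang, (circlePt x.1) ^ (-j) * (starRingEnd ℂ) ((circlePt x.1) ^ (-i)) ∂torusMeasure
        = ∫ x : Ang, fourier (i - j) x ∂AddCircle.haarAddCircle := by
      simp_rw [h1]
      rw [integral_fun_fst (μ := (AddCircle.haarAddCircle (T := 2 * Real.pi)))
        (ν := (AddCircle.haarAddCircle (T := 2 * Real.pi))) (fun x => fourier (i - j) x)]
      simp
    refine h2.trans ?_
    have h3 := orthonormal_iff_ite.1 (orthonormal_fourier (T := 2 * Real.pi)) j i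
    rw [fourierLp, fourierLp, ContinuousMap.inner_toLp] at h3
    have h4 : (if i = j then (1 : ℂ) else 0) = if j = i then 1 else 0 := by simp [eq_comm]
    rw [h4, ← h3]
    congr 1
    ext x
    rw [← fourier_neg, ← fourier_add, sub_eq_add_neg]
  -- Bessel's inequality makes the squared coefficients summable, so they tend to zero. The sign in
  -- `circlePt x.1 ^ (-l)` is undone by the conjugation in the inner product.
  have hs := hv.inner_products_summable (ContinuousMap.toLp 2 torusMeasure ℂ F)
  have h0 := hs.tendsto_cofinite_zero
  have h1 : Filter.Tendsto (fun l : ℤ => ‖inner ℂ (v l) (ContinuousMap.toLp 2 torusMeasure ℂ F)‖)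
      Filter.cofinite (nhds 0) := by
    have := h0.sqrt
    simpa [Real.sqrt_sq_eq_abs] using this
  rw [tendsto_zero_iff_norm_tendsto_zero]
  refine h1.congr fun l => ?_
  simp only [v]
  rw [ContinuousMap.inner_toLp]
  congr 2
  ext x
  simp only [ContinuousMap.coe_mk]
  rw [map_zpow₀, conj_circlePt, inv_zpow', neg_neg]

/-! ### Banded biorthogonal systems -/

section AbstractOrthogonality
open Filter Topology Finset

/-- Let `E l j` be a doubly indexed family with a biorthogonal family `B l j` which is a banded
combination of the `E`. A vector that is orthogonal to `E l j` for `0 ≤ l < n` and to `B l j` for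
`l < 0`, and whose coefficients decay, is orthogonal to all `E l j` with `l < 0`. -/
theorem inner_eq_zero_of_banded_biorthogonal {H : Type*} [NormedAddCommGroup H]
    [InnerProductSpace ℂ H] {m : ℕ} (n : ℕ) (E B : ℤ → Fin m → H)
    (M : Fin m → ℤ → Fin m → ℂ) (β γ : ℝ)
    (hO : ∀ l j l' j', inner ℂ (E l' j') (B l j) = if l' = l ∧ j' = j then 1 else 0)
    (hS : ∀ l j, B l j = ∑ s ∈ Icc (-(n : ℤ)) n, ∑ i, M j s i • E (l + s) i)
    (hB : ∀ l j, ‖B l j‖ ≤ β) (hE : ∀ l j, ‖E l j‖ ≤ γ) (g : H)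
    (hκ : ∀ j, Tendsto (fun l => inner ℂ (E l j) g) atBot (𝓝 0))
    (hg : ∀ l j, l < 0 → inner ℂ (B l j) g = 0)
    (hU : ∀ (l : ℤ) j, 0 ≤ l → l < n → inner ℂ (E l j) g = 0) :
    ∀ l j, l < 0 → inner ℂ (E l j) g = 0 := by
  set κ : ℤ → Fin m → ℂ := fun l j => inner ℂ (E l j) g with hκdef
  -- By biorthogonality, `u N` pairs with `E l j` as `g` does when `-N ≤ l < 0`, and to zero for
  -- every other `l`. The aim is `u N → 0`.
  let u : ℕ → H := fun N => ∑ l ∈ Ico (-(N : ℤ)) 0, ∑ j, κ l j • B l j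
  have hEu : ∀ N t i, inner ℂ (E t i) (u N) = if t ∈ Ico (-(N : ℤ)) 0 then κ t i else 0 := by
    intro N t i
    simp only [u, inner_sum, inner_smul_right, hO]
    rw [← Finset.sum_ite_eq (Ico (-(N : ℤ)) 0) t (fun l => κ l i)]
    refine Finset.sum_congr rfl fun l _ => ?_
    by_cases h : t = l
    · simp [h]
    · simp [h]
  have hBexp : ∀ l j (v : H), inner ℂ (B l j) v
      = ∑ s ∈ Icc (-(n : ℤ)) n, ∑ i, (starRingEnd ℂ) (M j s i) * inner ℂ (E (l + s) i) v := by
    intro l j v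
    rw [hS]
    simp only [sum_inner, inner_smul_left]
  -- The band of `B l j` stays within `[-N, n)`. There `u N` and `g` have the same pairings with
  -- `E`: by construction below `0`, and both zero on `[0, n)`.
  have hBu : ∀ (N : ℕ) l j, -(N : ℤ) + n ≤ l → l < 0 → inner ℂ (B l j) (u N) = 0 := by
    intro N l j h1 h2
    rw [← hg l j h2, hBexp, hBexp]
    refine Finset.sum_congr rfl fun s hs => Finset.sum_congr rfl fun i _ => ?_
    rw [hEu]
    rw [Finset.mem_Icc] at hs
    congr 1
    split_ifs with h
    · rfl
    · symm
      apply hU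
      · by_contra h3
        exact h (Finset.mem_Ico.2 ⟨by omega, by omega⟩)
      · omega
  -- Expanding one factor of `⟨u N, u N⟩` leaves only the `n` lowest indices, where the coefficients
  -- `κ` are small.
  have hu : ∀ N : ℕ, ‖u N‖ ≤ β * ∑ i ∈ range n, ∑ j, ‖κ (-(N : ℤ) + i) j‖ := by
    intro N
    have h1 : inner ℂ (u N) (u N)
        = ∑ l ∈ Ico (-(N : ℤ)) 0, ∑ j, (starRingEnd ℂ) (κ l j) * inner ℂ (B l j) (u N) := by
      conv_lhs => rw [show u N = ∑ l ∈ Ico (-(N : ℤ)) 0, ∑ j, κ l j • B l j from rfl]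
      rw [show (∑ l ∈ Ico (-(N : ℤ)) 0, ∑ j, κ l j • B l j) = u N from rfl]
      conv_lhs => lhs; rw [show u N = ∑ l ∈ Ico (-(N : ℤ)) 0, ∑ j, κ l j • B l j from rfl]
      simp only [sum_inner, inner_smul_left]
    have h2 : ‖u N‖ * ‖u N‖ ≤ (β * ∑ i ∈ range n, ∑ j, ‖κ (-(N : ℤ) + i) j‖) * ‖u N‖ := by
      calc ‖u N‖ * ‖u N‖ = ‖inner ℂ (u N) (u N)‖ := by
            rw [inner_self_eq_norm_sq_to_K]; simp [sq]
        _ ≤ ∑ l ∈ Ico (-(N : ℤ)) 0, ∑ j, ‖κ l j‖ * ‖inner ℂ (B l j) (u N)‖ := by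
            rw [h1]
            refine (norm_sum_le _ _).trans (Finset.sum_le_sum fun l _ => ?_)
            refine (norm_sum_le _ _).trans (Finset.sum_le_sum fun j _ => ?_)
            rw [norm_mul, RCLike.norm_conj]
        _ = ∑ l ∈ Ico (-(N : ℤ)) 0 ∩ Ico (-(N : ℤ)) (-(N : ℤ) + n),
              ∑ j, ‖κ l j‖ * ‖inner ℂ (B l j) (u N)‖ := by
            symm
            refine Finset.sum_subset Finset.inter_subset_left fun l hl hl' => ?_
            refine Finset.sum_eq_zero fun j _ => ?_
            rw [hBu N l j, norm_zero, mul_zero]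
            · by_contra h3
              apply hl'
              rw [Finset.mem_inter, Finset.mem_Ico, Finset.mem_Ico]
              rw [Finset.mem_Ico] at hl
              omega
            · exact (Finset.mem_Ico.1 hl).2
        _ ≤ ∑ l ∈ Ico (-(N : ℤ)) (-(N : ℤ) + n), ∑ j, ‖κ l j‖ * ‖inner ℂ (B l j) (u N)‖ :=
            Finset.sum_le_sum_of_subset_of_nonneg Finset.inter_subset_right
              fun l _ _ => Finset.sum_nonneg fun j _ => by positivity
        _ = ∑ i ∈ range n, ∑ j, ‖κ (-(N : ℤ) + i) j‖ * ‖inner ℂ (B (-(N : ℤ) + i) j) (u N)‖ := by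
            symm
            refine Finset.sum_bij (fun i _ => -(N : ℤ) + (i : ℤ)) ?_ ?_ ?_ ?_
            · intro i hi
              rw [Finset.mem_range] at hi
              rw [Finset.mem_Ico]; omega
            · intro i _ i' _ h; omega
            · intro l hl
              rw [Finset.mem_Ico] at hl
              exact ⟨(l + N).toNat, by rw [Finset.mem_range]; omega, by omega⟩
            · intro i _; rfl
        _ ≤ ∑ i ∈ range n, ∑ j, ‖κ (-(N : ℤ) + i) j‖ * (β * ‖u N‖) := by
            refine Finset.sum_le_sum fun i _ => Finset.sum_le_sum fun j _ => ?_
            gcongr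
            exact (norm_inner_le_norm _ _).trans (by gcongr; exact hB _ _)
        _ = _ := by
            simp only [← Finset.sum_mul]; ring
    -- Cancelling `‖u N‖` needs it nonzero. Otherwise `0 ≤ β` is required, which is available only
    -- if `Fin m` is inhabited; if it is empty, the sum vanishes.
    by_cases h0 : ‖u N‖ = 0
    · rw [h0] at h2 ⊢
      by_cases hm : ∃ j : Fin m, True
      · obtain ⟨j, _⟩ := hm
        have : 0 ≤ β := (norm_nonneg _).trans (hB 0 j)
        positivity
      · have : ∀ l : ℤ, ∑ j, ‖κ l j‖ = 0 := fun l =>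
          Finset.sum_eq_zero fun j _ => (hm ⟨j, trivial⟩).elim
        simp [this]
    · exact le_of_mul_le_mul_right h2 (lt_of_le_of_ne (norm_nonneg _) (Ne.symm h0))
  have hlim : Tendsto (fun N => ‖u N‖) atTop (𝓝 0) := by
    refine squeeze_zero (fun N => norm_nonneg _) hu ?_
    have h1 : Tendsto (fun N : ℕ => β * ∑ i ∈ range n, ∑ j, ‖κ (-(N : ℤ) + i) j‖) atTop
        (𝓝 (β * ∑ i ∈ range n, ∑ j : Fin m, 0)) := by
      refine Tendsto.const_mul _ (tendsto_finsetSum _ fun i _ => tendsto_finsetSum _ fun j _ => ?_)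
      have h2 : Tendsto (fun N : ℕ => -(N : ℤ) + i) atTop atBot :=
        tendsto_atBot_add_const_right _ _ (tendsto_neg_atTop_atBot.comp tendsto_natCast_atTop_atTop)
      simpa using ((hκ j).comp h2).norm
    simpa using h1
  intro l j hl
  have hle : ∀ᶠ N : ℕ in atTop, ‖κ l j‖ ≤ γ * ‖u N‖ := by
    filter_upwards [eventually_ge_atTop (-l).toNat] with N hN
    have h1 : κ l j = inner ℂ (E l j) (u N) := by
      rw [hEu, if_pos (Finset.mem_Ico.2 ⟨by omega, hl⟩)]
    rw [h1]
    exact (norm_inner_le_norm _ _).trans (by gcongr; exact hE _ _)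
  have h2 : Tendsto (fun N => γ * ‖u N‖) atTop (𝓝 0) := by simpa using hlim.const_mul γ
  have h3 : ‖κ l j‖ ≤ 0 := ge_of_tendsto h2 hle
  exact norm_le_zero_iff.1 h3

end AbstractOrthogonality

/-! ### Bounded solutions of linear recurrences -/

section Recurrence

/-- A bounded sequence that satisfies a linear recurrence whose characteristic roots all lie
outside the closed unit disk vanishes. -/
theorem eq_zero_of_bounded_of_recurrence (f : Polynomial ℂ) (hf : f ≠ 0)
    (hroot : ∀ z, f.IsRoot z → 1 < ‖z‖) (e : ℕ → ℂ) (C : ℝ) (hC : ∀ k, ‖e k‖ ≤ C)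
    (he : ∀ k, ∑ i ∈ Finset.range (f.natDegree + 1), f.coeff i * e (k + i) = 0) : ∀ k, e k = 0 := by
  -- In terms of the shift `S` the recurrence reads `f(S) e = 0`, so the linear factors of `f` can
  -- be removed one at a time.
  let S : Module.End ℂ (ℕ → ℂ) := LinearMap.funLeft ℂ ℂ (fun k => k + 1)
  have hSpow : ∀ (i : ℕ) (x : ℕ → ℂ) k, (S ^ i) x k = x (k + i) := by
    intro i
    induction i with
    | zero => intro x k; simp
    | succ i ih =>
      intro x k
      rw [pow_succ', Module.End.mul_apply]
      change (S ^ i) x (k + 1) = _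
      rw [ih]; congr 1; ring
  have haev : ∀ (g : Polynomial ℂ) (x : ℕ → ℂ) k,
      Polynomial.aeval S g x k = ∑ i ∈ Finset.range (g.natDegree + 1), g.coeff i * x (k + i) := by
    intro g x k
    rw [Polynomial.aeval_eq_sum_range]
    simp [LinearMap.sum_apply, Finset.sum_apply, hSpow]
  have key : ∀ (d : ℕ) (g : Polynomial ℂ), g.natDegree = d → g ≠ 0 → (∀ z, g.IsRoot z → 1 < ‖z‖) →
      ∀ x : ℕ → ℂ, (∃ C, ∀ k, ‖x k‖ ≤ C) → Polynomial.aeval S g x = 0 → x = 0 := by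
    intro d
    induction d with
    | zero =>
      intro g hd hg _ x _ h
      rw [Polynomial.eq_C_of_natDegree_eq_zero hd] at h hg
      rw [Polynomial.aeval_C] at h
      have : g.coeff 0 ≠ 0 := by simpa using hg
      simpa [Module.algebraMap_end_apply, this] using h
    | succ d ih =>
      intro g hd hg hr x hx h
      have hdeg : g.degree ≠ 0 := by
        rw [Polynomial.degree_eq_natDegree hg, hd]; exact_mod_cast Nat.succ_ne_zero d
      obtain ⟨ζ, hζ⟩ := IsAlgClosed.exists_root g hdeg
      obtain ⟨g', rfl⟩ := Polynomial.dvd_iff_isRoot.2 hζ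
      have hg' : g' ≠ 0 := right_ne_zero_of_mul hg
      have hd' : g'.natDegree = d := by
        rw [Polynomial.natDegree_mul (Polynomial.X_sub_C_ne_zero ζ) hg',
          Polynomial.natDegree_X_sub_C] at hd
        omega
      refine ih g' hd' hg' (fun z hz => hr z ?_) x hx ?_
      · rw [Polynomial.IsRoot, Polynomial.eval_mul, hz.eq_zero, mul_zero]
      set y := Polynomial.aeval S g' x with hy
      have hyC : ∃ C, ∀ k, ‖y k‖ ≤ C := by
        obtain ⟨C, hC⟩ := hx
        refine ⟨∑ i ∈ Finset.range (g'.natDegree + 1), ‖g'.coeff i‖ * C, fun k => ?_⟩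
        rw [hy, haev]
        refine (norm_sum_le _ _).trans (Finset.sum_le_sum fun i _ => ?_)
        rw [norm_mul]
        gcongr
        exact hC _
      -- `(S - ζ) y = 0` makes `y` geometric with ratio `ζ`. Since `|ζ| > 1`, boundedness forces `y
      -- = 0`.
      have hrec : ∀ k, y (k + 1) = ζ * y k := by
        intro k
        have h1 := congrFun h k
        rw [map_mul, Module.End.mul_apply, ← hy, map_sub, Polynomial.aeval_X, Polynomial.aeval_C] at h1
        simpa [S, LinearMap.funLeft, sub_eq_zero, Module.algebraMap_end_apply] using h1
      have hpow : ∀ k i, y (k + i) = ζ ^ i * y k := by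
        intro k i
        induction i with
        | zero => simp
        | succ i ih' => rw [← add_assoc, hrec, ih', pow_succ]; ring
      obtain ⟨C, hC⟩ := hyC
      funext k
      by_contra hk
      have hk' : 0 < ‖y k‖ := norm_pos_iff.2 hk
      obtain ⟨i, hi⟩ := pow_unbounded_of_one_lt (C / ‖y k‖) (hr ζ hζ)
      rw [div_lt_iff₀ hk'] at hi
      have := hC (k + i)
      rw [hpow, norm_mul, norm_pow] at this
      linarith
  have h0 := key _ f rfl hf hroot e ⟨C, hC⟩ (by funext k; rw [haev, he]; rfl)
  intro k
  rw [h0]; rfl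

end Recurrence

/-! ### Coefficients, degree boxes and reflection -/

/-- The exponent of the monomial `z ^ i * w ^ j`. -/
noncomputable def bideg (i j : ℕ) : Fin 2 →₀ ℕ := Finsupp.single 0 i + Finsupp.single 1 j

@[simp] theorem bideg_zero (i j : ℕ) : bideg i j 0 = i := by simp [bideg]
@[simp] theorem bideg_one (i j : ℕ) : bideg i j 1 = j := by simp [bideg]

theorem bideg_self (s : Fin 2 →₀ ℕ) : bideg (s 0) (s 1) = s := by
  ext k; fin_cases k <;> simp

theorem bideg_inj {i j i' j' : ℕ} : bideg i j = bideg i' j' ↔ i = i' ∧ j = j' :=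
  ⟨fun h => ⟨by simpa using DFunLike.congr_fun h 0, by simpa using DFunLike.congr_fun h 1⟩,
    fun h => by rw [h.1, h.2]⟩

namespace Poly2

/-- The coefficient of `z ^ i * w ^ j`. -/
noncomputable def cf (f : Poly2) (i j : ℕ) : ℂ := f.coeff (bideg i j)

@[simp] theorem cf_add (f g : Poly2) (i j : ℕ) : (f + g).cf i j = f.cf i j + g.cf i j := coeff_add _ _ _
@[simp] theorem cf_smul (c : ℂ) (f : Poly2) (i j : ℕ) : (c • f).cf i j = c * f.cf i j := coeff_smul _ _ _
@[simp] theorem cf_zero (i j : ℕ) : (0 : Poly2).cf i j = 0 := coeff_zero _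

/-- The monomial `z ^ i * w ^ j`. -/
noncomputable def mono (i j : ℕ) : Poly2 := monomial (bideg i j) 1

theorem cf_mono (i j k l : ℕ) : (mono i j).cf k l = if i = k ∧ j = l then 1 else 0 := by
  simp [cf, mono, coeff_monomial, bideg_inj]

theorem ext_cf {f g : Poly2} (h : ∀ i j, f.cf i j = g.cf i j) : f = g := by
  ext s
  rw [← bideg_self s]
  exact h _ _

/-- The polynomials of degree less than `a` in `z` and less than `b` in `w`. -/
noncomputable def box (a b : ℕ) : Submodule ℂ Poly2 where
  carrier := {f | ∀ i j, f.cf i j ≠ 0 → i < a ∧ j < b}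
  add_mem' := by
    intro f g hf hg i j h
    rw [cf_add] at h
    by_cases h1 : f.cf i j = 0
    · exact hg i j (by simpa [h1] using h)
    · exact hf i j h1
  zero_mem' := by intro i j h; simp at h
  smul_mem' := by
    intro c f hf i j h
    rw [cf_smul] at h
    exact hf i j (right_ne_zero_of_mul h)

theorem box_mono {a b a' b' : ℕ} (h : a ≤ a') (h' : b ≤ b') : box a b ≤ box a' b' :=
  fun _ hf i j hij => ⟨(hf i j hij).1.trans_le h, (hf i j hij).2.trans_le h'⟩

theorem mono_mem_box {a b i j : ℕ} (hi : i < a) (hj : j < b) : mono i j ∈ box a b := by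
  intro k l h
  rw [cf_mono] at h
  split_ifs at h with h1
  · exact ⟨h1.1 ▸ hi, h1.2 ▸ hj⟩
  · exact (h rfl).elim

/-- The polynomial with given coefficients. -/
noncomputable def ofCf (a b : ℕ) (c : ℕ → ℕ → ℂ) : Poly2 :=
  ∑ i ∈ Finset.range a, ∑ j ∈ Finset.range b, c i j • mono i j

theorem cf_sum {ι : Type*} (s : Finset ι) (f : ι → Poly2) (i j : ℕ) :
    (∑ k ∈ s, f k).cf i j = ∑ k ∈ s, (f k).cf i j := coeff_sum _ _ _

theorem cf_ofCf (a b : ℕ) (c : ℕ → ℕ → ℂ) (i j : ℕ) :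
    (ofCf a b c).cf i j = if i < a ∧ j < b then c i j else 0 := by
  simp only [ofCf, cf_sum, cf_smul, cf_mono, mul_ite, mul_one, mul_zero, ite_and]
  simp only [Finset.sum_ite_eq', Finset.mem_range, Finset.sum_ite_irrel, Finset.sum_const_zero]

theorem ofCf_mem_box (a b : ℕ) (c : ℕ → ℕ → ℂ) : ofCf a b c ∈ box a b := by
  intro i j h
  rw [cf_ofCf] at h
  by_contra h1
  simp [h1] at h

theorem ofCf_cf {a b : ℕ} {f : Poly2} (hf : f ∈ box a b) : ofCf a b f.cf = f := by
  refine ext_cf fun i j => ?_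
  rw [cf_ofCf]
  split_ifs with h
  · rfl
  · by_contra h1
    exact h (hf i j (Ne.symm h1))

@[simp] theorem at_add (f g : Poly2) (z w : ℂ) : (f + g).at z w = f.at z w + g.at z w := map_add _ _ _
@[simp] theorem at_sub (f g : Poly2) (z w : ℂ) : (f - g).at z w = f.at z w - g.at z w := map_sub _ _ _
@[simp] theorem at_mul (f g : Poly2) (z w : ℂ) : (f * g).at z w = f.at z w * g.at z w := map_mul _ _ _
@[simp] theorem at_zero (z w : ℂ) : (0 : Poly2).at z w = 0 := map_zero _
@[simp] theorem at_smul (c : ℂ) (f : Poly2) (z w : ℂ) : (c • f).at z w = c * f.at z w := by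
  simp [Poly2.at, MvPolynomial.smul_eval]
theorem at_sum {ι : Type*} (s : Finset ι) (f : ι → Poly2) (z w : ℂ) :
    (∑ k ∈ s, f k).at z w = ∑ k ∈ s, (f k).at z w := map_sum _ _ _

@[simp] theorem at_mono (i j : ℕ) (z w : ℂ) : (mono i j).at z w = z ^ i * w ^ j := by
  simp [Poly2.at, mono, eval_monomial, Finsupp.prod_fintype]

theorem at_ofCf (a b : ℕ) (c : ℕ → ℕ → ℂ) (z w : ℂ) :
    (ofCf a b c).at z w = ∑ i ∈ Finset.range a, ∑ j ∈ Finset.range b, c i j * (z ^ i * w ^ j) := by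
  simp [ofCf, at_sum]

theorem at_eq_sum {a b : ℕ} {f : Poly2} (hf : f ∈ box a b) (z w : ℂ) :
    f.at z w = ∑ i ∈ Finset.range a, ∑ j ∈ Finset.range b, f.cf i j * (z ^ i * w ^ j) := by
  conv_lhs => rw [← ofCf_cf hf, at_ofCf]

@[fun_prop]
theorem continuous_at_comp {X : Type*} [TopologicalSpace X] (f : Poly2) {u v : X → ℂ}
    (hu : Continuous u) (hv : Continuous v) : Continuous fun x => f.at (u x) (v x) := by
  have h : Continuous fun x => (![u x, v x] : Fin 2 → ℂ) := by
    refine continuous_pi fun k => ?_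
    fin_cases k
    · exact hu
    · exact hv
  have h2 : Continuous fun y : Fin 2 → ℂ => MvPolynomial.eval y f := MvPolynomial.continuous_eval f
  exact h2.comp h

theorem exists_mem_box (f : Poly2) : f ∈ box (f.degreeOf 0 + 1) (f.degreeOf 1 + 1) := by
  intro i j h
  have hs : bideg i j ∈ f.support := mem_support_iff.2 h
  have h0 := monomial_le_degreeOf 0 hs
  have h1 := monomial_le_degreeOf 1 hs
  simp only [bideg_zero, bideg_one] at h0 h1
  omega

theorem mem_box_of_hasDegreeAtMost {f : Poly2} {n m : ℕ} (h : f.HasDegreeAtMost n m) :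
    f ∈ box (n + 1) (m + 1) :=
  box_mono (Nat.succ_le_succ h.1) (Nat.succ_le_succ h.2) f.exists_mem_box

theorem hasDegreeAtMost_of_mem_box {f : Poly2} {n m : ℕ} (h : f ∈ box (n + 1) (m + 1)) :
    f.HasDegreeAtMost n m := by
  constructor
  · rw [degreeOf_le_iff]
    intro s hs
    rw [mem_support_iff, ← bideg_self s] at hs
    exact Nat.lt_succ_iff.1 (h _ _ hs).1
  · rw [degreeOf_le_iff]
    intro s hs
    rw [mem_support_iff, ← bideg_self s] at hs
    exact Nat.lt_succ_iff.1 (h _ _ hs).2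

theorem infinite_unit_sphere : (Metric.sphere (0 : ℂ) 1).Infinite := by
  refine (isPreconnected_sphere (by simp [Complex.rank_real_complex]) 0 1).infinite_of_nontrivial
    ⟨1, by simp, -1, by simp, ?_⟩
  norm_num

/-- The torus is a product of infinite sets, hence Zariski dense. Identities involving reflections
can thus be checked on the torus, where reflection is conjugation times a monomial. -/
theorem eq_zero_of_at_circle {f : Poly2} (h : ∀ z w : ℂ, ‖z‖ = 1 → ‖w‖ = 1 → f.at z w = 0) :
    f = 0 := by
  refine MvPolynomial.funext_set (fun _ => Metric.sphere (0 : ℂ) 1) (fun _ => infinite_unit_sphere) fun x hx => ?_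
  have h0 := hx 0 trivial
  have h1 := hx 1 trivial
  simp only [mem_sphere_iff_norm, sub_zero] at h0 h1
  have := h _ _ h0 h1
  rw [map_zero, ← this, Poly2.at]
  have hx2 : x = ![x 0, x 1] := by ext k; fin_cases k <;> rfl
  conv_lhs => rw [hx2]

/-- Polynomials in `box a b` are determined by their `a * b` coefficients. -/
noncomputable def boxEquiv (a b : ℕ) : box a b ≃ₗ[ℂ] (Fin a × Fin b → ℂ) :=
  LinearEquiv.ofBijective
    { toFun := fun f x => f.1.cf x.1 x.2
      map_add' := fun f g => by ext x; simp
      map_smul' := fun c f => by ext x; simp }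
    ⟨by
      intro f g h
      refine Subtype.ext (ext_cf fun i j => ?_)
      by_cases hij : i < a ∧ j < b
      · exact congrFun h (⟨i, hij.1⟩, ⟨j, hij.2⟩)
      · have h1 : f.1.cf i j = 0 := by by_contra h1; exact hij (f.2 i j h1)
        have h2 : g.1.cf i j = 0 := by by_contra h1; exact hij (g.2 i j h1)
        rw [h1, h2],
    by
      intro c
      refine ⟨⟨ofCf a b fun i j => if h : i < a ∧ j < b then c (⟨i, h.1⟩, ⟨j, h.2⟩) else 0,
        ofCf_mem_box _ _ _⟩, ?_⟩
      ext ⟨⟨i, hi⟩, ⟨j, hj⟩⟩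
      simp [cf_ofCf, hi, hj]⟩

instance (a b : ℕ) : FiniteDimensional ℂ (box a b) := (boxEquiv a b).symm.finiteDimensional

theorem finrank_box (a b : ℕ) : Module.finrank ℂ (box a b) = a * b := by
  rw [(boxEquiv a b).finrank_eq]; simp

/-- The reflection `z ^ N * w ^ M * conj (f (1 / conj z, 1 / conj w))` of a polynomial. -/
noncomputable def refl (N M : ℕ) (f : Poly2) : Poly2 :=
  ofCf (N + 1) (M + 1) fun i j => (starRingEnd ℂ) (f.cf (N - i) (M - j))

theorem refl_mem_box (N M : ℕ) (f : Poly2) : f.refl N M ∈ box (N + 1) (M + 1) := ofCf_mem_box _ _ _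

theorem cf_refl (N M : ℕ) (f : Poly2) (i j : ℕ) : (f.refl N M).cf i j =
    if i ≤ N ∧ j ≤ M then (starRingEnd ℂ) (f.cf (N - i) (M - j)) else 0 := by
  simp [refl, cf_ofCf]

theorem at_refl {N M : ℕ} {f : Poly2} (hf : f ∈ box (N + 1) (M + 1)) {z w : ℂ} (hz : z ≠ 0)
    (hw : w ≠ 0) : (f.refl N M).at z w
      = z ^ N * w ^ M * (starRingEnd ℂ) (f.at ((starRingEnd ℂ) z)⁻¹ ((starRingEnd ℂ) w)⁻¹) := by
  rw [refl, at_ofCf, at_eq_sum hf, map_sum, Finset.mul_sum,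
    ← Finset.sum_range_reflect]
  refine Finset.sum_congr rfl fun i hi => ?_
  rw [map_sum, Finset.mul_sum, ← Finset.sum_range_reflect]
  refine Finset.sum_congr rfl fun j hj => ?_
  have hi' : i ≤ N := Nat.lt_succ_iff.1 (Finset.mem_range.1 hi)
  have hj' : j ≤ M := Nat.lt_succ_iff.1 (Finset.mem_range.1 hj)
  have e1 : N + 1 - 1 - i = N - i := by omega
  have e2 : M + 1 - 1 - j = M - j := by omega
  rw [e1, e2, Nat.sub_sub_self hi', Nat.sub_sub_self hj']
  have h1 : z ^ N = z ^ (N - i) * z ^ i := by rw [← pow_add, Nat.sub_add_cancel hi']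
  have h2 : w ^ M = w ^ (M - j) * w ^ j := by rw [← pow_add, Nat.sub_add_cancel hj']
  rw [h1, h2]
  simp only [map_mul, map_pow, map_inv₀, Complex.conj_conj]
  rw [inv_pow, inv_pow]
  field_simp

theorem at_refl_circle {N M : ℕ} {f : Poly2} (hf : f ∈ box (N + 1) (M + 1)) {z w : ℂ}
    (hz : ‖z‖ = 1) (hw : ‖w‖ = 1) :
    (f.refl N M).at z w = z ^ N * w ^ M * (starRingEnd ℂ) (f.at z w) := by
  have hz0 : z ≠ 0 := by rintro rfl; simp at hz
  have hw0 : w ≠ 0 := by rintro rfl; simp at hw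
  have e1 : ((starRingEnd ℂ) z)⁻¹ = z := by
    rw [← Complex.inv_eq_conj hz, inv_inv]
  have e2 : ((starRingEnd ℂ) w)⁻¹ = w := by
    rw [← Complex.inv_eq_conj hw, inv_inv]
  rw [at_refl hf hz0 hw0, e1, e2]

theorem refl_refl {N M : ℕ} {f : Poly2} (hf : f ∈ box (N + 1) (M + 1)) :
    (f.refl N M).refl N M = f := by
  refine ext_cf fun i j => ?_
  rw [cf_refl, cf_refl]
  split_ifs with h1 h2
  · rw [Complex.conj_conj, Nat.sub_sub_self h1.1, Nat.sub_sub_self h1.2]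
  · exact (h2 ⟨by omega, by omega⟩).elim
  · by_contra h2
    have := hf i j (Ne.symm h2)
    omega

end Poly2

/-! ### Stable polynomials and the embedding `f ↦ f/q` -/

namespace Poly2

/-- The polynomial has no zeros on the closed bidisk. -/
def Stable (q : Poly2) : Prop := ∀ z w : ℂ, ‖z‖ ≤ 1 → ‖w‖ ≤ 1 → q.at z w ≠ 0

/-- The coefficient of `w ^ j`, as a function of `z`, of a polynomial of degree less than `a`
in `z`. -/
noncomputable def wc (f : Poly2) (a j : ℕ) (z : ℂ) : ℂ := ∑ s ∈ Finset.range a, f.cf s j * z ^ s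

@[fun_prop]
theorem continuous_wc (f : Poly2) (a j : ℕ) : Continuous (f.wc a j) := by
  unfold wc; fun_prop

theorem at_eq_sum_wc {a b : ℕ} {f : Poly2} (hf : f ∈ box a b) (z w : ℂ) :
    f.at z w = ∑ j ∈ Finset.range b, f.wc a j z * w ^ j := by
  rw [at_eq_sum hf, Finset.sum_comm]
  refine Finset.sum_congr rfl fun j _ => ?_
  rw [wc, Finset.sum_mul]
  exact Finset.sum_congr rfl fun i _ => by ring

theorem at_zero_right {a b : ℕ} {f : Poly2} (hf : f ∈ box a (b + 1)) (z : ℂ) :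
    f.at z 0 = f.wc a 0 z := by
  rw [at_eq_sum_wc hf, Finset.sum_eq_single 0]
  · simp
  · intro j _ hj; simp [hj]
  · intro h; simp at h

theorem differentiable_at_right (f : Poly2) (z : ℂ) : Differentiable ℂ fun w => f.at z w := by
  have : (fun w => f.at z w) = fun w => ∑ j ∈ Finset.range (f.degreeOf 1 + 1),
      f.wc (f.degreeOf 0 + 1) j z * w ^ j := by
    ext w; exact at_eq_sum_wc f.exists_mem_box z w
  rw [this]; fun_prop

theorem differentiable_at_left (f : Poly2) (w : ℂ) : Differentiable ℂ fun z => f.at z w := by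
  have : (fun z => f.at z w) = fun z => ∑ i ∈ Finset.range (f.degreeOf 0 + 1),
      ∑ j ∈ Finset.range (f.degreeOf 1 + 1), f.cf i j * (z ^ i * w ^ j) := by
    ext z; exact at_eq_sum f.exists_mem_box z w
  rw [this]; fun_prop

end Poly2

/-- The polynomial as a continuous function on the torus. -/
noncomputable def Poly2.onTorus : Poly2 →ₗ[ℂ] C(Ang × Ang, ℂ) where
  toFun f := ⟨fun x => f.at (circlePt x.1) (circlePt x.2), by fun_prop⟩
  map_add' f g := by ext x; simp
  map_smul' c f := by ext x; simp

@[simp] theorem Poly2.onTorus_apply (f : Poly2) (x : Ang × Ang) :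
    f.onTorus x = f.at (circlePt x.1) (circlePt x.2) := rfl

/-- The monomial `z ^ l * w ^ j` on the torus. -/
noncomputable def tmono (l j : ℤ) : C(Ang × Ang, ℂ) :=
  ⟨fun x => circlePt x.1 ^ l * circlePt x.2 ^ j, by
    refine Continuous.mul ?_ ?_
    · exact Continuous.zpow₀ (by fun_prop) _ fun x => Or.inl (circlePt_ne_zero _)
    · exact Continuous.zpow₀ (by fun_prop) _ fun x => Or.inl (circlePt_ne_zero _)⟩

@[simp] theorem tmono_apply (l j : ℤ) (x : Ang × Ang) :
    tmono l j x = circlePt x.1 ^ l * circlePt x.2 ^ j := rfl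

theorem onTorus_mono (i j : ℕ) : (Poly2.mono i j).onTorus = tmono i j := by
  ext x; simp

theorem tmono_mul (l j l' j' : ℤ) : tmono l j * tmono l' j' = tmono (l + l') (j + j') := by
  ext x
  simp only [ContinuousMap.mul_apply, tmono_apply]
  rw [zpow_add₀ (circlePt_ne_zero _), zpow_add₀ (circlePt_ne_zero _)]; ring

@[simp] theorem norm_tmono_apply (l j : ℤ) (x : Ang × Ang) : ‖tmono l j x‖ = 1 := by
  simp [norm_zpow]

theorem conj_tmono_apply (l j : ℤ) (x : Ang × Ang) :
    (starRingEnd ℂ) (tmono l j x) = tmono (-l) (-j) x := by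
  simp [map_zpow₀, conj_circlePt]

theorem integral_circlePt_zpow (k : ℤ) :
    ∫ x, circlePt x ^ k ∂AddCircle.haarAddCircle = if k = 0 then 1 else 0 := by
  have key : ∀ k : ℕ, k ≠ 0 → ∫ x, circlePt x ^ k ∂AddCircle.haarAddCircle = 0 := by
    intro k hk
    rw [integral_circlePt_of_diffContOnCl (f := fun z => z ^ k)
      (DifferentiableOn.diffContOnCl (by fun_prop))]
    simp [hk]
  rcases lt_trichotomy k 0 with h | h | h
  · obtain ⟨k', rfl⟩ : ∃ k' : ℕ, k = -(k' : ℤ) := ⟨k.natAbs, by omega⟩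
    have h1 := key k' (by omega)
    have h2 : ∀ x, circlePt x ^ (-(k' : ℤ)) = (starRingEnd ℂ) (circlePt x ^ k') := by
      intro x
      rw [map_pow, conj_circlePt, zpow_neg, zpow_natCast, inv_pow]
    simp_rw [h2]
    rw [integral_conj, h1, if_neg (by omega), map_zero]
  · simp [h]
  · obtain ⟨k', rfl⟩ : ∃ k' : ℕ, k = (k' : ℤ) := ⟨k.natAbs, by omega⟩
    simp_rw [zpow_natCast]
    rw [key k' (by omega), if_neg (by omega)]

theorem integral_tmono (l j : ℤ) :
    ∫ x, tmono l j x ∂torusMeasure = if l = 0 ∧ j = 0 then 1 else 0 := by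
  simp only [tmono_apply]
  rw [integral_prod_mul (fun x => circlePt x ^ l) (fun y => circlePt y ^ j),
    integral_circlePt_zpow, integral_circlePt_zpow]
  by_cases h : l = 0 <;> by_cases h' : j = 0 <;> simp [h, h']

namespace Poly2

variable {q : Poly2}

theorem Stable.ne_zero (hq : q.Stable) (x : Ang × Ang) : q.onTorus x ≠ 0 :=
  hq _ _ (norm_circlePt _).le (norm_circlePt _).le

/-- The reciprocal of a stable polynomial on the torus. -/
noncomputable def Stable.invT (hq : q.Stable) : C(Ang × Ang, ℂ) :=
  ⟨fun x => (q.onTorus x)⁻¹, q.onTorus.continuous.inv₀ hq.ne_zero⟩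

@[simp] theorem Stable.invT_apply (hq : q.Stable) (x : Ang × Ang) : hq.invT x = (q.onTorus x)⁻¹ := rfl

theorem Stable.diffContOnCl_right (hq : q.Stable) {z : ℂ} (hz : ‖z‖ ≤ 1) :
    DiffContOnCl ℂ (fun w => (q.at z w)⁻¹) (Metric.ball 0 1) := by
  refine DiffContOnCl.inv (q.differentiable_at_right z).diffContOnCl fun w hw => hq z w hz ?_
  rw [closure_ball _ one_ne_zero] at hw
  simpa using hw

theorem Stable.diffContOnCl_left (hq : q.Stable) {w : ℂ} (hw : ‖w‖ ≤ 1) :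
    DiffContOnCl ℂ (fun z => (q.at z w)⁻¹) (Metric.ball 0 1) := by
  refine DiffContOnCl.inv (q.differentiable_at_left w).diffContOnCl fun z hz => hq z w ?_ hw
  rw [closure_ball _ one_ne_zero] at hz
  simpa using hz

/-- Fubini and the mean value property in `w` alone, so the dependence `h` on `z` need only be
continuous. The factor `0 ^ k` is the value of `w ^ k` at the centre. -/
theorem Stable.integral_mul_inv (hq : q.Stable) {h : Ang → ℂ} (hh : Continuous h) (k : ℕ) :
    ∫ x, h x.1 * circlePt x.2 ^ k * hq.invT x ∂torusMeasure
      = ∫ x, h x * 0 ^ k * (q.at (circlePt x) 0)⁻¹ ∂AddCircle.haarAddCircle := by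
  rw [integral_prod _ (integrable_torus (by fun_prop))]
  congr 1
  ext x
  exact integral_circlePt_of_diffContOnCl (f := fun w => h x * w ^ k * (q.at (circlePt x) w)⁻¹)
    (((Differentiable.diffContOnCl (by fun_prop) :
      DiffContOnCl ℂ (fun w : ℂ => h x * w ^ k) (Metric.ball 0 1))).smul
        (hq.diffContOnCl_right (norm_circlePt x).le))

theorem Stable.integral_mul_inv_eq_zero (hq : q.Stable) {h : Ang → ℂ} (hh : Continuous h) {k : ℕ}
    (hk : k ≠ 0) : ∫ x, h x.1 * circlePt x.2 ^ k * hq.invT x ∂torusMeasure = 0 := by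
  rw [hq.integral_mul_inv hh]; simp [hk]

theorem Stable.integral_pow_mul_inv (hq : q.Stable) {k : ℕ} (hk : k ≠ 0) :
    ∫ x, circlePt x.1 ^ k * hq.invT x ∂torusMeasure = 0 := by
  have h1 := hq.integral_mul_inv (h := fun x => circlePt x ^ k) (by fun_prop) 0
  simp only [pow_zero, mul_one] at h1
  rw [h1, integral_circlePt_of_diffContOnCl (f := fun z => z ^ k * (q.at z 0)⁻¹)
    (((Differentiable.diffContOnCl (by fun_prop) :
      DiffContOnCl ℂ (fun z : ℂ => z ^ k) (Metric.ball 0 1))).smul (hq.diffContOnCl_left (by simp)))]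
  simp [hk]

/-- The embedding `f ↦ f / q` into the square integrable functions on the torus. -/
noncomputable def Stable.J (hq : q.Stable) : C(Ang × Ang, ℂ) →ₗ[ℂ] Lp ℂ 2 torusMeasure where
  toFun f := ContinuousMap.toLp 2 torusMeasure ℂ (f * hq.invT)
  map_add' f g := by rw [add_mul, map_add]
  map_smul' c f := by rw [smul_mul_assoc, map_smul]; rfl

theorem Stable.inner_J (hq : q.Stable) (f g : C(Ang × Ang, ℂ)) :
    inner ℂ (hq.J f) (hq.J g)
      = ∫ x, g x * (starRingEnd ℂ) (f x) * hq.invT x * (starRingEnd ℂ) (hq.invT x) ∂torusMeasure := by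
  simp only [Stable.J, LinearMap.coe_mk, AddHom.coe_mk]
  rw [ContinuousMap.inner_toLp]
  congr 1
  ext x
  simp only [ContinuousMap.mul_apply, map_mul]
  ring

theorem Stable.J_injective (hq : q.Stable) : Function.Injective hq.J := by
  rw [← LinearMap.ker_eq_bot, LinearMap.ker_eq_bot']
  intro f hf
  simp only [Stable.J, LinearMap.coe_mk, AddHom.coe_mk] at hf
  have h1 : f * hq.invT = 0 := by
    apply ContinuousMap.toLp_injective (p := 2) torusMeasure (𝕜 := ℂ)
    rw [hf, map_zero]
  ext x
  have h2 := DFunLike.congr_fun h1 x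
  simpa [hq.ne_zero x] using (mul_eq_zero.1 h2).resolve_right (inv_ne_zero (hq.ne_zero x))

/-- Multiplication by a unimodular function preserves inner products. -/
theorem Stable.inner_J_mul (hq : q.Stable) (u f g : C(Ang × Ang, ℂ)) (hu : ∀ x, ‖u x‖ = 1) :
    inner ℂ (hq.J (u * f)) (hq.J (u * g)) = inner ℂ (hq.J f) (hq.J g) := by
  rw [hq.inner_J, hq.inner_J]
  congr 1
  ext x
  have h1 : u x * (starRingEnd ℂ) (u x) = 1 := by
    rw [Complex.mul_conj', hu]; simp
  simp only [ContinuousMap.mul_apply, map_mul]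
  linear_combination (g x * (starRingEnd ℂ) (f x) * hq.invT x * (starRingEnd ℂ) (hq.invT x)) * h1

theorem Stable.norm_J_mul (hq : q.Stable) (u f : C(Ang × Ang, ℂ)) (hu : ∀ x, ‖u x‖ = 1) :
    ‖hq.J (u * f)‖ = ‖hq.J f‖ := by
  rw [@norm_eq_sqrt_re_inner ℂ, @norm_eq_sqrt_re_inner ℂ, hq.inner_J_mul u f f hu]

/-- The Riemann–Lebesgue lemma applied to `f w^{-j} / |q|²`; it supplies the decay needed for the
banded biorthogonality argument. -/
theorem Stable.tendsto_inner_tmono (hq : q.Stable) (j : ℤ) (f : C(Ang × Ang, ℂ)) :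
    Filter.Tendsto (fun l => inner ℂ (hq.J (tmono l j)) (hq.J f)) Filter.atBot (nhds 0) := by
  have h1 := tendsto_integral_circlePt_zpow (f * tmono 0 (-j) * hq.invT * star hq.invT)
  have h2 : Filter.Tendsto (fun l : ℤ => -l) Filter.atBot Filter.cofinite := by
    refine Filter.Tendsto.mono_right Filter.tendsto_neg_atBot_atTop ?_
    rw [Int.cofinite_eq]; exact le_sup_right
  refine (h1.comp h2).congr fun l => ?_
  rw [hq.inner_J]
  simp only [Function.comp]
  congr 1
  ext x
  rw [conj_tmono_apply]
  simp
  ring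

end Poly2

/-! ### The Christoffel–Darboux system dual to the monomials -/

/-- Trigonometric polynomials with `z`-frequencies in `[a, b]` and `w`-frequencies in `[0, m)`. -/
noncomputable def trigBox (a b : ℤ) (m : ℕ) : Submodule ℂ C(Ang × Ang, ℂ) :=
  Submodule.span ℂ (Set.range fun x : (Finset.Icc a b) × Fin m => tmono x.1 (x.2 : ℕ))

theorem tmono_mem_trigBox {a b : ℤ} {m : ℕ} {l : ℤ} {j : ℕ} (h1 : a ≤ l) (h2 : l ≤ b) (h3 : j < m) :
    tmono l j ∈ trigBox a b m :=
  Submodule.subset_span ⟨(⟨l, Finset.mem_Icc.2 ⟨h1, h2⟩⟩, ⟨j, h3⟩), rfl⟩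

theorem exists_eq_sum_of_mem_trigBox {a b : ℤ} {m : ℕ} {u : C(Ang × Ang, ℂ)} (hu : u ∈ trigBox a b m) :
    ∃ M : ℤ → Fin m → ℂ, u = ∑ s ∈ Finset.Icc a b, ∑ i, M s i • tmono s (i : ℕ) := by
  rw [trigBox, Submodule.mem_span_range_iff_exists_fun] at hu
  obtain ⟨c, rfl⟩ := hu
  refine ⟨fun s i => if h : s ∈ Finset.Icc a b then c (⟨s, h⟩, i) else 0, ?_⟩
  rw [Fintype.sum_prod_type, ← Finset.sum_coe_sort (Finset.Icc a b)]
  refine Finset.sum_congr rfl fun s _ => Finset.sum_congr rfl fun i _ => ?_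
  simp only
  rw [dif_pos s.2]

theorem tmono_mul_mem_trigBox {a b : ℤ} {m : ℕ} (l : ℤ) {u : C(Ang × Ang, ℂ)} (hu : u ∈ trigBox a b m) :
    tmono l 0 * u ∈ trigBox (a + l) (b + l) m := by
  obtain ⟨M, rfl⟩ := exists_eq_sum_of_mem_trigBox hu
  rw [Finset.mul_sum]
  refine Submodule.sum_mem _ fun s hs => ?_
  rw [Finset.mul_sum]
  refine Submodule.sum_mem _ fun i _ => ?_
  rw [mul_smul_comm, tmono_mul, zero_add]
  rw [Finset.mem_Icc] at hs
  exact Submodule.smul_mem _ _ (tmono_mem_trigBox (by omega) (by omega) i.2)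

namespace Poly2

/-- The coefficient of `w ^ j` as a function on the torus. -/
noncomputable def wcT (f : Poly2) (a j : ℕ) : C(Ang × Ang, ℂ) :=
  ∑ s ∈ Finset.range a, f.cf s j • tmono s 0

theorem wcT_apply (f : Poly2) (a j : ℕ) (x : Ang × Ang) : f.wcT a j x = f.wc a j (circlePt x.1) := by
  simp [wcT, wc, ContinuousMap.sum_apply]

theorem star_wcT (f : Poly2) (a j : ℕ) :
    star (f.wcT a j) = ∑ s ∈ Finset.range a, (starRingEnd ℂ) (f.cf s j) • tmono (-(s : ℤ)) 0 := by
  ext x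
  simp only [wcT, ContinuousMap.star_apply, ContinuousMap.sum_apply, ContinuousMap.smul_apply, star_sum]
  refine Finset.sum_congr rfl fun s _ => ?_
  rw [smul_eq_mul, smul_eq_mul, star_mul']
  congr 1
  exact (conj_tmono_apply _ _ _).trans (by simp)

/-- Products of coefficient functions as trigonometric polynomials. -/
theorem wcT_mul_star_wcT_mem (f g : Poly2) (n i t : ℕ) {b : ℕ} {j m : ℕ} (hj : j < m) :
    tmono 0 j * (f.wcT (b + 1) i * star (g.wcT (n + 1) t)) ∈ trigBox (-(n : ℤ)) b m := by
  rw [star_wcT, wcT, Finset.sum_mul_sum, Finset.mul_sum]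
  refine Submodule.sum_mem _ fun s hs => ?_
  rw [Finset.mul_sum]
  refine Submodule.sum_mem _ fun s' hs' => ?_
  rw [Finset.mem_range] at hs hs'
  rw [smul_mul_smul_comm, tmono_mul, mul_smul_comm, tmono_mul]
  refine Submodule.smul_mem _ _ ?_
  simp only [add_zero, zero_add]
  exact tmono_mem_trigBox (by omega) (by omega) hj

theorem onTorus_eq_sum {a b : ℕ} {f : Poly2} (hf : f ∈ box a b) :
    f.onTorus = ∑ j ∈ Finset.range b, f.wcT a j * tmono 0 j := by
  ext x
  simp [at_eq_sum_wc hf, ContinuousMap.sum_apply, wcT_apply]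

/-- The one-variable reflection in `w` of `q` on the torus. -/
noncomputable def hatT (q : Poly2) (m : ℕ) : C(Ang × Ang, ℂ) := tmono 0 m * star q.onTorus

theorem hatT_eq_sum {a m : ℕ} {q : Poly2} (hq : q ∈ box a (m + 1)) :
    q.hatT m = ∑ j ∈ Finset.range (m + 1), star (q.wcT a (m - j)) * tmono 0 j := by
  rw [hatT, onTorus_eq_sum hq, star_sum, Finset.mul_sum, ← Finset.sum_range_reflect]
  refine Finset.sum_congr rfl fun j hj => ?_
  rw [Finset.mem_range] at hj
  have e : m + 1 - 1 - j = m - j := by omega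
  rw [e, star_mul']
  have h1 : star (tmono 0 ((m - j : ℕ) : ℤ)) = tmono 0 (-((m - j : ℕ) : ℤ)) := by
    ext x; exact (conj_tmono_apply _ _ _).trans (by simp)
  rw [h1, mul_left_comm, tmono_mul]
  congr 2
  omega

/-- The coefficients of the one-variable Christoffel-Darboux kernel of `q(z, ·)`. -/
noncomputable def cdT (q : Poly2) (n m j : ℕ) : C(Ang × Ang, ℂ) :=
  ∑ i ∈ Finset.range (j + 1), tmono 0 ((j - i : ℕ) : ℤ) *
    (star (q.wcT (n + 1) i) * q.onTorus - q.wcT (n + 1) (m - i) * q.hatT m)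

/-- Individual products reach `w`-degree `j + m`, but those of degree at least `m` cancel in pairs,
as in the classical Christoffel–Darboux formula. In `z`, a coefficient function times a conjugate
one has frequencies in `[-n, n]`. -/
theorem cdT_mem_trigBox {n m j : ℕ} {q : Poly2} (hq : q ∈ box (n + 1) (m + 1)) (hj : j < m) :
    q.cdT n m j ∈ trigBox (-(n : ℤ)) n m := by
  set A := fun i : ℕ => q.wcT (n + 1) i with hA
  set G : ℕ × ℕ → C(Ang × Ang, ℂ) := fun x => tmono 0 ((j - x.1 + x.2 : ℕ) : ℤ) *
    (star (A x.1) * A x.2 - A (m - x.1) * star (A (m - x.2))) with hG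
  have h1 : q.cdT n m j = ∑ x ∈ Finset.range (j + 1) ×ˢ Finset.range (m + 1), G x := by
    rw [cdT, Finset.sum_product]
    refine Finset.sum_congr rfl fun i _ => ?_
    rw [hatT_eq_sum hq, onTorus_eq_sum hq, Finset.mul_sum, Finset.mul_sum, ← Finset.sum_sub_distrib,
      Finset.mul_sum]
    refine Finset.sum_congr rfl fun t _ => ?_
    have e : tmono 0 ((j - i + t : ℕ) : ℤ) = tmono 0 ((j - i : ℕ) : ℤ) * tmono 0 (t : ℤ) := by
      rw [tmono_mul]; push_cast; simp
    simp only [hG, hA, e]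
    ring
  rw [h1, ← Finset.sum_filter_add_sum_filter_not _ (fun x : ℕ × ℕ => j - x.1 + x.2 < m)]
  refine Submodule.add_mem _ (Submodule.sum_mem _ fun x hx => ?_) ?_
  · rw [Finset.mem_filter] at hx
    simp only [hG, mul_sub]
    refine Submodule.sub_mem _ ?_ ?_
    · rw [mul_comm (star _)]
      exact wcT_mul_star_wcT_mem q q n _ _ hx.2
    · exact wcT_mul_star_wcT_mem q q n _ _ hx.2
  · have h2 : ∑ x ∈ Finset.range (j + 1) ×ˢ Finset.range (m + 1) with ¬ (j - x.1 + x.2 < m), G x = 0 := by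
      simp only [hG, mul_sub, Finset.sum_sub_distrib]
      rw [sub_eq_zero]
      -- The involution `(i, t) ↦ (m - t, m - i)` keeps the exponent `j - i + t` and exchanges the
      -- two products. It preserves `i ≤ j` because the exponent is at least `m`.
      refine Finset.sum_nbij' (fun x => (m - x.2, m - x.1)) (fun x => (m - x.2, m - x.1)) ?_ ?_ ?_ ?_ ?_
      · rintro ⟨i, t⟩ h
        simp only [Finset.mem_filter, Finset.mem_product, Finset.mem_range] at h ⊢
        omega
      · rintro ⟨i, t⟩ h
        simp only [Finset.mem_filter, Finset.mem_product, Finset.mem_range] at h ⊢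
        omega
      · rintro ⟨i, t⟩ h
        simp only [Finset.mem_filter, Finset.mem_product, Finset.mem_range] at h ⊢
        ext <;> simp <;> omega
      · rintro ⟨i, t⟩ h
        simp only [Finset.mem_filter, Finset.mem_product, Finset.mem_range] at h ⊢
        ext <;> simp <;> omega
      · rintro ⟨i, t⟩ h
        simp only [Finset.mem_filter, Finset.mem_product, Finset.mem_range] at h ⊢
        have e1 : m - (m - t) = t := by omega
        have e2 : m - (m - i) = i := by omega
        have e3 : j - (m - t) + (m - i) = j - i + t := by omega
        rw [e1, e2, e3, mul_comm (star _)]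
    rw [h2]; exact Submodule.zero_mem _

/-- After division by `|q|²`, the summand with `star (q.wcT (n + 1) i) * q.onTorus` becomes the
conjugate of a function `A i` with denominator `q`, and the one with `hatT` becomes a function `D i`
with denominator `q` and a positive power of `w`. The mean value property kills every `D i`, and
also `A i` for `i > j`. Hence the sum of `A i` over `i ≤ j` may be extended to all `i ≤ m`, where it
collapses to a monomial because `q/q = 1`. -/
theorem Stable.inner_tmono_cdT {n m : ℕ} {q : Poly2} (hq : q.Stable) (hb : q ∈ box (n + 1) (m + 1))
    (l l' : ℤ) {j j' : ℕ} (hj : j < m) (hj' : j' < m) :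
    inner ℂ (hq.J (tmono l' j')) (hq.J (tmono l 0 * q.cdT n m j))
      = if l' = l ∧ j' = j then 1 else 0 := by
  rw [hq.inner_J]
  set A : ℕ → C(Ang × Ang, ℂ) := fun i =>
    tmono (l' - l) ((j' : ℤ) - j + i) * q.wcT (n + 1) i * hq.invT with hA
  set D : ℕ → C(Ang × Ang, ℂ) := fun i =>
    tmono (l - l') ((j - i + (m - j') : ℕ) : ℤ) * q.wcT (n + 1) (m - i) * hq.invT with hD
  have hAsum : ∑ i ∈ Finset.range (m + 1), A i = tmono (l' - l) ((j' : ℤ) - j) := by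
    have h1 : ∀ i, A i = tmono (l' - l) ((j' : ℤ) - j) * (q.wcT (n + 1) i * tmono 0 i) * hq.invT := by
      intro i
      have : tmono (l' - l) ((j' : ℤ) - j + i) = tmono (l' - l) ((j' : ℤ) - j) * tmono 0 i := by
        rw [tmono_mul, add_zero]
      simp only [hA, this]; ring
    simp_rw [h1]
    rw [← Finset.sum_mul, ← Finset.mul_sum, ← onTorus_eq_sum hb]
    ext x
    have := hq.ne_zero x
    simp only [ContinuousMap.mul_apply, Stable.invT_apply]
    field_simp
  have hpt : ∀ x, (tmono l 0 * q.cdT n m j) x * (starRingEnd ℂ) (tmono l' j' x) * hq.invT x *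
      (starRingEnd ℂ) (hq.invT x)
      = ∑ i ∈ Finset.range (j + 1), ((starRingEnd ℂ) (A i x) - D i x) := by
    intro x
    simp only [cdT, ContinuousMap.mul_apply, ContinuousMap.sum_apply, Finset.mul_sum, Finset.sum_mul]
    refine Finset.sum_congr rfl fun i hi => ?_
    have hi' : i ≤ j := Nat.lt_succ_iff.1 (Finset.mem_range.1 hi)
    have hq0 := hq.ne_zero x
    have hq1 : (starRingEnd ℂ) (q.onTorus x) ≠ 0 := (map_ne_zero _).2 hq0
    have e1 : (starRingEnd ℂ) (tmono (l' - l) ((j' : ℤ) - j + i) x)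
        = tmono l 0 x * tmono 0 ((j - i : ℕ) : ℤ) x * (starRingEnd ℂ) (tmono l' j' x) := by
      rw [conj_tmono_apply, conj_tmono_apply, ← ContinuousMap.mul_apply, ← ContinuousMap.mul_apply,
        tmono_mul, tmono_mul]
      congr 2 <;> omega
    have e2 : tmono (l - l') ((j - i + (m - j') : ℕ) : ℤ) x
        = tmono l 0 x * tmono 0 ((j - i : ℕ) : ℤ) x * (starRingEnd ℂ) (tmono l' j' x) * tmono 0 m x := by
      rw [conj_tmono_apply, ← ContinuousMap.mul_apply, ← ContinuousMap.mul_apply,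
        ← ContinuousMap.mul_apply, tmono_mul, tmono_mul, tmono_mul]
      congr 2 <;> omega
    simp only [hA, hD, ContinuousMap.mul_apply, map_mul, ContinuousMap.sub_apply, hatT,
      ContinuousMap.star_apply, Stable.invT_apply, map_inv₀, e1, e2, RCLike.star_def]
    field_simp
  simp_rw [hpt]
  have hAint : ∀ i, Integrable (fun x => A i x) torusMeasure := fun i => integrable_torus (A i).continuous
  have hAint' : ∀ i, Integrable (fun x => (starRingEnd ℂ) (A i x)) torusMeasure :=
    fun i => integrable_torus (Complex.continuous_conj.comp (A i).continuous)
  have hDint : ∀ i, Integrable (fun x => D i x) torusMeasure := fun i => integrable_torus (D i).continuous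
  have hD0 : ∀ i, ∫ x, D i x ∂torusMeasure = 0 := by
    intro i
    have hc : Continuous fun x : Ang => circlePt x ^ (l - l') * q.wc (n + 1) (m - i) (circlePt x) :=
      (Continuous.zpow₀ (by fun_prop) _ fun x => Or.inl (circlePt_ne_zero _)).mul (by fun_prop)
    rw [← hq.integral_mul_inv_eq_zero hc (k := j - i + (m - j')) (by omega)]
    congr 1
    ext x
    simp only [hD, ContinuousMap.mul_apply, tmono_apply, wcT_apply, zpow_natCast]
    ring
  have hA0 : ∀ i, j < i → ∫ x, A i x ∂torusMeasure = 0 := by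
    intro i hi
    have hc : Continuous fun x : Ang => circlePt x ^ (l' - l) * q.wc (n + 1) i (circlePt x) :=
      (Continuous.zpow₀ (by fun_prop) _ fun x => Or.inl (circlePt_ne_zero _)).mul (by fun_prop)
    rw [← hq.integral_mul_inv_eq_zero hc (k := j' + i - j) (by omega)]
    congr 1
    ext x
    have e : (j' : ℤ) - j + i = ((j' + i - j : ℕ) : ℤ) := by omega
    simp only [hA, e, ContinuousMap.mul_apply, tmono_apply, wcT_apply, zpow_natCast]
    ring
  have hAtot : ∑ i ∈ Finset.range (j + 1), ∫ x, A i x ∂torusMeasure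
      = ∫ x, tmono (l' - l) ((j' : ℤ) - j) x ∂torusMeasure := by
    rw [← hAsum]
    simp only [ContinuousMap.sum_apply]
    rw [integral_finsetSum _ fun i _ => hAint i]
    refine Finset.sum_subset (fun i hi => ?_) fun i _ hi => hA0 i ?_
    · rw [Finset.mem_range] at hi ⊢; omega
    · rw [Finset.mem_range] at hi; omega
  have h2 : ∀ i, Integrable (fun x => (starRingEnd ℂ) (A i x) - D i x) torusMeasure :=
    fun i => (hAint' i).sub (hDint i)
  rw [integral_finsetSum _ fun i _ => h2 i]
  have h3 : ∀ i, ∫ x, ((starRingEnd ℂ) (A i x) - D i x) ∂torusMeasure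
      = (starRingEnd ℂ) (∫ x, A i x ∂torusMeasure) := by
    intro i
    rw [integral_sub (hAint' i) (hDint i), hD0, sub_zero, integral_conj]
  simp_rw [h3]
  rw [← map_sum, hAtot, integral_tmono]
  have : (l' - l = 0 ∧ (j' : ℤ) - j = 0) ↔ (l' = l ∧ j' = j) := by omega
  simp only [this]
  split_ifs <;> simp

end Poly2

/-! ### Orthogonality of the two complements -/

namespace Poly2

variable {q : Poly2}

theorem onTorus_eq_sum_mono {a b : ℕ} {f : Poly2} (hf : f ∈ box a b) :
    f.onTorus = ∑ i ∈ Finset.range a, ∑ j ∈ Finset.range b, f.cf i j • tmono i j := by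
  conv_lhs => rw [← ofCf_cf hf, ofCf]
  simp [onTorus_mono]

/-- A polynomial that is orthogonal to `box n m` is orthogonal to all lower frequencies in `z`. -/
theorem Stable.inner_tmono_eq_zero {n m : ℕ} (hq : q.Stable) (hb : q ∈ box (n + 1) (m + 1))
    {g : Poly2} (hg : g ∈ box (n + 1) m)
    (hgo : ∀ f ∈ box n m, inner ℂ (hq.J f.onTorus) (hq.J g.onTorus) = 0)
    {l : ℤ} (hl : l < n) {j : ℕ} (hj : j < m) :
    inner ℂ (hq.J (tmono l j)) (hq.J g.onTorus) = 0 := by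
  have hU : ∀ (l : ℤ) (j : Fin m), 0 ≤ l → l < n →
      inner ℂ (hq.J (tmono l (j : ℕ))) (hq.J g.onTorus) = 0 := by
    intro l j h0 h1
    have := hgo (mono l.toNat j) (mono_mem_box (by omega) j.2)
    rwa [onTorus_mono, Int.toNat_of_nonneg h0] at this
  by_cases h0 : 0 ≤ l
  · exact hU l ⟨j, hj⟩ h0 hl
  -- The functions `cdT` have `z`-frequencies in `[-n, n]`, so their translates form a system of
  -- bandwidth `n`.
  choose M hM using fun j : Fin m => exists_eq_sum_of_mem_trigBox (cdT_mem_trigBox hb j.2)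
  refine inner_eq_zero_of_banded_biorthogonal n (fun l (j : Fin m) => hq.J (tmono l (j : ℕ)))
    (fun l (j : Fin m) => hq.J (tmono l 0 * q.cdT n m j)) M
    (∑ j : Fin m, ‖hq.J (q.cdT n m j)‖) (‖hq.J 1‖) ?_ ?_ ?_ ?_ (hq.J g.onTorus) ?_ ?_ hU l ⟨j, hj⟩
    (not_le.1 h0)
  · intro l j l' j'
    rw [hq.inner_tmono_cdT hb l l' j.2 j'.2]
    simp only [Fin.ext_iff]
  · intro l j
    conv_lhs => rw [hM j]
    rw [Finset.mul_sum, map_sum]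
    refine Finset.sum_congr rfl fun s _ => ?_
    rw [Finset.mul_sum, map_sum]
    refine Finset.sum_congr rfl fun i _ => ?_
    rw [mul_smul_comm, tmono_mul, zero_add, map_smul]
  · intro l j
    rw [hq.norm_J_mul _ _ (norm_tmono_apply _ _)]
    exact Finset.single_le_sum (f := fun j : Fin m => ‖hq.J (q.cdT n m j)‖)
      (fun _ _ => norm_nonneg _) (Finset.mem_univ j)
  · intro l j
    conv_lhs => rw [← mul_one (tmono l (j : ℕ))]
    rw [hq.norm_J_mul _ _ (norm_tmono_apply _ _)]
  · intro j
    exact hq.tendsto_inner_tmono _ _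
  -- `g` involves only frequencies `i ≥ 0` in `z`, so biorthogonality makes it orthogonal to the
  -- dual vectors with `l < 0`.
  · intro l j hl'
    rw [onTorus_eq_sum_mono hg, map_sum, inner_sum]
    refine Finset.sum_eq_zero fun i _ => ?_
    rw [map_sum, inner_sum]
    refine Finset.sum_eq_zero fun t ht => ?_
    rw [map_smul, inner_smul_right, ← inner_conj_symm,
      hq.inner_tmono_cdT hb _ _ j.2 (Finset.mem_range.1 ht), if_neg (by omega)]
    simp

theorem Stable.wc_zero_ne_zero {n m : ℕ} (hq : q.Stable) (hb : q ∈ box (n + 1) (m + 1)) {z : ℂ}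
    (hz : ‖z‖ ≤ 1) : q.wc (n + 1) 0 z ≠ 0 := by
  rw [← at_zero_right hb]
  exact hq z 0 hz (by simp)

/-- The two orthogonal complements of `box n m`, in `box n (m + 1)` and in `box (n + 1) m`, are
orthogonal to each other. -/
theorem Stable.inner_eq_zero {n m : ℕ} (hq : q.Stable) (hb : q ∈ box (n + 1) (m + 1))
    {f g : Poly2} (hf : f ∈ box n (m + 1)) (hg : g ∈ box (n + 1) m)
    (hgo : ∀ f ∈ box n m, inner ℂ (hq.J f.onTorus) (hq.J g.onTorus) = 0) :
    inner ℂ (hq.J f.onTorus) (hq.J g.onTorus) = 0 := by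
  rcases Nat.eq_zero_or_pos n with rfl | hn
  · have : f = 0 := ext_cf fun i j => by
      by_contra h
      have := hf i j (by simpa using h)
      omega
    rw [this, map_zero, map_zero, inner_zero_left]
  -- It suffices to find a recurrence for these bounded numbers; the wanted inner product is `e 0`.
  -- Orthogonality of `f` to `box n m` plays no role.
  set e : ℕ → ℂ := fun k => inner ℂ (hq.J (tmono (-(k : ℤ)) 0 * f.onTorus)) (hq.J g.onTorus) with he
  have horth : ∀ u ∈ trigBox (-(n : ℤ)) ((n : ℤ) - 1) m, ∀ k : ℕ,
      inner ℂ (hq.J (tmono (-(k : ℤ)) 0 * u)) (hq.J g.onTorus) = 0 := by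
    intro u hu k
    obtain ⟨c, hc⟩ := exists_eq_sum_of_mem_trigBox (tmono_mul_mem_trigBox (-(k : ℤ)) hu)
    rw [hc, map_sum, sum_inner]
    refine Finset.sum_eq_zero fun s hs => ?_
    rw [map_sum, sum_inner]
    refine Finset.sum_eq_zero fun i _ => ?_
    rw [Finset.mem_Icc] at hs
    rw [map_smul, inner_smul_left, hq.inner_tmono_eq_zero hb hg hgo (by omega) i.2, mul_zero]
  -- On the torus `hatT / |q|² = w^m / q`, and `g` has degree less than `m` in `w`. The conjugate
  -- pairing integrates only positive powers of `w` against `1/q`, with coefficients depending on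
  -- `z`.
  have hhat : ∀ k : ℕ, inner ℂ (hq.J (tmono (-(k : ℤ)) 0 * (f.wcT n m * q.hatT m))) (hq.J g.onTorus) = 0 := by
    intro k
    rw [← inner_conj_symm, hq.inner_J]
    set D : ℕ → C(Ang × Ang, ℂ) := fun j =>
      tmono (-(k : ℤ)) ((m - j : ℕ) : ℤ) * star (g.wcT (n + 1) j) * f.wcT n m * hq.invT with hD
    have hpt : ∀ x, (tmono (-(k : ℤ)) 0 * (f.wcT n m * q.hatT m)) x * (starRingEnd ℂ) (g.onTorus x) *
        hq.invT x * (starRingEnd ℂ) (hq.invT x) = ∑ j ∈ Finset.range m, D j x := by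
      intro x
      rw [onTorus_eq_sum hg]
      simp only [ContinuousMap.mul_apply, ContinuousMap.sum_apply, map_sum, Finset.mul_sum,
        Finset.sum_mul]
      refine Finset.sum_congr rfl fun j hj => ?_
      rw [Finset.mem_range] at hj
      have hq0 := hq.ne_zero x
      have hq1 : (starRingEnd ℂ) (q.onTorus x) ≠ 0 := (map_ne_zero _).2 hq0
      have e1 : tmono (-(k : ℤ)) ((m - j : ℕ) : ℤ) x
          = tmono (-(k : ℤ)) 0 x * tmono 0 m x * (starRingEnd ℂ) (tmono 0 j x) := by
        rw [conj_tmono_apply, ← ContinuousMap.mul_apply, ← ContinuousMap.mul_apply, tmono_mul,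
          tmono_mul]
        congr 2 <;> omega
      simp only [hD, ContinuousMap.mul_apply, map_mul, hatT, ContinuousMap.star_apply,
        Stable.invT_apply, map_inv₀, e1, RCLike.star_def]
      field_simp
    simp_rw [hpt]
    rw [integral_finsetSum _ fun j _ => integrable_torus (D j).continuous, map_sum]
    refine Finset.sum_eq_zero fun j hj => ?_
    rw [Finset.mem_range] at hj
    have hc : Continuous fun x : Ang => circlePt x ^ (-(k : ℤ)) *
        (starRingEnd ℂ) (g.wc (n + 1) j (circlePt x)) * f.wc n m (circlePt x) :=
      ((Continuous.zpow₀ (by fun_prop) _ fun x => Or.inl (circlePt_ne_zero _)).mul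
        (Complex.continuous_conj.comp (by fun_prop))).mul (by fun_prop)
    have h1 := hq.integral_mul_inv_eq_zero hc (k := m - j) (by omega)
    rw [← map_zero (starRingEnd ℂ), ← h1]
    congr 2
    ext x
    simp only [hD, ContinuousMap.mul_apply, tmono_apply, wcT_apply, zpow_natCast,
      ContinuousMap.star_apply, RCLike.star_def]
    ring
  -- The multiples are chosen so that the `w^m` terms cancel. The difference has `w`-degree less
  -- than `m` and `z`-frequencies less than `n`, where `g` is already known to be orthogonal.
  have hdecomp : star (q.wcT (n + 1) 0) * f.onTorus - f.wcT n m * q.hatT m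
      ∈ trigBox (-(n : ℤ)) ((n : ℤ) - 1) m := by
    have hn1 : n - 1 + 1 = n := Nat.sub_add_cancel hn
    have hc : ((n - 1 : ℕ) : ℤ) = (n : ℤ) - 1 := by omega
    have e1 : star (q.wcT (n + 1) 0) * f.onTorus - f.wcT n m * q.hatT m
        = ∑ j ∈ Finset.range m, (tmono 0 j * (f.wcT n j * star (q.wcT (n + 1) 0))
          - tmono 0 j * (f.wcT n m * star (q.wcT (n + 1) (m - j)))) := by
      rw [onTorus_eq_sum hf, hatT_eq_sum hb, Finset.sum_range_succ, Finset.sum_range_succ,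
        Nat.sub_self, Finset.sum_sub_distrib, mul_add, mul_add, Finset.mul_sum, Finset.mul_sum]
      have e2 : ∀ j, star (q.wcT (n + 1) 0) * (f.wcT n j * tmono 0 j)
        = tmono 0 j * (f.wcT n j * star (q.wcT (n + 1) 0)) := fun j => by ring
      have e3 : ∀ j : ℕ, f.wcT n m * (star (q.wcT (n + 1) (m - j)) * tmono 0 j)
        = tmono 0 j * (f.wcT n m * star (q.wcT (n + 1) (m - j))) := fun j => by ring
      simp_rw [e2, e3]
      ring
    rw [e1]
    refine Submodule.sum_mem _ fun j hj => ?_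
    rw [Finset.mem_range] at hj
    rw [← hc]
    refine Submodule.sub_mem _ ?_ ?_
    · have := wcT_mul_star_wcT_mem f q n j 0 (b := n - 1) hj
      rwa [hn1] at this
    · have := wcT_mul_star_wcT_mem f q n m (m - j) (b := n - 1) hj
      rwa [hn1] at this
  -- Both pieces pair to zero with `g`, hence so does `z^{-k} conj(q(z,0)) f`. The inner product is
  -- conjugate linear on the left, so the coefficients of `q(z, 0)` appear unconjugated.
  have hrec : ∀ k : ℕ, ∑ s ∈ Finset.range (n + 1), q.cf s 0 * e (k + s) = 0 := by
    intro k
    have h1 := horth _ hdecomp k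
    rw [mul_sub, map_sub, inner_sub_left, hhat k, sub_zero, star_wcT, Finset.sum_mul, Finset.mul_sum,
      map_sum, sum_inner] at h1
    rw [← h1]
    refine Finset.sum_congr rfl fun s _ => ?_
    rw [smul_mul_assoc, mul_smul_comm, map_smul, inner_smul_left, Complex.conj_conj, ← mul_assoc,
      tmono_mul, add_zero, he]
    simp only
    congr 5
    push_cast
    ring
  -- The characteristic polynomial is `q(z, 0)`, whose roots lie outside the closed disk by
  -- stability. Its degree may be less than `n`.
  let F : Polynomial ℂ := ∑ s ∈ Finset.range (n + 1), Polynomial.C (q.cf s 0) * Polynomial.X ^ s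
  have hFc : ∀ s, F.coeff s = if s < n + 1 then q.cf s 0 else 0 := by
    intro s
    simp only [F, Polynomial.finsetSum_coeff, Polynomial.coeff_C_mul_X_pow]
    simp
  have hFe : ∀ z, F.eval z = q.wc (n + 1) 0 z := by
    intro z; simp [F, Polynomial.eval_finsetSum, wc]
  have hF0 : F ≠ 0 := by
    intro h
    apply hq.wc_zero_ne_zero hb (z := 0) (by simp)
    rw [← hFe, h, Polynomial.eval_zero]
  have hfin := eq_zero_of_bounded_of_recurrence F hF0 (fun z hz => by
      by_contra h
      exact hq.wc_zero_ne_zero hb (not_lt.1 h) (by rw [← hFe]; exact hz)) e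
    (‖hq.J f.onTorus‖ * ‖hq.J g.onTorus‖) (fun k => by
      refine (norm_inner_le_norm _ _).trans_eq ?_
      rw [hq.norm_J_mul _ _ (norm_tmono_apply _ _)]) (fun k => by
      rw [← hrec k]
      have hd : F.natDegree + 1 ≤ n + 1 := by
        refine Nat.succ_le_succ (Polynomial.natDegree_le_iff_coeff_eq_zero.2 fun N hN => ?_)
        rw [hFc, if_neg (by omega)]
      have h2 : ∑ s ∈ Finset.range (n + 1), q.cf s 0 * e (k + s)
          = ∑ s ∈ Finset.range (n + 1), F.coeff s * e (k + s) := by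
        refine Finset.sum_congr rfl fun s hs => ?_
        rw [hFc, if_pos (Finset.mem_range.1 hs)]
      rw [h2]
      refine Finset.sum_subset (Finset.range_mono hd) fun s _ hs => ?_
      rw [Finset.mem_range, not_lt] at hs
      rw [Polynomial.coeff_eq_zero_of_natDegree_lt hs, zero_mul]) 0
  rw [← hfin, he]
  simp only [Nat.cast_zero, neg_zero]
  congr 2
  have : tmono 0 0 = 1 := by ext x; simp
  rw [this, one_mul]

end Poly2

/-! ### Orthonormal bases and reproducing kernels -/

section Kernel

variable {V H : Type*} [AddCommGroup V] [Module ℂ V] [NormedAddCommGroup H] [InnerProductSpace ℂ H]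

theorem finrank_map_of_injective (Φ : V →ₗ[ℂ] H) (hΦ : Function.Injective Φ) (U : Submodule ℂ V) :
    Module.finrank ℂ (U.map Φ) = Module.finrank ℂ U :=
  (Submodule.equivMapOfInjective Φ hΦ U).finrank_eq.symm

/-- The basis of the orthogonal complement is lifted through `Φ`, so that in the application its
members are polynomials rather than classes in `L²`. -/
theorem exists_orthonormal_complement (Φ : V →ₗ[ℂ] H) (hΦ : Function.Injective Φ)
    {U S : Submodule ℂ V} [FiniteDimensional ℂ S] (hUS : U ≤ S) (k : ℕ)
    (hk : Module.finrank ℂ S = Module.finrank ℂ U + k) :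
    ∃ e : Fin k → V, (∀ i, e i ∈ S) ∧ Orthonormal ℂ (fun i => Φ (e i)) ∧
      ∀ u ∈ U, ∀ i, inner ℂ (Φ u) (Φ (e i)) = 0 := by
  have : FiniteDimensional ℂ U := Submodule.finiteDimensional_of_le hUS
  have h1 := Submodule.finrank_add_inf_finrank_orthogonal (𝕜 := ℂ) (Submodule.map_mono (f := Φ) hUS)
  rw [finrank_map_of_injective Φ hΦ, finrank_map_of_injective Φ hΦ, hk] at h1
  have h2 : Module.finrank ℂ ↥((U.map Φ)ᗮ ⊓ S.map Φ) = k := by omega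
  let b := (stdOrthonormalBasis ℂ ↥((U.map Φ)ᗮ ⊓ S.map Φ)).reindex (finCongr h2)
  have hb : ∀ i, ∃ v ∈ S, Φ v = (b i : H) := fun i => (b i).2.2
  choose e heS he using hb
  refine ⟨e, heS, ?_, ?_⟩
  · have := b.orthonormal
    have h3 : (fun i => Φ (e i)) = ((U.map Φ)ᗮ ⊓ S.map Φ).subtypeₗᵢ ∘ b := by
      ext i; simp [he]
    rw [h3]
    exact this.comp_linearIsometry _
  · intro u hu i
    rw [he]
    exact (b i).2.1 _ (Submodule.mem_map_of_mem hu)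

theorem eq_sum_inner_smul_of_orthonormal (Φ : V →ₗ[ℂ] H) (hΦ : Function.Injective Φ)
    {S : Submodule ℂ V} [FiniteDimensional ℂ S] {ι : Type*} [Fintype ι] {e : ι → V}
    (heS : ∀ i, e i ∈ S) (he : Orthonormal ℂ (fun i => Φ (e i)))
    (hcard : Fintype.card ι = Module.finrank ℂ S) {f : V} (hf : f ∈ S) :
    f = ∑ i, inner ℂ (Φ (e i)) (Φ f) • e i := by
  have h1 : Submodule.span ℂ (Set.range fun i => Φ (e i)) = S.map Φ := by
    refine Submodule.eq_of_le_of_finrank_eq ?_ ?_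
    · rw [Submodule.span_le]
      rintro _ ⟨i, rfl⟩
      exact Submodule.mem_map_of_mem (heS i)
    · rw [finrank_span_eq_card he.linearIndependent, finrank_map_of_injective Φ hΦ, hcard]
  have h2 : Φ f ∈ Submodule.span ℂ (Set.range fun i => Φ (e i)) := by
    rw [h1]; exact Submodule.mem_map_of_mem hf
  obtain ⟨c, hc⟩ := (Submodule.mem_span_range_iff_exists_fun ℂ).1 h2
  apply hΦ
  rw [map_sum]
  conv_lhs => rw [← hc]
  refine Finset.sum_congr rfl fun i _ => ?_
  rw [map_smul, ← hc, he.inner_right_fintype]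

/-- The diagonal of the reproducing kernel does not depend on the orthonormal basis. -/
theorem sum_norm_sq_eq_of_orthonormal (Φ : V →ₗ[ℂ] H) (hΦ : Function.Injective Φ)
    {S : Submodule ℂ V} [FiniteDimensional ℂ S] {ι ι' : Type*} [Fintype ι] [Fintype ι'] {e : ι → V}
    {e' : ι' → V} (heS : ∀ i, e i ∈ S) (he : Orthonormal ℂ (fun i => Φ (e i)))
    (hcard : Fintype.card ι = Module.finrank ℂ S) (heS' : ∀ i, e' i ∈ S)
    (he' : Orthonormal ℂ (fun i => Φ (e' i))) (hcard' : Fintype.card ι' = Module.finrank ℂ S)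
    (L : V →ₗ[ℂ] ℂ) : ∑ i, ‖L (e i)‖ ^ 2 = ∑ i, ‖L (e' i)‖ ^ 2 := by
  have h1 : ∀ i, L (e i) = ∑ j, inner ℂ (Φ (e' j)) (Φ (e i)) * L (e' j) := fun i => by
    conv_lhs => rw [eq_sum_inner_smul_of_orthonormal Φ hΦ heS' he' hcard' (heS i)]
    simp [map_sum]
  have h2 : ∀ j, L (e' j) = ∑ i, inner ℂ (Φ (e i)) (Φ (e' j)) * L (e i) := fun j => by
    conv_lhs => rw [eq_sum_inner_smul_of_orthonormal Φ hΦ heS he hcard (heS' j)]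
    simp [map_sum]
  -- Expand `L (e i)` in the second basis and regroup: the conjugated sum over `i` is the expansion
  -- of `L (e' j)` in the first.
  have h3 : (∑ i, L (e i) * (starRingEnd ℂ) (L (e i))) = ∑ j, L (e' j) * (starRingEnd ℂ) (L (e' j)) := by
    calc (∑ i, L (e i) * (starRingEnd ℂ) (L (e i)))
        = ∑ i, ∑ j, inner ℂ (Φ (e' j)) (Φ (e i)) * L (e' j) * (starRingEnd ℂ) (L (e i)) := by
          refine Finset.sum_congr rfl fun i _ => ?_
          conv_lhs => lhs; rw [h1 i]
          rw [Finset.sum_mul]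
      _ = ∑ j, L (e' j) * (starRingEnd ℂ) (∑ i, inner ℂ (Φ (e i)) (Φ (e' j)) * L (e i)) := by
          rw [Finset.sum_comm]
          refine Finset.sum_congr rfl fun j _ => ?_
          rw [map_sum, Finset.mul_sum]
          refine Finset.sum_congr rfl fun i _ => ?_
          rw [map_mul, inner_conj_symm]; ring
      _ = _ := by simp_rw [← h2]
  simp only [Complex.mul_conj'] at h3
  exact_mod_cast h3

end Kernel

/-! ### The sum of squares formula for stable polynomials -/

namespace Poly2

theorem onTorus_injective : Function.Injective onTorus := by
  rw [← LinearMap.ker_eq_bot, LinearMap.ker_eq_bot']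
  intro f hf
  refine eq_zero_of_at_circle fun z w hz hw => ?_
  obtain ⟨x, rfl⟩ := circlePt_surj hz
  obtain ⟨y, rfl⟩ := circlePt_surj hw
  exact DFunLike.congr_fun hf (x, y)

/-- Evaluation at a point as a linear functional. -/
noncomputable def atL (z w : ℂ) : Poly2 →ₗ[ℂ] ℂ where
  toFun f := f.at z w
  map_add' f g := by simp
  map_smul' c f := by simp

theorem box_eq_zero_left {b : ℕ} {f : Poly2} (hf : f ∈ box 0 b) : f = 0 :=
  ext_cf fun i j => by
    by_contra h
    have := hf i j (by simpa using h)
    omega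

theorem box_eq_zero_right {a : ℕ} {f : Poly2} (hf : f ∈ box a 0) : f = 0 :=
  ext_cf fun i j => by
    by_contra h
    have := hf i j (by simpa using h)
    omega

@[simp] theorem refl_zero (N M : ℕ) : (0 : Poly2).refl N M = 0 := ext_cf fun i j => by simp [cf_refl]

/-- The degree in `z` is below `a`, so reflecting at `a` rather than `a - 1` gains a factor `z`. For
`a = 0` the truncated subtraction is harmless because `f = 0`. -/
theorem refl_succ_left {a M : ℕ} {f : Poly2} (hf : f ∈ box a (M + 1)) (z w : ℂ) :
    (f.refl a M).at z w = z * (f.refl (a - 1) M).at z w := by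
  rcases a with _ | a
  · simp [box_eq_zero_left hf]
  have h : f.refl (a + 1) M - mono 1 0 * f.refl a M = 0 := by
    refine eq_zero_of_at_circle fun z w hz hw => ?_
    rw [at_sub, at_mul, at_refl_circle hf hz hw,
      at_refl_circle (box_mono (Nat.le_succ _) le_rfl hf) hz hw]
    simp; ring
  rw [sub_eq_zero.1 h]; simp

theorem refl_succ_right {N b : ℕ} {f : Poly2} (hf : f ∈ box (N + 1) b) (z w : ℂ) :
    (f.refl N b).at z w = w * (f.refl N (b - 1)).at z w := by
  rcases b with _ | b
  · simp [box_eq_zero_right hf]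
  have h : f.refl N (b + 1) - mono 0 1 * f.refl N b = 0 := by
    refine eq_zero_of_at_circle fun z w hz hw => ?_
    rw [at_sub, at_mul, at_refl_circle hf hz hw,
      at_refl_circle (box_mono le_rfl (Nat.le_succ _) hf) hz hw]
    simp; ring
  rw [sub_eq_zero.1 h]; simp

theorem onTorus_refl {N M : ℕ} {f : Poly2} (hf : f ∈ box (N + 1) (M + 1)) :
    (f.refl N M).onTorus = tmono N M * star f.onTorus := by
  ext x
  simp [at_refl_circle hf]

variable {q : Poly2}

/-- Reflection is conjugation times a unimodular monomial on the torus, hence antiunitary; this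
exchanges the arguments. -/
theorem Stable.inner_refl (hq : q.Stable) {N M : ℕ} {f g : Poly2} (hf : f ∈ box (N + 1) (M + 1))
    (hg : g ∈ box (N + 1) (M + 1)) :
    inner ℂ (hq.J (f.refl N M).onTorus) (hq.J (g.refl N M).onTorus)
      = inner ℂ (hq.J g.onTorus) (hq.J f.onTorus) := by
  rw [onTorus_refl hf, onTorus_refl hg, hq.inner_J_mul _ _ _ (norm_tmono_apply _ _), hq.inner_J,
    hq.inner_J]
  congr 1
  ext x
  simp only [ContinuousMap.star_apply, RCLike.star_def, Complex.conj_conj]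
  ring

/-- The map `f ↦ f / q` from polynomials to square integrable functions on the torus. -/
noncomputable def Stable.Φ (hq : q.Stable) : Poly2 →ₗ[ℂ] Lp ℂ 2 torusMeasure := hq.J ∘ₗ onTorus

theorem Stable.Φ_injective (hq : q.Stable) : Function.Injective hq.Φ :=
  hq.J_injective.comp onTorus_injective

theorem Stable.orthonormal_refl (hq : q.Stable) {N M : ℕ} {ι : Type*} {e : ι → Poly2}
    (heS : ∀ i, e i ∈ box (N + 1) (M + 1)) (he : Orthonormal ℂ fun i => hq.Φ (e i)) :
    Orthonormal ℂ fun i => hq.Φ ((e i).refl N M) := by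
  classical
  rw [orthonormal_iff_ite] at he ⊢
  intro i j
  have h1 := hq.inner_refl (heS i) (heS j)
  have h2 := he j i
  simp only [Stable.Φ, LinearMap.comp_apply] at h2 ⊢
  rw [h1, h2]
  simp [eq_comm]

/-- The diagonal of the kernel of `box a b` is invariant under reflection. -/
theorem Stable.sum_norm_sq_refl (hq : q.Stable) {a b : ℕ} {ι : Type*} [Fintype ι] {e : ι → Poly2}
    (heS : ∀ i, e i ∈ box a b) (he : Orthonormal ℂ fun i => hq.Φ (e i))
    (hcard : Fintype.card ι = a * b) (z w : ℂ) :
    ∑ i, ‖(e i).at z w‖ ^ 2 = ∑ i, ‖((e i).refl (a - 1) (b - 1)).at z w‖ ^ 2 := by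
  rcases a with _ | a
  · simp [box_eq_zero_left (heS _)]
  rcases b with _ | b
  · simp [box_eq_zero_right (heS _)]
  exact sum_norm_sq_eq_of_orthonormal hq.Φ hq.Φ_injective heS he (by rw [hcard, finrank_box])
    (fun i => refl_mem_box a b (e i)) (hq.orthonormal_refl heS he) (by rw [hcard, finrank_box]) (atL z w)

/-- On the torus `q~ / |q|² = z^n w^m / q`. The pairing is the integral of `z^(n-i) w^(m-j) / q`,
which the mean value property kills unless both exponents are zero. -/
theorem Stable.inner_mono_refl (hq : q.Stable) {n m : ℕ} (hb : q ∈ box (n + 1) (m + 1)) {i j : ℕ}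
    (hi : i ≤ n) (hj : j ≤ m) (hij : i < n ∨ j < m) :
    inner ℂ (hq.Φ (mono i j)) (hq.Φ (q.refl n m)) = 0 := by
  simp only [Stable.Φ, LinearMap.comp_apply]
  rw [hq.inner_J, onTorus_refl hb, onTorus_mono]
  have h1 : ∀ x, (tmono n m * star q.onTorus) x * (starRingEnd ℂ) (tmono i j x) * hq.invT x *
      (starRingEnd ℂ) (hq.invT x) = circlePt x.1 ^ (n - i) * circlePt x.2 ^ (m - j) * hq.invT x := by
    intro x
    have hq1 : (starRingEnd ℂ) (q.onTorus x) ≠ 0 := (map_ne_zero _).2 (hq.ne_zero x)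
    have e1 : circlePt x.1 ^ (n - i) * circlePt x.2 ^ (m - j)
        = tmono n m x * (starRingEnd ℂ) (tmono i j x) := by
      rw [conj_tmono_apply, ← ContinuousMap.mul_apply, tmono_mul, tmono_apply, ← zpow_natCast,
        ← zpow_natCast]
      congr 2 <;> omega
    rw [e1]
    simp only [ContinuousMap.mul_apply, ContinuousMap.star_apply, Stable.invT_apply, RCLike.star_def,
      map_inv₀]
    field_simp
  simp_rw [h1]
  by_cases h : j < m
  · exact hq.integral_mul_inv_eq_zero (h := fun x => circlePt x ^ (n - i)) (by fun_prop) (by omega)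
  · have : m - j = 0 := by omega
    simp only [this, pow_zero, mul_one]
    exact hq.integral_pow_mul_inv (by omega)

theorem Stable.inner_refl_eq_zero (hq : q.Stable) {n m a b : ℕ} (hb : q ∈ box (n + 1) (m + 1))
    (ha : a ≤ n + 1) (hb' : b ≤ m + 1) (hab : a ≤ n ∨ b ≤ m) {f : Poly2} (hf : f ∈ box a b) :
    inner ℂ (hq.Φ f) (hq.Φ (q.refl n m)) = 0 := by
  rw [← ofCf_cf hf, ofCf, map_sum, sum_inner]
  refine Finset.sum_eq_zero fun i hi => ?_
  rw [map_sum, sum_inner]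
  refine Finset.sum_eq_zero fun j hj => ?_
  rw [Finset.mem_range] at hi hj
  rw [map_smul, inner_smul_left, hq.inner_mono_refl hb (by omega) (by omega) (by omega), mul_zero]

theorem Stable.norm_refl (hq : q.Stable) {n m : ℕ} (hb : q ∈ box (n + 1) (m + 1)) :
    ‖hq.Φ (q.refl n m)‖ = 1 := by
  have h1 : inner ℂ (hq.Φ (q.refl n m)) (hq.Φ (q.refl n m)) = 1 := by
    simp only [Stable.Φ, LinearMap.comp_apply]
    rw [hq.inner_refl hb hb, hq.inner_J]
    have : ∀ x, q.onTorus x * (starRingEnd ℂ) (q.onTorus x) * hq.invT x * (starRingEnd ℂ) (hq.invT x)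
        = 1 := by
      intro x
      have hq0 := hq.ne_zero x
      have hq1 : (starRingEnd ℂ) (q.onTorus x) ≠ 0 := (map_ne_zero _).2 hq0
      simp only [Stable.invT_apply, map_inv₀]
      field_simp
    simp_rw [this]
    simp
  rw [@norm_eq_sqrt_re_inner ℂ, h1]; simp

/-- The sum of squares formula for a polynomial without zeros on the closed bidisk. -/
theorem Stable.exists_sum_of_squares (hq : q.Stable) {n m : ℕ} (hb : q ∈ box (n + 1) (m + 1)) :
    ∃ (P : Fin n → Poly2) (Q : Fin m → Poly2), (∀ i, P i ∈ box n (m + 1)) ∧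
      (∀ j, Q j ∈ box (n + 1) m) ∧ ∀ z w : ℂ,
        ‖q.at z w‖ ^ 2 - ‖(q.refl n m).at z w‖ ^ 2
          = (1 - ‖z‖ ^ 2) * vecNormSq P z w + (1 - ‖w‖ ^ 2) * vecNormSq Q z w := by
  obtain ⟨u, huS, hu, -⟩ := exists_orthonormal_complement hq.Φ hq.Φ_injective
    (bot_le : ⊥ ≤ box n m) (n * m) (by rw [finrank_box, finrank_bot, zero_add])
  obtain ⟨e, heS, he, heo⟩ := exists_orthonormal_complement hq.Φ hq.Φ_injective
    (box_mono le_rfl (Nat.le_succ m) : box n m ≤ box n (m + 1)) n (by rw [finrank_box, finrank_box]; ring)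
  obtain ⟨g, hgS, hg, hgo⟩ := exists_orthonormal_complement hq.Φ hq.Φ_injective
    (box_mono (Nat.le_succ n) le_rfl : box n m ≤ box (n + 1) m) m (by rw [finrank_box, finrank_box]; ring)
  -- This orthogonality is what lets the two complements be combined into one orthonormal system.
  have heg : ∀ i j, inner ℂ (hq.Φ (e i)) (hq.Φ (g j)) = 0 := fun i j =>
    hq.inner_eq_zero hb (heS i) (hgS j) fun f hf => hgo f hf j
  have hsum : ∀ {α β : Type} (x : α → Poly2) (y : β → Poly2), Orthonormal ℂ (fun i => hq.Φ (x i)) →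
      Orthonormal ℂ (fun i => hq.Φ (y i)) → (∀ i j, inner ℂ (hq.Φ (x i)) (hq.Φ (y j)) = 0) →
      Orthonormal ℂ (fun i => hq.Φ (Sum.elim x y i)) := by
    intro α β x y hx hy hxy
    refine ⟨?_, ?_⟩
    · rintro (i | j)
      · exact hx.1 i
      · exact hy.1 j
    · rintro (i | i) (j | j) hij
      · exact hx.2 (fun h => hij (by rw [h]))
      · exact hxy i j
      · rw [← inner_conj_symm]; simp [hxy]
      · exact hy.2 (fun h => hij (by rw [h]))
  have hue := hsum u e hu he fun i j => heo _ (huS i) j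
  have hug := hsum u g hu hg fun i j => hgo _ (huS i) j
  have hueg := hsum (Sum.elim u e) g hue hg (by
    rintro (i | i) j
    · exact hgo _ (huS i) j
    · exact heg i j)
  have hueS : ∀ i, Sum.elim u e i ∈ box n (m + 1) := by
    rintro (i | i)
    · exact box_mono le_rfl (Nat.le_succ m) (huS i)
    · exact heS i
  have hugS : ∀ i, Sum.elim u g i ∈ box (n + 1) m := by
    rintro (i | i)
    · exact box_mono (Nat.le_succ n) le_rfl (huS i)
    · exact hgS i
  -- The system has `nm + n + m + 1 = (n+1)(m+1)` members, so it is a basis of the full box.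
  have hall := hsum (Sum.elim (Sum.elim u e) g) (fun _ : Unit => q.refl n m) hueg
    ⟨fun _ => hq.norm_refl hb, fun i j hij => (hij (Subsingleton.elim i j)).elim⟩ (by
      rintro (i | j) _
      · exact hq.inner_refl_eq_zero hb (Nat.le_succ n) le_rfl (Or.inl le_rfl) (hueS i)
      · exact hq.inner_refl_eq_zero hb le_rfl (Nat.le_succ m) (Or.inr le_rfl) (hgS j))
  have hallS : ∀ i, Sum.elim (Sum.elim (Sum.elim u e) g) (fun _ : Unit => q.refl n m) i
      ∈ box (n + 1) (m + 1) := by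
    rintro ((i | i) | i)
    · exact box_mono (Nat.le_succ n) le_rfl (hueS i)
    · exact box_mono le_rfl (Nat.le_succ m) (hgS i)
    · exact refl_mem_box n m q
  refine ⟨e, fun j => (g j).refl n (m - 1), heS, fun j => ?_, fun z w => ?_⟩
  · have hm : m - 1 + 1 = m := by have := j.2; omega
    have := refl_mem_box n (m - 1) (g j)
    rwa [hm] at this
  -- For each of the four boxes the kernel diagonal is computed from a basis and from its
  -- reflection. Rewriting all reflections at the smallest admissible degree exposes the factors
  -- `|z|²` and `|w|²`, after which the kernel of `box n m` can be eliminated.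
  have k0 := hq.sum_norm_sq_refl huS hu (by simp) z w
  have k1 := hq.sum_norm_sq_refl hueS hue (by simp; ring) z w
  have k2 := hq.sum_norm_sq_refl hugS hug (by simp; ring) z w
  have k3 := hq.sum_norm_sq_refl hallS hall (by simp; ring) z w
  simp only [Fintype.sum_sum_type, Sum.elim_inl, Sum.elim_inr, Nat.add_sub_cancel, Finset.univ_unique,
    Finset.sum_singleton, refl_refl hb] at k1 k2 k3
  have r1 : ∀ i, ((u i).refl (n - 1) m).at z w = w * ((u i).refl (n - 1) (m - 1)).at z w := fun i =>
    refl_succ_right (box_mono (by omega) le_rfl (huS i)) z w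
  have r2 : ∀ i, ((u i).refl n (m - 1)).at z w = z * ((u i).refl (n - 1) (m - 1)).at z w := fun i =>
    refl_succ_left (box_mono le_rfl (by omega) (huS i)) z w
  have r3 : ∀ i, ((u i).refl n m).at z w = z * (w * ((u i).refl (n - 1) (m - 1)).at z w) := fun i => by
    rw [← r1]
    exact refl_succ_left (box_mono le_rfl (by omega) (huS i)) z w
  have r4 : ∀ i, ((e i).refl n m).at z w = z * ((e i).refl (n - 1) m).at z w := fun i =>
    refl_succ_left (heS i) z w
  have r5 : ∀ i, ((g i).refl n m).at z w = w * ((g i).refl n (m - 1)).at z w := fun i =>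
    refl_succ_right (hgS i) z w
  simp only [r1, r2, r3, r4, r5, norm_mul, mul_pow, ← Finset.mul_sum] at k0 k1 k2 k3
  simp only [vecNormSq]
  linear_combination (-1) * k3 + k1 * ‖z‖ ^ 2 + k2 - ‖z‖ ^ 2 * k0
end Poly2

/-! ### Leading coefficients and self-reflection for distinguished varieties -/

namespace Poly2

/-- Exchange of the two variables. -/
noncomputable def swap (f : Poly2) : Poly2 := rename (Equiv.swap 0 1) f

@[simp] theorem at_swap (f : Poly2) (z w : ℂ) : f.swap.at z w = f.at w z := by
  rw [Poly2.at, swap, eval_rename, Poly2.at]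
  have : (![z, w] : Fin 2 → ℂ) ∘ (Equiv.swap 0 1 : Equiv.Perm (Fin 2)) = ![w, z] := by
    ext k; fin_cases k <;> simp
  rw [this]

theorem hasDegree_swap {f : Poly2} {n m : ℕ} (h : f.HasDegree n m) : f.swap.HasDegree m n := by
  have h0 := degreeOf_rename_of_injective (p := f) (Equiv.swap (0 : Fin 2) 1).injective 1
  have h1 := degreeOf_rename_of_injective (p := f) (Equiv.swap (0 : Fin 2) 1).injective 0
  simp only [Equiv.swap_apply_right, Equiv.swap_apply_left] at h0 h1
  exact ⟨h0.trans h.2, h1.trans h.1⟩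

theorem DefinesDistinguishedVariety.cases {p : Poly2} (hp : p.DefinesDistinguishedVariety) {z w : ℂ}
    (h : p.at z w = 0) : (‖z‖ < 1 ∧ ‖w‖ < 1) ∨ (‖z‖ = 1 ∧ ‖w‖ = 1) ∨ (1 < ‖z‖ ∧ 1 < ‖w‖) := by
  have := hp (show (z, w) ∈ p.zeroSet from h)
  simpa [openDisk, unitTorus, exteriorDisk, or_assoc] using this

theorem definesDistinguishedVariety_iff {p : Poly2} : p.DefinesDistinguishedVariety ↔ ∀ z w : ℂ,
    p.at z w = 0 → (‖z‖ < 1 ∧ ‖w‖ < 1) ∨ (‖z‖ = 1 ∧ ‖w‖ = 1) ∨ (1 < ‖z‖ ∧ 1 < ‖w‖) := by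
  refine ⟨fun hp z w h => hp.cases h, fun h => ?_⟩
  rintro ⟨z, w⟩ hx
  simpa [openDisk, unitTorus, exteriorDisk, or_assoc] using h z w hx

theorem DefinesDistinguishedVariety.swap {p : Poly2} (hp : p.DefinesDistinguishedVariety) :
    p.swap.DefinesDistinguishedVariety := by
  rw [definesDistinguishedVariety_iff]
  intro z w h
  rw [at_swap] at h
  have := hp.cases h
  tauto

theorem mem_box_of_hasDegree {f : Poly2} {n m : ℕ} (h : f.HasDegree n m) : f ∈ box (n + 1) (m + 1) :=
  mem_box_of_hasDegreeAtMost ⟨h.1.le, h.2.le⟩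

/-- The one-variable polynomial `p(z, ·)`. -/
noncomputable def slice (f : Poly2) (a b : ℕ) (z : ℂ) : Polynomial ℂ :=
  ∑ j ∈ Finset.range b, Polynomial.C (f.wc a j z) * Polynomial.X ^ j

theorem eval_slice {a b : ℕ} {f : Poly2} (hf : f ∈ box a b) (z w : ℂ) :
    (f.slice a b z).eval w = f.at z w := by
  simp [slice, Polynomial.eval_finsetSum, at_eq_sum_wc hf]

theorem coeff_slice (f : Poly2) (a b : ℕ) (z : ℂ) (j : ℕ) :
    (f.slice a b z).coeff j = if j < b then f.wc a j z else 0 := by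
  simp [slice, Polynomial.finsetSum_coeff]

theorem natDegree_slice {f : Poly2} {a b : ℕ} {z : ℂ} (h : f.wc a b z ≠ 0) :
    (f.slice a (b + 1) z).natDegree = b := by
  refine Polynomial.natDegree_eq_of_le_of_coeff_ne_zero ?_ (by rw [coeff_slice]; simpa using h)
  refine Polynomial.natDegree_le_iff_coeff_eq_zero.2 fun N hN => ?_
  rw [coeff_slice, if_neg (by omega)]

theorem slice_eq_prod {f : Poly2} {a b : ℕ} {z : ℂ} (h : f.wc a b z ≠ 0) :
    f.slice a (b + 1) z = Polynomial.C (f.wc a b z) *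
      ((f.slice a (b + 1) z).roots.map fun r => Polynomial.X - Polynomial.C r).prod ∧
    (f.slice a (b + 1) z).roots.card = b := by
  have hs := IsAlgClosed.splits (f.slice a (b + 1) z)
  have hl : (f.slice a (b + 1) z).leadingCoeff = f.wc a b z := by
    rw [Polynomial.leadingCoeff, natDegree_slice h, coeff_slice, if_pos (Nat.lt_succ_self b)]
  refine ⟨?_, ?_⟩
  · conv_lhs => rw [hs.eq_prod_roots]
    rw [hl]
  · exact hs.natDegree_eq_card_roots.symm.trans (natDegree_slice h)

theorem finite_wc_zero {f : Poly2} {a j : ℕ} (h : ∃ i < a, f.cf i j ≠ 0) :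
    {z : ℂ | f.wc a j z = 0}.Finite := by
  obtain ⟨i, hi, h⟩ := h
  let F : Polynomial ℂ := ∑ s ∈ Finset.range a, Polynomial.C (f.cf s j) * Polynomial.X ^ s
  have hF : F ≠ 0 := by
    intro h0
    apply h
    have := congrArg (fun G => Polynomial.coeff G i) h0
    simpa [F, Polynomial.finsetSum_coeff, Polynomial.coeff_C_mul_X_pow, hi] using this
  refine (F.roots.toFinset.finite_toSet).subset fun z hz => ?_
  simp only [Finset.mem_coe, Multiset.mem_toFinset, Polynomial.mem_roots hF, Polynomial.IsRoot]
  simpa [F, Polynomial.eval_finsetSum, wc] using hz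

theorem exists_cf_ne_zero {p : Poly2} {n m : ℕ} (hdeg : p.HasDegree n m) (hp : p ≠ 0) :
    ∃ i < n + 1, p.cf i m ≠ 0 := by
  by_contra! h
  have hb : p ∈ box (n + 1) m := by
    intro i j hij
    have h1 := mem_box_of_hasDegree hdeg i j hij
    refine ⟨h1.1, lt_of_le_of_ne (Nat.lt_succ_iff.1 h1.2) ?_⟩
    rintro rfl
    exact hij (h i h1.1)
  rcases m with _ | m
  · exact hp (box_eq_zero_right hb)
  · have := (hasDegreeAtMost_of_mem_box hb).2
    rw [hdeg.2] at this
    omega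

variable {p : Poly2} {n m : ℕ}

/-- A line `{z} × ℂ` contained in `V` would contain `(z, 0)` and `(z, 2)`, forcing both `|z| < 1`
and `|z| > 1`. -/
theorem DefinesDistinguishedVariety.exists_at_ne_zero (hp : p.DefinesDistinguishedVariety) (z : ℂ) :
    ∃ w, p.at z w ≠ 0 := by
  by_contra! h
  have h0 := hp.cases (h 0)
  have h2 := hp.cases (h 2)
  norm_num at h0 h2
  linarith

/-- The leading coefficient in `w` has no zeros on the closed unit disk. -/
theorem DefinesDistinguishedVariety.wc_ne_zero (hp : p.DefinesDistinguishedVariety)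
    (hdeg : p.HasDegree n m) {z : ℂ} (hz : ‖z‖ ≤ 1) : p.wc (n + 1) m z ≠ 0 := by
  have hb := mem_box_of_hasDegree hdeg
  have hp0 : p ≠ 0 := by
    rintro rfl
    obtain ⟨w, hw⟩ := hp.exists_at_ne_zero 0
    simp at hw
  -- For `|z| < 1` all roots of `p(z, ·)` lie in the disk, so every factor satisfies `|w - r| ≤ 1 +
  -- |w|`.
  have hbound : ∀ w, ∀ z ∈ Metric.ball (0 : ℂ) 1 ∩ {z | p.wc (n + 1) m z = 0}ᶜ,
      ‖p.at z w‖ ≤ ‖p.wc (n + 1) m z‖ * (1 + ‖w‖) ^ m := by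
    rintro w z ⟨hz1, hz2⟩
    obtain ⟨h1, h2⟩ := slice_eq_prod (a := n + 1) (b := m) (z := z) hz2
    rw [← eval_slice hb]
    conv_lhs => rw [h1]
    rw [Polynomial.eval_mul, Polynomial.eval_C, norm_mul, Polynomial.eval_multiset_prod,
      Multiset.map_map]
    gcongr
    conv_rhs => rw [← h2]
    have hroots : ∀ r ∈ (p.slice (n + 1) (m + 1) z).roots, ‖w - r‖ ≤ 1 + ‖w‖ := by
      intro r hr
      have h3 : p.at z r = 0 := by rw [← eval_slice hb]; exact Polynomial.isRoot_of_mem_roots hr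
      rw [Metric.mem_ball, dist_zero_right] at hz1
      have h4 := hp.cases h3
      have : ‖r‖ < 1 := by
        rcases h4 with h | h | h
        · exact h.2
        · linarith [h.1]
        · linarith [h.1]
      linarith [norm_sub_le w r]
    generalize (p.slice (n + 1) (m + 1) z).roots = s at hroots
    clear h1 h2
    induction s using Multiset.induction_on with
    | empty => simp
    | cons r s ih =>
      rw [Multiset.map_cons, Multiset.prod_cons, norm_mul, Multiset.card_cons, pow_succ']
      have hr := hroots r (Multiset.mem_cons_self r s)
      have ih' := ih fun r' hr' => hroots r' (Multiset.mem_cons_of_mem hr')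
      simp only [Function.comp, Polynomial.eval_sub, Polynomial.eval_X, Polynomial.eval_C] at ih' ⊢
      gcongr
  -- By density the bound holds on the closed disk. A zero of the leading coefficient there would
  -- make `p(z, ·)` vanish identically.
  have hdense : Dense {z : ℂ | p.wc (n + 1) m z = 0}ᶜ :=
    (finite_wc_zero (exists_cf_ne_zero hdeg hp0)).countable.dense_compl ℝ
  have hcl : z ∈ closure (Metric.ball (0 : ℂ) 1 ∩ {z | p.wc (n + 1) m z = 0}ᶜ) := by
    have h1 : Metric.ball (0 : ℂ) 1 ⊆ closure (Metric.ball (0 : ℂ) 1 ∩ {z | p.wc (n + 1) m z = 0}ᶜ) :=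
      hdense.open_subset_closure_inter Metric.isOpen_ball
    refine closure_minimal h1 isClosed_closure ?_
    rw [closure_ball _ one_ne_zero]
    simpa using hz
  intro h0
  obtain ⟨w, hw⟩ := hp.exists_at_ne_zero z
  apply hw
  have h1 : z ∈ {z | ‖p.at z w‖ ≤ ‖p.wc (n + 1) m z‖ * (1 + ‖w‖) ^ m} :=
    closure_minimal (hbound w) (isClosed_le
      (f := fun z => ‖p.at z w‖) (g := fun z => ‖p.wc (n + 1) m z‖ * (1 + ‖w‖) ^ m)
      (by fun_prop) (by fun_prop)) hcl
  rw [Set.mem_ofPred_eq, h0] at h1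
  simpa using h1

/-- On the torus, `p(z, ·)` is self-reflective up to a constant. -/
theorem DefinesDistinguishedVariety.exists_conj_eq (hp : p.DefinesDistinguishedVariety)
    (hdeg : p.HasDegree n m) {z : ℂ} (hz : ‖z‖ = 1) :
    ∃ c : ℂ, ∀ w : ℂ, ‖w‖ = 1 → w ^ m * (starRingEnd ℂ) (p.at z w) = c * p.at z w := by
  have hb := mem_box_of_hasDegree hdeg
  have hL := hp.wc_ne_zero hdeg hz.le
  obtain ⟨h1, h2⟩ := slice_eq_prod hL
  have hroots : ∀ r ∈ (p.slice (n + 1) (m + 1) z).roots, ‖r‖ = 1 := by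
    intro r hr
    have h3 : p.at z r = 0 := by rw [← eval_slice hb]; exact Polynomial.isRoot_of_mem_roots hr
    rcases hp.cases h3 with h | h | h
    · linarith [h.1]
    · exact h.2
    · linarith [h.1]
  have hat : ∀ w, p.at z w = p.wc (n + 1) m z *
      ((p.slice (n + 1) (m + 1) z).roots.map fun r => w - r).prod := by
    intro w
    rw [← eval_slice hb]
    conv_lhs => rw [h1]
    rw [Polynomial.eval_mul, Polynomial.eval_C, Polynomial.eval_multiset_prod, Multiset.map_map]
    simp
  -- For `|r| = |w| = 1` one has `w * conj (w - r) = -conj r * (w - r)`; multiply over the roots.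
  have key : ∀ s : Multiset ℂ, (∀ r ∈ s, ‖r‖ = 1) → ∃ c : ℂ, ∀ w : ℂ, ‖w‖ = 1 →
      w ^ s.card * (starRingEnd ℂ) (s.map fun r => w - r).prod = c * (s.map fun r => w - r).prod := by
    intro s
    induction s using Multiset.induction_on with
    | empty => intro _; exact ⟨1, by simp⟩
    | cons r s ih =>
      intro hs
      obtain ⟨c, hc⟩ := ih fun r' hr' => hs r' (Multiset.mem_cons_of_mem hr')
      have hr := hs r (Multiset.mem_cons_self r s)
      refine ⟨c * (-(starRingEnd ℂ) r), fun w hw => ?_⟩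
      have e1 : w * (starRingEnd ℂ) w = 1 := by rw [Complex.mul_conj', hw]; simp
      have e2 : r * (starRingEnd ℂ) r = 1 := by rw [Complex.mul_conj', hr]; simp
      rw [Multiset.map_cons, Multiset.prod_cons, Multiset.card_cons, map_mul, map_sub, pow_succ]
      have := hc w hw
      linear_combination (w * ((starRingEnd ℂ) w - (starRingEnd ℂ) r)) * this
        + c * (s.map fun r => w - r).prod * (e1 - e2)
  obtain ⟨c, hc⟩ := key _ hroots
  rw [h2] at hc
  refine ⟨(starRingEnd ℂ) (p.wc (n + 1) m z) * c / p.wc (n + 1) m z, fun w hw => ?_⟩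
  rw [hat, map_mul]
  have := hc w hw
  field_simp
  linear_combination (starRingEnd ℂ) (p.wc (n + 1) m z) * this

/-- A polynomial defining a distinguished variety is self-reflective up to a constant. -/
theorem DefinesDistinguishedVariety.exists_refl_eq (hp : p.DefinesDistinguishedVariety)
    (hdeg : p.HasDegree n m) : ∃ c : ℂ, ‖c‖ = 1 ∧ p.refl n m = c • p := by
  have hb := mem_box_of_hasDegree hdeg
  have hne : p ≠ 0 := by
    rintro rfl
    obtain ⟨w, hw⟩ := hp.exists_at_ne_zero 0
    simp at hw
  obtain ⟨z₀, w₀, hz₀, hw₀, h0⟩ : ∃ z w : ℂ, ‖z‖ = 1 ∧ ‖w‖ = 1 ∧ p.at z w ≠ 0 := by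
    by_contra! h
    exact hne (eq_zero_of_at_circle h)
  obtain ⟨d, hd⟩ := hp.exists_conj_eq hdeg hz₀
  set r : Poly2 := ofCf 1 (m + 1) fun _ j => p.wc (n + 1) j z₀ with hr
  have hrat : ∀ z w, r.at z w = p.at z₀ w := by
    intro z w
    rw [hr, at_ofCf, at_eq_sum_wc hb]; simp
  have hr0 : r ≠ 0 := by
    intro h
    apply h0
    rw [← hrat 0, h, at_zero]
  -- The proportionality factor depends on `w` alone by slicing in one direction. Comparing with the
  -- fixed slice `z₀` in the other direction shows that it is constant where `p(z₀, w) ≠ 0`;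
  -- multiplying by `r` avoids the exceptional points.
  have hmul : (p.refl n m - (z₀ ^ n * d) • p) * r = 0 := by
    refine eq_zero_of_at_circle fun z w hz hw => ?_
    obtain ⟨c, hc⟩ := hp.swap.exists_conj_eq (hasDegree_swap hdeg) hw
    simp only [at_swap] at hc
    rw [at_mul, at_sub, at_smul, hrat, at_refl_circle hb hz hw]
    have e1 := hc z hz
    have e2 := hc z₀ hz₀
    have e3 := hd w hw
    linear_combination w ^ m * p.at z₀ w * e1 - w ^ m * p.at z w * e2 + z₀ ^ n * p.at z w * e3
  have heq := sub_eq_zero.1 ((mul_eq_zero.1 hmul).resolve_right hr0)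
  refine ⟨z₀ ^ n * d, ?_, heq⟩
  have h1 := congrArg (fun f : Poly2 => ‖f.at z₀ w₀‖) heq
  simp only [at_smul, at_refl_circle hb hz₀ hw₀, norm_mul, norm_pow, hz₀, hw₀, one_pow, one_mul,
    RCLike.norm_conj] at h1 ⊢
  have h2 : 0 < ‖p.at z₀ w₀‖ := norm_pos_iff.2 h0
  exact (mul_right_cancel₀ h2.ne' (by rw [← h1, one_mul])).symm

end Poly2

/-! ### Stable dilations -/

namespace Poly2

/-- The reflection `w ^ (b - 1) * f (z, 1 / w)`. -/
noncomputable def flipW (a b : ℕ) (f : Poly2) : Poly2 := ofCf a b fun i j => f.cf i (b - 1 - j)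

theorem at_flipW {a b : ℕ} {f : Poly2} (hf : f ∈ box a b) (z : ℂ) {w : ℂ} (hw : w ≠ 0) :
    (f.flipW a b).at z w = w ^ (b - 1) * f.at z w⁻¹ := by
  rw [flipW, at_ofCf, at_eq_sum hf, Finset.mul_sum]
  refine Finset.sum_congr rfl fun i _ => ?_
  rw [Finset.mul_sum, ← Finset.sum_range_reflect]
  refine Finset.sum_congr rfl fun j hj => ?_
  rw [Finset.mem_range] at hj
  have e : b - 1 - (b - 1 - j) = j := by omega
  have h2 : w ^ (b - 1) = w ^ (b - 1 - j) * w ^ j := by rw [← pow_add, Nat.sub_add_cancel (by omega)]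
  rw [e, h2, inv_pow]
  field_simp

variable {p : Poly2} {n m : ℕ}

/-- The sum of squares formula for a dilation of a polynomial defining a distinguished variety. -/
theorem DefinesDistinguishedVariety.exists_sum_of_squares_dilation
    (hp : p.DefinesDistinguishedVariety) (hdeg : p.HasDegree n m) {α β : ℝ} (hα0 : 0 < α) (hα1 : α ≤ 1)
    (hβ0 : 0 < β) (hβ1 : β ≤ 1) (hαβ : α < 1 ∨ β < 1) :
    ∃ (P : Fin n → Poly2) (Q : Fin m → Poly2), (∀ i, P i ∈ box n (m + 1)) ∧
      (∀ j, Q j ∈ box (n + 1) m) ∧ ∀ z w : ℂ, w ≠ 0 →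
        β ^ (2 * m) * ‖p.at (α * z) ((β : ℂ)⁻¹ * w)‖ ^ 2
          - α ^ (2 * n) * ‖p.at ((α : ℂ)⁻¹ * z) (β * w)‖ ^ 2
          = (1 - ‖z‖ ^ 2) * vecNormSq P z w - (1 - ‖w‖ ^ 2) * vecNormSq Q z w := by
  have hb := mem_box_of_hasDegree hdeg
  have hα : (α : ℂ) ≠ 0 := by exact_mod_cast hα0.ne'
  have hβ : (β : ℂ) ≠ 0 := by exact_mod_cast hβ0.ne'
  -- This is `(βw)^m p(αz, 1/(βw))`, extended polynomially to `w = 0`.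
  set q : Poly2 := ofCf (n + 1) (m + 1) fun i j => p.cf i (m - j) * (α : ℂ) ^ i * (β : ℂ) ^ j with hq
  have hqb : q ∈ box (n + 1) (m + 1) := ofCf_mem_box _ _ _
  have hflip : ∀ z w, w ≠ 0 → (p.flipW (n + 1) (m + 1)).at z w = w ^ m * p.at z w⁻¹ := fun z w hw =>
    at_flipW hb z hw
  have hqflip : ∀ z w, q.at z w = (p.flipW (n + 1) (m + 1)).at (α * z) (β * w) := by
    intro z w
    rw [hq, flipW, at_ofCf, at_ofCf]
    refine Finset.sum_congr rfl fun i _ => Finset.sum_congr rfl fun j _ => ?_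
    simp only [Nat.add_sub_cancel, mul_pow]; ring
  have hq0 : ∀ z, q.at z 0 = p.wc (n + 1) m (α * z) := by
    intro z
    rw [at_zero_right hqb, wc, wc]
    refine Finset.sum_congr rfl fun i hi => ?_
    rw [hq, cf_ofCf, if_pos ⟨Finset.mem_range.1 hi, Nat.succ_pos _⟩]
    simp only [Nat.sub_zero, pow_zero, mul_pow]; ring
  -- At `w = 0` the value is the leading coefficient of `p`. Elsewhere a zero gives a point of `V`
  -- with `|αz| ≤ α ≤ 1 ≤ 1/β ≤ |1/(βw)|`, which must lie on the torus; then `α = β = 1`, which is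
  -- excluded.
  have hstable : q.Stable := by
    intro z w hz hw
    have hαz : ‖(α : ℂ) * z‖ ≤ α := by
      rw [norm_mul, Complex.norm_real, Real.norm_of_nonneg hα0.le]
      exact mul_le_of_le_one_right hα0.le hz
    by_cases hw0 : w = 0
    · rw [hw0, hq0]
      exact hp.wc_ne_zero hdeg (hαz.trans hα1)
    · have hβw0 : (β : ℂ) * w ≠ 0 := mul_ne_zero hβ hw0
      rw [hqflip, hflip _ _ hβw0]
      refine mul_ne_zero (pow_ne_zero _ hβw0) fun h0 => ?_
      have hβw : ‖(β : ℂ) * w‖ ≤ β := by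
        rw [norm_mul, Complex.norm_real, Real.norm_of_nonneg hβ0.le]
        exact mul_le_of_le_one_right hβ0.le hw
      have hpos : 0 < ‖(β : ℂ) * w‖ := norm_pos_iff.2 hβw0
      have h1 : β⁻¹ ≤ ‖((β : ℂ) * w)⁻¹‖ := by
        rw [norm_inv]; exact inv_anti₀ hpos hβw
      have h2 : 1 ≤ β⁻¹ := (one_le_inv₀ hβ0).2 hβ1
      rcases hp.cases h0 with h | h | h
      · linarith [h.2]
      · rcases hαβ with h' | h'
        · linarith [h.1]
        · have : 1 < β⁻¹ := (one_lt_inv₀ hβ0).2 h'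
          linarith [h.2]
      · linarith [h.1]
  obtain ⟨c, hc, hrefl⟩ := hp.exists_refl_eq hdeg
  -- Self-reflection of `p` turns the conjugated coefficients back into those of `p`, so the
  -- reflection of `q` is a dilation by the inverse factors.
  have hqrefl : ∀ z w, (q.refl n m).at z w
      = c * (α : ℂ) ^ n * (β : ℂ) ^ m * (p.flipW (n + 1) (m + 1)).at ((α : ℂ)⁻¹ * z) ((β : ℂ)⁻¹ * w) := by
    intro z w
    rw [refl, flipW, at_ofCf, at_ofCf, Finset.mul_sum]
    refine Finset.sum_congr rfl fun i hi => ?_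
    rw [Finset.mul_sum]
    refine Finset.sum_congr rfl fun j hj => ?_
    rw [Finset.mem_range] at hi hj
    have h1 : (starRingEnd ℂ) (p.cf (n - i) j) = c * p.cf i (m - j) := by
      rw [← cf_smul, ← hrefl, cf_refl, if_pos (by omega), Nat.sub_sub_self (by omega)]
    have h2 : (α : ℂ) ^ n = (α : ℂ) ^ (n - i) * (α : ℂ) ^ i := by
      rw [← pow_add, Nat.sub_add_cancel (by omega)]
    have h3 : (β : ℂ) ^ m = (β : ℂ) ^ (m - j) * (β : ℂ) ^ j := by
      rw [← pow_add, Nat.sub_add_cancel (by omega)]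
    rw [hq, cf_ofCf, if_pos (by omega), Nat.sub_sub_self (by omega)]
    simp only [map_mul, h1, map_pow, Complex.conj_ofReal, Nat.add_sub_cancel, mul_pow, h2, h3, inv_pow]
    field_simp
  obtain ⟨P, Q, hP, hQ, hPQ⟩ := hstable.exists_sum_of_squares hqb
  refine ⟨fun i => (P i).flipW n (m + 1), fun j => (Q j).flipW (n + 1) m, fun i => ofCf_mem_box _ _ _,
    fun j => ofCf_mem_box _ _ _, fun z w hw => ?_⟩
  have hw' : 0 < ‖w‖ := norm_pos_iff.2 hw
  have h := hPQ z w⁻¹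
  rw [hqrefl, hqflip, hflip _ _ (by simp [hβ, hw]), hflip _ _ (by simp [hβ, hw])] at h
  have e1 : ((β : ℂ) * w⁻¹)⁻¹ = (β : ℂ)⁻¹ * w := by field_simp
  have e2 : ((β : ℂ)⁻¹ * w⁻¹)⁻¹ = (β : ℂ) * w := by field_simp
  rw [e1, e2] at h
  have eP : vecNormSq (fun i => (P i).flipW n (m + 1)) z w = ‖w‖ ^ (2 * m) * vecNormSq P z w⁻¹ := by
    simp only [vecNormSq, Finset.mul_sum]
    refine Finset.sum_congr rfl fun i _ => ?_
    rw [at_flipW (hP i) z hw, norm_mul, norm_pow, Nat.add_sub_cancel, mul_pow, ← pow_mul, mul_comm m]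
  -- The entries of `Q` have `w`-degree at most `m - 1`, so multiplication by `|w|^(2m)` leaves a
  -- spare `|w|²`. It turns `1 - |w|⁻²` into `-(1 - |w|²)`, which accounts for the sign in the
  -- result.
  have eQ : ‖w‖ ^ 2 * vecNormSq (fun j => (Q j).flipW (n + 1) m) z w
      = ‖w‖ ^ (2 * m) * vecNormSq Q z w⁻¹ := by
    simp only [vecNormSq, Finset.mul_sum]
    refine Finset.sum_congr rfl fun j _ => ?_
    rw [at_flipW (hQ j) z hw, norm_mul, norm_pow, mul_pow, ← pow_mul, ← mul_assoc, ← pow_add]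
    congr 2
    have := j.2
    omega
  have eQ' : vecNormSq (fun j => (Q j).flipW (n + 1) m) z w
      = ‖w‖ ^ (2 * m) * vecNormSq Q z w⁻¹ / ‖w‖ ^ 2 := by
    rw [← eQ]; field_simp
  rw [eP, eQ']
  simp only [norm_mul, norm_pow, norm_inv, hc, Complex.norm_real, Real.norm_of_nonneg hα0.le,
    Real.norm_of_nonneg hβ0.le] at h
  have h' := congrArg (fun x => ‖w‖ ^ (2 * m) * x) h
  have f1 : ‖w‖ ^ (2 * m) * (((β * ‖w‖⁻¹) ^ m * ‖p.at (α * z) ((β : ℂ)⁻¹ * w)‖) ^ 2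
      - (1 * α ^ n * β ^ m * ((β⁻¹ * ‖w‖⁻¹) ^ m * ‖p.at ((α : ℂ)⁻¹ * z) (β * w)‖)) ^ 2)
      = β ^ (2 * m) * ‖p.at (α * z) ((β : ℂ)⁻¹ * w)‖ ^ 2 - α ^ (2 * n) * ‖p.at ((α : ℂ)⁻¹ * z) (β * w)‖ ^ 2 := by
    simp only [mul_pow, inv_pow, ← pow_mul, mul_comm 2]
    field_simp
  rw [f1] at h'
  rw [h']
  field_simp
  ring

/-! ### Compactness in spaces of bounded degree -/

section Limit

/-- The coefficients of a polynomial are controlled by its values on a grid. -/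
theorem exists_norm_cf_le (a b : ℕ) (A B : Finset ℂ) (hA : a ≤ A.card) (hB : b ≤ B.card) :
    ∃ C : ℝ, 0 ≤ C ∧ ∀ f ∈ box a b, ∀ R : ℝ, 0 ≤ R → (∀ z ∈ A, ∀ w ∈ B, ‖f.at z w‖ ≤ R) →
      ∀ i j, ‖f.cf i j‖ ≤ C * R := by
  -- Evaluation on a large enough grid is injective on the coefficients. An injective linear map in
  -- finite dimension is bounded below, which gives the constant.
  let T : (Fin a × Fin b → ℂ) →ₗ[ℂ] (A × B → ℂ) :=
    { toFun := fun c x => ∑ y : Fin a × Fin b, c y * ((x.1 : ℂ) ^ (y.1 : ℕ) * (x.2 : ℂ) ^ (y.2 : ℕ))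
      map_add' := fun c d => by ext x; simp [add_mul, Finset.sum_add_distrib]
      map_smul' := fun r c => by ext x; simp [mul_assoc, Finset.mul_sum] }
  have hTat : ∀ f ∈ box a b, ∀ x : A × B, T (fun y => f.cf y.1 y.2) x = f.at x.1 x.2 := by
    intro f hf x
    rw [at_eq_sum hf]
    simp only [T, LinearMap.coe_mk, AddHom.coe_mk]
    rw [Fintype.sum_prod_type, ← Fin.sum_univ_eq_sum_range (fun i => ∑ j ∈ Finset.range b,
      f.cf i j * ((x.1 : ℂ) ^ i * (x.2 : ℂ) ^ j)) a]
    refine Finset.sum_congr rfl fun i _ => ?_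
    rw [← Fin.sum_univ_eq_sum_range (fun j => f.cf i j * ((x.1 : ℂ) ^ (i : ℕ) * (x.2 : ℂ) ^ j)) b]
  have hker : T.ker = ⊥ := by
    rw [LinearMap.ker_eq_bot']
    intro c hc
    obtain ⟨f, rfl⟩ := (boxEquiv a b).surjective c
    have hfv : ∀ z ∈ A, ∀ w ∈ B, f.1.at z w = 0 := by
      intro z hz w hw
      rw [← hTat f.1 f.2 (⟨z, hz⟩, ⟨w, hw⟩)]
      exact congrFun hc (⟨z, hz⟩, ⟨w, hw⟩)
    have hf0 : f.1 = 0 := by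
      rcases a with _ | a
      · exact box_eq_zero_left f.2
      rcases b with _ | b
      · exact box_eq_zero_right f.2
      have hd := hasDegreeAtMost_of_mem_box f.2
      refine MvPolynomial.eq_zero_of_eval_zero_at_prod_finset f.1 ![A, B] ?_ ?_
      · intro k; fin_cases k
        · exact lt_of_le_of_lt hd.1 hA
        · exact lt_of_le_of_lt hd.2 hB
      · intro x hx
        have h0 := hfv _ (hx 0) _ (hx 1)
        have hx2 : x = ![x 0, x 1] := by ext k; fin_cases k <;> rfl
        rw [hx2]; exact h0
    rw [Subtype.ext (a2 := (0 : box a b)) hf0, map_zero]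
  obtain ⟨K, -, hK⟩ := T.exists_antilipschitzWith hker
  refine ⟨K, K.2, fun f hf R hR hfR i j => ?_⟩
  by_cases hij : f.cf i j = 0
  · rw [hij, norm_zero]; exact mul_nonneg K.2 hR
  obtain ⟨hi, hj⟩ := hf i j hij
  have h1 := hK.le_mul_dist (fun y : Fin a × Fin b => f.cf y.1 y.2) 0
  rw [map_zero, dist_zero_right, dist_zero_right] at h1
  have h2 : ‖T (fun y : Fin a × Fin b => f.cf y.1 y.2)‖ ≤ R := by
    rw [pi_norm_le_iff_of_nonneg hR]
    intro x
    rw [hTat f hf]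
    exact hfR _ x.1.2 _ x.2.2
  calc ‖f.cf i j‖ ≤ ‖(fun y : Fin a × Fin b => f.cf y.1 y.2)‖ :=
        norm_le_pi_norm (fun y : Fin a × Fin b => f.cf y.1 y.2) (⟨i, hi⟩, ⟨j, hj⟩)
    _ ≤ K * ‖T (fun y : Fin a × Fin b => f.cf y.1 y.2)‖ := h1
    _ ≤ K * R := mul_le_mul_of_nonneg_left h2 K.2

theorem exists_subseq_tendsto {r a b : ℕ} (f : ℕ → Fin r → Poly2) (hf : ∀ k i, f k i ∈ box a b)
    (C : ℝ) (hC : ∀ k i s t, ‖(f k i).cf s t‖ ≤ C) :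
    ∃ g : Fin r → Poly2, (∀ i, g i ∈ box a b) ∧ ∃ φ : ℕ → ℕ, StrictMono φ ∧
      ∀ i z w, Tendsto (fun k => (f (φ k) i).at z w) atTop (𝓝 ((g i).at z w)) := by
  let x : ℕ → (Fin r × Fin a × Fin b → ℂ) := fun k y => (f k y.1).cf y.2.1 y.2.2
  have hx : ∀ k, x k ∈ Metric.closedBall (0 : Fin r × Fin a × Fin b → ℂ) |C| := by
    intro k
    rw [mem_closedBall_zero_iff, pi_norm_le_iff_of_nonneg (abs_nonneg _)]
    exact fun y => (hC _ _ _ _).trans (le_abs_self _)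
  obtain ⟨l, -, φ, hφ, hlim⟩ := tendsto_subseq_of_bounded Metric.isBounded_closedBall hx
  rw [tendsto_pi_nhds] at hlim
  refine ⟨fun i => ofCf a b fun s t => if h : s < a ∧ t < b then l (i, ⟨s, h.1⟩, ⟨t, h.2⟩) else 0,
    fun i => ofCf_mem_box _ _ _, φ, hφ, fun i z w => ?_⟩
  rw [at_ofCf]
  have h1 : ∀ k, (f (φ k) i).at z w = ∑ s ∈ Finset.range a, ∑ t ∈ Finset.range b,
      (f (φ k) i).cf s t * (z ^ s * w ^ t) := fun k => at_eq_sum (hf _ _) z w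
  simp_rw [h1]
  refine tendsto_finsetSum _ fun s hs => tendsto_finsetSum _ fun t ht => Tendsto.mul_const _ ?_
  rw [Finset.mem_range] at hs ht
  rw [dif_pos ⟨hs, ht⟩]
  exact hlim (i, ⟨s, hs⟩, ⟨t, ht⟩)

end Limit

end Poly2

/-! ### Differentiating the dilations, and existence -/

namespace Poly2

theorem hasDerivAt_at {𝕜 : Type*} [NontriviallyNormedField 𝕜] [NormedAlgebra 𝕜 ℂ] (f : Poly2)
    {x y : 𝕜 → ℂ} {x' y' : ℂ} {t : 𝕜} (hx : HasDerivAt x x' t)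
    (hy : HasDerivAt y y' t) : HasDerivAt (fun s => f.at (x s) (y s))
      (f.dz.at (x t) (y t) * x' + f.dw.at (x t) (y t) * y') t := by
  induction f using MvPolynomial.induction_on with
  | C c => simpa [Poly2.at, Poly2.dz, Poly2.dw] using hasDerivAt_const t c
  | add f g hf hg =>
    have := hf.add hg
    refine (this.congr_deriv ?_).congr_of_eventuallyEq (Eventually.of_forall fun s => ?_)
    · simp only [Poly2.at, Poly2.dz, Poly2.dw, map_add]; ring
    · simp only [Poly2.at, map_add]; rfl
  | mul_X f i hf =>
    fin_cases i
    · refine ((hf.mul hx).congr_deriv ?_).congr_of_eventuallyEq (Eventually.of_forall fun s => ?_)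
      · simp [Poly2.at, Poly2.dz, Poly2.dw, Derivation.leibniz, pderiv_X]; ring
      · simp [Poly2.at]
    · refine ((hf.mul hy).congr_deriv ?_).congr_of_eventuallyEq (Eventually.of_forall fun s => ?_)
      · simp [Poly2.at, Poly2.dz, Poly2.dw, Derivation.leibniz, pderiv_X]; ring
      · simp [Poly2.at]

/-- The left side of the sum of squares formula without the vector polynomials. -/
noncomputable def weightedForm (p : Poly2) (n m : ℕ) (a b : ℝ) (z w : ℂ) : ℝ :=
  (b * m - a * n) * ‖p.at z w‖ ^ 2
      + 2 * (((a : ℂ) * z * p.dz.at z w - (b : ℂ) * w * p.dw.at z w)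
          * (starRingEnd ℂ) (p.at z w)).re

/-- The dilation whose derivative at `0` is the weighted form. -/
noncomputable def dilationForm (p : Poly2) (n m : ℕ) (a b : ℝ) (z w : ℂ) (t : ℝ) : ℝ :=
  Real.exp (-(b * t)) ^ (2 * m)
      * ‖p.at ((Real.exp (-(a * t)) : ℝ) * z) (((Real.exp (-(b * t)) : ℝ) : ℂ)⁻¹ * w)‖ ^ 2
    - Real.exp (-(a * t)) ^ (2 * n)
      * ‖p.at (((Real.exp (-(a * t)) : ℝ) : ℂ)⁻¹ * z) ((Real.exp (-(b * t)) : ℝ) * w)‖ ^ 2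

/-- The scalar powers contribute `-2(bm - an)|p|²`. The two moduli move in opposite directions and
enter with opposite signs, so their derivatives add up. -/
theorem hasDerivAt_dilationForm (p : Poly2) (n m : ℕ) (a b : ℝ) (z w : ℂ) :
    HasDerivAt (p.dilationForm n m a b z w) (-2 * p.weightedForm n m a b z w) 0 := by
  have hexp : ∀ c : ℝ, HasDerivAt (fun t : ℝ => Real.exp (-(c * t))) (-c) 0 := by
    intro c
    have := (((hasDerivAt_id (0 : ℝ)).const_mul c).neg).exp
    simpa using this
  have hexpC : ∀ c : ℝ, HasDerivAt (fun t : ℝ => ((Real.exp (-(c * t)) : ℝ) : ℂ)) (-c : ℂ) 0 := by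
    intro c
    have := (hexp c).ofReal_comp
    simpa using this
  have hinvC : ∀ c : ℝ, HasDerivAt (fun t : ℝ => ((Real.exp (-(c * t)) : ℝ) : ℂ)⁻¹) (c : ℂ) 0 := by
    intro c
    have := (hexpC c).fun_inv (by simp)
    simpa using this
  have hpow : ∀ (c : ℝ) (k : ℕ), HasDerivAt (fun t : ℝ => Real.exp (-(c * t)) ^ (2 * k)) (-(2 * c * k)) 0 := by
    intro c k
    have := (hexp c).fun_pow (2 * k)
    refine this.congr_deriv ?_
    simp; ring
  have hu := p.hasDerivAt_at ((hexpC a).mul_const z) ((hinvC b).mul_const w)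
  have hv := p.hasDerivAt_at ((hinvC a).mul_const z) ((hexpC b).mul_const w)
  have hu2 := (hpow b m).mul hu.norm_sq
  have hv2 := (hpow a n).mul hv.norm_sq
  refine (hu2.sub hv2).congr_deriv ?_
  simp only [mul_zero, neg_zero, Real.exp_zero, Complex.ofReal_one, one_mul, inv_one, one_pow,
    weightedForm, Complex.inner]
  have e : ∀ X Y c d : ℂ, (X * (c * z) + Y * (d * w)) = c * z * X + d * w * Y := by
    intros; ring
  simp only [e, Complex.mul_re, Complex.add_re, Complex.sub_re, Complex.neg_re, Complex.neg_im,
    Complex.mul_im, Complex.add_im, Complex.sub_im, Complex.conj_re, Complex.conj_im,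
    Complex.ofReal_re, Complex.ofReal_im]
  ring

theorem tendsto_dilationForm (p : Poly2) (n m : ℕ) (a b : ℝ) (z w : ℂ) :
    Tendsto (fun k : ℕ => p.dilationForm n m a b z w (1 / ((k : ℝ) + 1)) / (2 * (1 / ((k : ℝ) + 1)))) atTop
      (𝓝 (-p.weightedForm n m a b z w)) := by
  have h1 := hasDerivAt_iff_tendsto_slope.1 (p.hasDerivAt_dilationForm n m a b z w)
  have h2 : Tendsto (fun k : ℕ => 1 / ((k : ℝ) + 1)) atTop (𝓝[≠] 0) := by
    refine tendsto_nhdsWithin_iff.2 ⟨tendsto_one_div_add_atTop_nhds_zero_nat, Eventually.of_forall fun k => ?_⟩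
    have : (0 : ℝ) < 1 / ((k : ℝ) + 1) := by positivity
    exact this.ne'
  have h3 := (h1.comp h2).div_const 2
  have h0 : p.dilationForm n m a b z w 0 = 0 := by simp [dilationForm]
  convert h3 using 2
  · simp only [Function.comp, slope_def_field, h0, sub_zero]
    rw [div_div, mul_comm]
  · ring

theorem vecNormSq_smul {k : ℕ} (c : ℝ) (A : Fin k → Poly2) (z w : ℂ) :
    vecNormSq (fun i => (c : ℂ) • A i) z w = c ^ 2 * vecNormSq A z w := by
  simp only [vecNormSq, Finset.mul_sum, at_smul, norm_mul, mul_pow, Complex.norm_real, Real.norm_eq_abs,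
    sq_abs]

theorem norm_sq_le_vecNormSq {k : ℕ} (A : Fin k → Poly2) (i : Fin k) (z w : ℂ) :
    ‖(A i).at z w‖ ^ 2 ≤ vecNormSq A z w :=
  Finset.single_le_sum (f := fun i => ‖(A i).at z w‖ ^ 2) (fun _ _ => sq_nonneg _) (Finset.mem_univ i)

theorem vecNormSq_nonneg {k : ℕ} (A : Fin k → Poly2) (z w : ℂ) : 0 ≤ vecNormSq A z w :=
  Finset.sum_nonneg fun _ _ => sq_nonneg _

theorem continuous_vecNormSq {k : ℕ} (A : Fin k → Poly2) (z : ℂ) : Continuous fun w => vecNormSq A z w := by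
  unfold vecNormSq; fun_prop

variable {p : Poly2} {n m : ℕ}

/-- Existence in the sum of squares formula. -/
theorem DefinesDistinguishedVariety.exists_isSOSPair (hp : p.DefinesDistinguishedVariety)
    (hdeg : p.HasDegree n m) (a b : ℝ) (ha : 0 ≤ a) (hb : 0 ≤ b) (hab : ¬ (a = 0 ∧ b = 0)) :
    ∃ (P : Fin n → Poly2) (Q : Fin m → Poly2), IsSOSPair p n m a b P Q := by
  set τ : ℕ → ℝ := fun k => 1 / ((k : ℝ) + 1) with hτ
  have hτ0 : ∀ k, 0 < τ k := fun k => by simp only [hτ]; positivity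
  have hle : ∀ c : ℝ, 0 ≤ c → ∀ k, Real.exp (-(c * τ k)) ≤ 1 := fun c hc k =>
    Real.exp_le_one_iff.2 (by have := mul_nonneg hc (hτ0 k).le; linarith)
  have hlt : ∀ k, Real.exp (-(a * τ k)) < 1 ∨ Real.exp (-(b * τ k)) < 1 := by
    intro k
    rcases ha.lt_or_eq with h | h
    · left; rw [Real.exp_lt_one_iff]; have := mul_pos h (hτ0 k); linarith
    · rcases hb.lt_or_eq with h' | h'
      · right; rw [Real.exp_lt_one_iff]; have := mul_pos h' (hτ0 k); linarith
      · exact (hab ⟨h.symm, h'.symm⟩).elim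
  choose P₀ Q₀ hP₀ hQ₀ hPQ₀ using fun k => hp.exists_sum_of_squares_dilation hdeg
    (Real.exp_pos (-(a * τ k))) (hle a ha k) (Real.exp_pos (-(b * τ k))) (hle b hb k) (hlt k)
  set σ : ℕ → ℝ := fun k => (√(2 * τ k))⁻¹ with hσ
  have hσ2 : ∀ k, σ k ^ 2 = (2 * τ k)⁻¹ := fun k => by
    simp only [hσ]
    rw [inv_pow, Real.sq_sqrt (by have := hτ0 k; positivity)]
  set P : ℕ → Fin n → Poly2 := fun k i => (σ k : ℂ) • P₀ k i with hP
  set Q : ℕ → Fin m → Poly2 := fun k i => (σ k : ℂ) • Q₀ k i with hQ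
  have hPb : ∀ k i, P k i ∈ box n (m + 1) := fun k i => Submodule.smul_mem _ _ (hP₀ k i)
  have hQb : ∀ k i, Q k i ∈ box (n + 1) m := fun k i => Submodule.smul_mem _ _ (hQ₀ k i)
  set S : ℕ → ℂ → ℂ → ℝ := fun k z w => p.dilationForm n m a b z w (τ k) / (2 * τ k) with hS
  have hSeq : ∀ k z w, w ≠ 0 →
      S k z w = (1 - ‖z‖ ^ 2) * vecNormSq (P k) z w - (1 - ‖w‖ ^ 2) * vecNormSq (Q k) z w := by
    intro k z w hw
    simp only [hS, hP, hQ]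
    rw [vecNormSq_smul, vecNormSq_smul, hσ2, dilationForm, hPQ₀ k z w hw]
    ring
  have hSlim : ∀ z w, Tendsto (fun k => S k z w) atTop (𝓝 (-p.weightedForm n m a b z w)) := fun z w =>
    p.tendsto_dilationForm n m a b z w
  -- The grid has `|z| ≤ 1/2` and `|w| ≥ 2`, so `1 - |z|²` and `-(1 - |w|²)` are positive and
  -- bounded away from zero. An upper bound for `S` therefore bounds `P` and `Q` separately.
  let A : Finset ℂ := (Finset.range (n + 1)).image fun i : ℕ => ((i : ℂ) + 2)⁻¹
  let B : Finset ℂ := (Finset.range (m + 1)).image fun i : ℕ => ((i : ℂ) + 2)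
  have hA : n + 1 ≤ A.card := by
    rw [Finset.card_image_of_injective, Finset.card_range]
    intro i j h
    simpa using h
  have hB : m + 1 ≤ B.card := by
    rw [Finset.card_image_of_injective, Finset.card_range]
    intro i j h
    simpa using h
  have hnorm : ∀ i : ℕ, 2 ≤ ‖(i : ℂ) + 2‖ := by
    intro i
    have : ((i : ℂ) + 2) = ((i + 2 : ℕ) : ℂ) := by push_cast; rfl
    rw [this, Complex.norm_natCast]
    push_cast
    linarith [(Nat.cast_nonneg i : (0 : ℝ) ≤ i)]
  have hA1 : ∀ z ∈ A, ‖z‖ ≤ 1 / 2 := by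
    intro z hz
    obtain ⟨i, -, rfl⟩ := Finset.mem_image.1 hz
    rw [norm_inv, inv_le_comm₀ (by linarith [hnorm i]) (by norm_num)]
    simpa using hnorm i
  have hB1 : ∀ w ∈ B, 2 ≤ ‖w‖ := by
    intro w hw
    obtain ⟨i, -, rfl⟩ := Finset.mem_image.1 hw
    exact hnorm i
  -- At each grid point `S` converges, hence is bounded above; the grid is finite.
  obtain ⟨R, hR0, hR⟩ : ∃ R : ℝ, 0 ≤ R ∧ ∀ z ∈ A, ∀ w ∈ B, ∀ k, S k z w ≤ R := by
    have h1 : ∀ x : ℂ × ℂ, ∃ r : ℝ, 0 ≤ r ∧ ∀ k, S k x.1 x.2 ≤ r := by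
      intro x
      obtain ⟨r, hr⟩ := (hSlim x.1 x.2).bddAbove_range
      exact ⟨|r|, abs_nonneg _, fun k => (hr ⟨k, rfl⟩).trans (le_abs_self _)⟩
    choose r hr0 hr using h1
    refine ⟨∑ x ∈ A ×ˢ B, r x, Finset.sum_nonneg fun x _ => hr0 x, fun z hz w hw k => ?_⟩
    exact (hr (z, w) k).trans (Finset.single_le_sum (fun x _ => hr0 x) (Finset.mk_mem_product hz hw))
  have hbd : ∀ k, ∀ z ∈ A, ∀ w ∈ B, vecNormSq (P k) z w ≤ 2 * R ∧ vecNormSq (Q k) z w ≤ 2 * R := by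
    intro k z hz w hw
    have hw0 : w ≠ 0 := by rintro rfl; have := hB1 0 hw; norm_num at this
    have h1 := hSeq k z w hw0
    have h2 := hR z hz w hw k
    have h3 := hA1 z hz
    have h4 := hB1 w hw
    have h5 := vecNormSq_nonneg (P k) z w
    have h6 := vecNormSq_nonneg (Q k) z w
    have h7 : ‖z‖ ^ 2 ≤ 1 / 4 := by nlinarith [norm_nonneg z]
    have h8 : 4 ≤ ‖w‖ ^ 2 := by nlinarith
    have h9 : 0 ≤ (1 / 4 - ‖z‖ ^ 2) * vecNormSq (P k) z w := mul_nonneg (by linarith) h5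
    have h10 : 0 ≤ (‖w‖ ^ 2 - 4) * vecNormSq (Q k) z w := mul_nonneg (by linarith) h6
    constructor <;> linarith
  have hsq : ∀ x : ℝ, x ^ 2 ≤ 2 * R → x ≤ 2 * R + 1 := fun x hx => by nlinarith [sq_nonneg (x - 1)]
  obtain ⟨C₁, -, hC₁⟩ := exists_norm_cf_le n (m + 1) A B (by omega) hB
  obtain ⟨C₂, -, hC₂⟩ := exists_norm_cf_le (n + 1) m A B hA (by omega)
  obtain ⟨P', hP', φ, hφ, hPlim⟩ := exists_subseq_tendsto P hPb (C₁ * (2 * R + 1)) fun k i =>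
    hC₁ _ (hPb k i) _ (by linarith) fun z hz w hw =>
      hsq _ ((norm_sq_le_vecNormSq _ i z w).trans (hbd k z hz w hw).1)
  obtain ⟨Q', hQ', ψ, hψ, hQlim⟩ := exists_subseq_tendsto (fun k => Q (φ k)) (fun k i => hQb _ i)
    (C₂ * (2 * R + 1)) fun k i =>
    hC₂ _ (hQb _ i) _ (by linarith) fun z hz w hw =>
      hsq _ ((norm_sq_le_vecNormSq _ i z w).trans (hbd _ z hz w hw).2)
  have hmain : ∀ z w : ℂ, w ≠ 0 → -p.weightedForm n m a b z w
      = (1 - ‖z‖ ^ 2) * vecNormSq P' z w - (1 - ‖w‖ ^ 2) * vecNormSq Q' z w := by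
    intro z w hw
    have h1 : Tendsto (fun k => S (φ (ψ k)) z w) atTop (𝓝 (-p.weightedForm n m a b z w)) :=
      (hSlim z w).comp (hφ.comp hψ).tendsto_atTop
    refine tendsto_nhds_unique h1 ?_
    simp_rw [hSeq _ z w hw, vecNormSq]
    refine Tendsto.sub (Tendsto.const_mul _ (tendsto_finsetSum _ fun i _ => ?_))
      (Tendsto.const_mul _ (tendsto_finsetSum _ fun i _ => ?_))
    · exact (((hPlim i z w).comp hψ.tendsto_atTop).norm).pow 2
    · exact ((hQlim i z w).norm).pow 2
  refine ⟨P', Q', fun i => ?_, fun j => ?_, fun z w => ?_⟩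
  · have hn : n - 1 + 1 = n := by have := i.2; omega
    exact hasDegreeAtMost_of_mem_box (by rw [hn]; exact hP' i)
  · have hm : m - 1 + 1 = m := by have := j.2; omega
    exact hasDegreeAtMost_of_mem_box (by rw [hm]; exact hQ' j)
  -- The reflection in `w` excluded `w = 0`; continuity restores it.
  have hcont : (fun w : ℂ => -p.weightedForm n m a b z w)
      = fun w => (1 - ‖z‖ ^ 2) * vecNormSq P' z w - (1 - ‖w‖ ^ 2) * vecNormSq Q' z w := by
    refine Continuous.ext_on (dense_compl_singleton 0) ?_ ?_ fun w hw => hmain z w hw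
    · unfold weightedForm
      have hre : ∀ f : ℂ → ℂ, Continuous f → Continuous fun w => (f w).re :=
        fun f hf => Complex.continuous_re.comp hf
      refine Continuous.neg (Continuous.add (by fun_prop) (Continuous.mul (by fun_prop) (hre _ ?_)))
      exact Continuous.mul (by fun_prop) (Complex.continuous_conj.comp (by fun_prop))
    · have h1 := continuous_vecNormSq P' z
      have h2 := continuous_vecNormSq Q' z
      fun_prop
  have := congrFun hcont w
  simp only [weightedForm] at this
  linarith

end Poly2

/-! ### Polarization and boundary derivatives -/

namespace Poly2

theorem at_map_conj (f : Poly2) (z w : ℂ) :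
    Poly2.at (MvPolynomial.map (starRingEnd ℂ) f) z w
      = (starRingEnd ℂ) (f.at ((starRingEnd ℂ) z) ((starRingEnd ℂ) w)) := by
  induction f using MvPolynomial.induction_on with
  | C c => simp [Poly2.at]
  | add f g hf hg =>
    simp only [Poly2.at, map_add] at hf hg ⊢
    rw [hf, hg]
  | mul_X f i hf =>
    simp only [Poly2.at, map_mul, MvPolynomial.map_X, eval_X] at hf ⊢
    rw [hf]
    congr 1
    fin_cases i <;> simp

/-- A sesquianalytic polynomial identity on the diagonal holds off the diagonal. -/
theorem polarization {ι : Type*} [Fintype ι] (f g : ι → Poly2)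
    (h : ∀ z w : ℂ, ∑ i, (f i).at z w * (starRingEnd ℂ) ((g i).at z w) = 0) (z w Z W : ℂ) :
    ∑ i, (f i).at z w * (starRingEnd ℂ) ((g i).at Z W) = 0 := by
  -- In real coordinates `z = x₀ + i x₁` and `conj z = x₀ - i x₁`, and similarly for `w`. The sum
  -- becomes a polynomial in four variables vanishing on `ℝ⁴`, hence zero. At complex arguments the
  -- two linear forms take independent values.
  let σ : Fin 2 → MvPolynomial (Fin 4) ℂ := ![X 0 + C Complex.I * X 1, X 2 + C Complex.I * X 3]
  let τ : Fin 2 → MvPolynomial (Fin 4) ℂ := ![X 0 - C Complex.I * X 1, X 2 - C Complex.I * X 3]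
  let F : MvPolynomial (Fin 4) ℂ :=
    ∑ i, aeval σ (f i) * aeval τ (MvPolynomial.map (starRingEnd ℂ) (g i))
  have hev : ∀ (r : Fin 4 → ℂ) (q : Poly2) (ρ : Fin 2 → MvPolynomial (Fin 4) ℂ),
      eval r (aeval ρ q) = q.at (eval r (ρ 0)) (eval r (ρ 1)) := by
    intro r q ρ
    rw [Poly2.at, aeval_def, ← MvPolynomial.coe_eval₂Hom, ← RingHom.comp_apply]
    congr 1
    refine MvPolynomial.ringHom_ext (fun c => ?_) fun i => ?_
    · simp
    · fin_cases i <;> simp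
  have hF : ∀ r : Fin 4 → ℂ, eval r F = ∑ i, (f i).at (r 0 + Complex.I * r 1) (r 2 + Complex.I * r 3) *
      (starRingEnd ℂ) ((g i).at ((starRingEnd ℂ) (r 0 - Complex.I * r 1))
        ((starRingEnd ℂ) (r 2 - Complex.I * r 3))) := by
    intro r
    simp only [F, map_sum, map_mul, hev, at_map_conj]
    simp [σ, τ]
  have hF0 : F = 0 := by
    refine MvPolynomial.funext_set (fun _ => Set.range ((↑) : ℝ → ℂ))
      (fun _ => Set.infinite_range_of_injective Complex.ofReal_injective) fun r hr => ?_
    choose x hx using fun i => hr i trivial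
    rw [hF, map_zero]
    refine Eq.trans ?_ (h (r 0 + Complex.I * r 1) (r 2 + Complex.I * r 3))
    refine Finset.sum_congr rfl fun i _ => ?_
    simp only [← hx]
    congr 3 <;> simp
  have hfin := hF ![(z + (starRingEnd ℂ) Z) / 2, (z - (starRingEnd ℂ) Z) / (2 * Complex.I),
    (w + (starRingEnd ℂ) W) / 2, (w - (starRingEnd ℂ) W) / (2 * Complex.I)]
  rw [hF0, map_zero] at hfin
  rw [hfin]
  have hI := Complex.I_ne_zero
  have e : ∀ u v : ℂ, (u + v) / 2 + Complex.I * ((u - v) / (2 * Complex.I)) = u := by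
    intro u v; field_simp; ring
  have e' : ∀ u v : ℂ, (u + v) / 2 - Complex.I * ((u - v) / (2 * Complex.I)) = v := by
    intro u v; field_simp; ring
  refine Finset.sum_congr rfl fun i _ => ?_
  simp only [Matrix.cons_val_zero, Matrix.cons_val_one, Matrix.cons_val, e, e', Complex.conj_conj]

/-- The weighted derivative `a * z * p_z - b * w * p_w`. -/
noncomputable def weightedDeriv (p : Poly2) (a b : ℝ) (z w : ℂ) : ℂ :=
  (a : ℂ) * z * p.dz.at z w - (b : ℂ) * w * p.dw.at z w

variable {p : Poly2} {n m : ℕ} {a b : ℝ} {P : Fin n → Poly2} {Q : Fin m → Poly2}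

theorem vecInner_self {k : ℕ} (A : Fin k → Poly2) (z w : ℂ) : vecInner A z w z w = (vecNormSq A z w : ℂ) := by
  simp only [vecInner, vecNormSq, Complex.mul_conj']
  push_cast
  rfl

/-- The polarized sum of squares formula. -/
theorem IsSOSPair.polarized (h : IsSOSPair p n m a b P Q) (z w Z W : ℂ) :
    ((b * m - a * n : ℝ) : ℂ) * p.at z w * (starRingEnd ℂ) (p.at Z W)
      + p.weightedDeriv a b z w * (starRingEnd ℂ) (p.at Z W)
      + p.at z w * (starRingEnd ℂ) (p.weightedDeriv a b Z W)
      + (1 - z * (starRingEnd ℂ) Z) * vecInner P z w Z W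
      = (1 - w * (starRingEnd ℂ) W) * vecInner Q z w Z W := by
  let D : Poly2 := (a : ℂ) • (mono 1 0 * p.dz) - (b : ℂ) • (mono 0 1 * p.dw)
  have hD : ∀ z w, D.at z w = p.weightedDeriv a b z w := by
    intro z w; simp only [D, weightedDeriv, at_sub, at_smul, at_mul, at_mono, pow_one, pow_zero, mul_one,
      one_mul, mul_assoc]
  -- The identity is written as a single sum `∑ fᵢ conj gᵢ`, the form that polarization accepts.
  let f : (Fin 3 ⊕ (Fin n ⊕ Fin n)) ⊕ (Fin m ⊕ Fin m) → Poly2 :=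
    Sum.elim (Sum.elim ![((b * m - a * n : ℝ) : ℂ) • p, D, p] (Sum.elim P fun i => -mono 1 0 * P i))
      (Sum.elim (fun j => - Q j) fun j => mono 0 1 * Q j)
  let g : (Fin 3 ⊕ (Fin n ⊕ Fin n)) ⊕ (Fin m ⊕ Fin m) → Poly2 :=
    Sum.elim (Sum.elim ![p, p, D] (Sum.elim P fun i => mono 1 0 * P i))
      (Sum.elim Q fun j => mono 0 1 * Q j)
  have hneg : ∀ (f : Poly2) z w, (-f).at z w = - f.at z w := fun f z w => map_neg _ _
  have hfg : ∀ z w Z W : ℂ, ∑ i, (f i).at z w * (starRingEnd ℂ) ((g i).at Z W)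
      = ((b * m - a * n : ℝ) : ℂ) * p.at z w * (starRingEnd ℂ) (p.at Z W)
      + p.weightedDeriv a b z w * (starRingEnd ℂ) (p.at Z W)
      + p.at z w * (starRingEnd ℂ) (p.weightedDeriv a b Z W)
      + (1 - z * (starRingEnd ℂ) Z) * vecInner P z w Z W
      - (1 - w * (starRingEnd ℂ) W) * vecInner Q z w Z W := by
    intro z w Z W
    simp only [Fintype.sum_sum_type, Fin.sum_univ_three, f, g, Sum.elim_inl, Sum.elim_inr,
      Matrix.cons_val_zero, Matrix.cons_val_one, Matrix.cons_val, at_smul, hD, at_mul, hneg, at_mono,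
      vecInner, map_mul, pow_one, pow_zero, mul_one, one_mul]
    have e1 : ∑ i, -z * (P i).at z w * ((starRingEnd ℂ) Z * (starRingEnd ℂ) ((P i).at Z W))
        = - (z * (starRingEnd ℂ) Z * ∑ i, (P i).at z w * (starRingEnd ℂ) ((P i).at Z W)) := by
      rw [Finset.mul_sum, ← Finset.sum_neg_distrib]
      exact Finset.sum_congr rfl fun i _ => by ring
    have e2 : ∑ i, w * (Q i).at z w * ((starRingEnd ℂ) W * (starRingEnd ℂ) ((Q i).at Z W))
        = w * (starRingEnd ℂ) W * ∑ i, (Q i).at z w * (starRingEnd ℂ) ((Q i).at Z W) := by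
      rw [Finset.mul_sum]
      exact Finset.sum_congr rfl fun i _ => by ring
    have e3 : ∑ i, -(Q i).at z w * (starRingEnd ℂ) ((Q i).at Z W)
        = - ∑ i, (Q i).at z w * (starRingEnd ℂ) ((Q i).at Z W) := by
      rw [← Finset.sum_neg_distrib]
      exact Finset.sum_congr rfl fun i _ => by ring
    rw [e1, e2, e3]
    ring
  have hdiag : ∀ z w, ∑ i, (f i).at z w * (starRingEnd ℂ) ((g i).at z w) = 0 := by
    intro z w
    rw [hfg, vecInner_self, vecInner_self]
    have h1 := congrArg (fun x : ℝ => (x : ℂ)) (h.2.2 z w)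
    simp only [Complex.ofReal_add, Complex.ofReal_mul, Complex.ofReal_sub, Complex.ofReal_pow,
      Complex.ofReal_one, Complex.ofReal_ofNat, Complex.ofReal_natCast] at h1
    have h2 := Complex.add_conj (p.weightedDeriv a b z w * (starRingEnd ℂ) (p.at z w))
    rw [map_mul, Complex.conj_conj] at h2
    have h3 := Complex.mul_conj' z
    have h4 := Complex.mul_conj' w
    have h5 := Complex.mul_conj' (p.at z w)
    simp only [Complex.ofReal_mul, Complex.ofReal_ofNat] at h2
    change _ + 2 * ((p.weightedDeriv a b z w * (starRingEnd ℂ) (p.at z w)).re : ℂ) + _ = _ at h1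
    rw [h3, h4]
    push_cast
    linear_combination h1 + h2 + ((b : ℂ) * m - a * n) * h5
  have := polarization f g hdiag z w Z W
  rw [hfg] at this
  exact sub_eq_zero.1 this

/-- The sum of squares formula on the variety. -/
theorem IsSOSPair.inner_eq (h : IsSOSPair p n m a b P Q) {z w Z W : ℂ} (h1 : p.at z w = 0)
    (h2 : p.at Z W = 0) : (1 - z * (starRingEnd ℂ) Z) * vecInner P z w Z W
      = (1 - w * (starRingEnd ℂ) W) * vecInner Q z w Z W := by
  have := IsSOSPair.polarized h z w Z W
  rw [h1, h2] at this
  simpa using this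

theorem differentiable_vecInner {k : ℕ} (A : Fin k → Poly2) (Z W : ℂ) {x y : ℂ → ℂ} (hx : Differentiable ℂ x)
    (hy : Differentiable ℂ y) : Differentiable ℂ fun t => vecInner A (x t) (y t) Z W := by
  unfold vecInner
  refine Differentiable.fun_sum fun i _ => Differentiable.mul_const (fun t => ?_) _
  exact ((A i).hasDerivAt_at (hx t).hasDerivAt (hy t).hasDerivAt).differentiableAt

/-- Fix the second point at `(z, w)` and let the first be `(t, w)`. As `|w| = 1`, the `Q` term drops
out; as `1 - t conj z` vanishes at `t = z`, differentiating there leaves only `|P|²`. -/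
theorem IsSOSPair.left_deriv (h : IsSOSPair p n m a b P Q) {z w : ℂ} (hp : p.at z w = 0) (hz : ‖z‖ = 1)
    (hw : ‖w‖ = 1) :
    z * p.dz.at z w * (starRingEnd ℂ) (p.weightedDeriv a b z w) = (vecNormSq P z w : ℂ) := by
  have hz1 : z * (starRingEnd ℂ) z = 1 := by rw [Complex.mul_conj', hz]; simp
  have hw1 : w * (starRingEnd ℂ) w = 1 := by rw [Complex.mul_conj', hw]; simp
  have h1 : ∀ t : ℂ, p.at t w * (starRingEnd ℂ) (p.weightedDeriv a b z w)
      = -((1 - t * (starRingEnd ℂ) z) * vecInner P t w z w) := by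
    intro t
    have := IsSOSPair.polarized h t w z w
    rw [hp, hw1] at this
    simp only [map_zero, mul_zero, sub_self, zero_mul, add_zero, zero_add] at this
    linear_combination this
  have h2 := (p.hasDerivAt_at (hasDerivAt_id z) (hasDerivAt_const z w)).mul_const
    ((starRingEnd ℂ) (p.weightedDeriv a b z w))
  have h3 := ((((hasDerivAt_id z).mul_const ((starRingEnd ℂ) z)).const_sub 1).mul
    ((differentiable_vecInner P z w differentiable_id (differentiable_const w)) z).hasDerivAt).neg
  have h4 := h2.unique (h3.congr_of_eventuallyEq (Eventually.of_forall h1))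
  simp only [id, hz1, vecInner_self] at h4
  linear_combination z * h4 + (vecNormSq P z w : ℂ) * hz1

theorem IsSOSPair.right_deriv (h : IsSOSPair p n m a b P Q) {z w : ℂ} (hp : p.at z w = 0) (hz : ‖z‖ = 1)
    (hw : ‖w‖ = 1) :
    w * p.dw.at z w * (starRingEnd ℂ) (p.weightedDeriv a b z w) = -(vecNormSq Q z w : ℂ) := by
  have hz1 : z * (starRingEnd ℂ) z = 1 := by rw [Complex.mul_conj', hz]; simp
  have hw1 : w * (starRingEnd ℂ) w = 1 := by rw [Complex.mul_conj', hw]; simp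
  have h1 : ∀ t : ℂ, p.at z t * (starRingEnd ℂ) (p.weightedDeriv a b z w)
      = (1 - t * (starRingEnd ℂ) w) * vecInner Q z t z w := by
    intro t
    have := IsSOSPair.polarized h z t z w
    rw [hp, hz1] at this
    simp only [map_zero, mul_zero, sub_self, zero_mul, add_zero, zero_add] at this
    exact this
  have h2 := (p.hasDerivAt_at (hasDerivAt_const w z) (hasDerivAt_id w)).mul_const
    ((starRingEnd ℂ) (p.weightedDeriv a b z w))
  have h3 := (((hasDerivAt_id w).mul_const ((starRingEnd ℂ) w)).const_sub 1).mul
    ((differentiable_vecInner Q z w (differentiable_const z) differentiable_id) w).hasDerivAt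
  have h4 := h2.unique (h3.congr_of_eventuallyEq (Eventually.of_forall h1))
  simp only [id, hw1, vecInner_self] at h4
  linear_combination w * h4 - (vecNormSq Q z w : ℂ) * hw1

end Poly2

/-! ### Squarefree polynomials have finitely many critical lines -/

/-- Squarefreeness passes to the polynomial ring over the fraction field. -/
theorem Polynomial.squarefree_map_of_squarefree {R K : Type*} [CommRing R] [IsDomain R]
    [NormalizedGCDMonoid R] [Field K] [Algebra R K] [IsFractionRing R K] {f : Polynomial R}
    (hf : Squarefree f) : Squarefree (f.map (algebraMap R K)) := by
  intro g hg
  have hf0 : f.map (algebraMap R K) ≠ 0 :=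
    (Polynomial.map_ne_zero_iff (IsFractionRing.injective R K)).2 hf.ne_zero
  have hg0 : g ≠ 0 := by
    rintro rfl
    exact hf0 (by simpa using hg)
  set G := IsLocalization.integerNormalization (nonZeroDivisors R) g with hG
  obtain ⟨b, hb⟩ := IsLocalization.integerNormalization_spec (nonZeroDivisors R) g
  -- Gauss's lemma: the square of a primitive polynomial divides `f` over `R` once it does so over
  -- the fraction field.
  have hprim : (G.primPart * G.primPart).IsPrimitive :=
    G.isPrimitive_primPart.mul G.isPrimitive_primPart
  have hdvd : G.primPart.map (algebraMap R K) ∣ g := by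
    have h1 : G.primPart.map (algebraMap R K) ∣ G.map (algebraMap R K) :=
      Polynomial.map_dvd _ G.primPart_dvd
    have hb0 : algebraMap R K b ≠ 0 := IsFractionRing.to_map_ne_zero_of_mem_nonZeroDivisors hb.1
    rw [hG, hb.2, algebra_compatible_smul K, Polynomial.smul_eq_C_mul] at h1
    exact ((Polynomial.isUnit_C.2 hb0.isUnit).dvd_mul_left).1 h1
  have h2 : G.primPart * G.primPart ∣ f := by
    rw [hprim.dvd_iff_fraction_map_dvd_fraction_map K, Polynomial.map_mul]
    exact (mul_dvd_mul hdvd hdvd).trans hg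
  exact Polynomial.isUnit_or_eq_zero_of_isUnit_integerNormalization_primPart hg0 (hf _ h2)

/-- A squarefree polynomial over a domain of characteristic zero has a Bézout relation with its
derivative, up to a nonzero constant. -/
theorem Polynomial.exists_mul_add_derivative_mul_eq_C {R : Type*} [CommRing R] [IsDomain R]
    [NormalizedGCDMonoid R] [CharZero R] {f : Polynomial R} (hf : Squarefree f) :
    ∃ (u v : Polynomial R) (d : R), d ≠ 0 ∧
      u * f + v * Polynomial.derivative f = Polynomial.C d := by
  let K := FractionRing R
  have hinj := IsFractionRing.injective R K
  -- In characteristic zero squarefree means separable; clearing denominators in the Bézout relation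
  -- gives `d = s * t`.
  have h1 : (f.map (algebraMap R K)).Separable :=
    PerfectField.separable_iff_squarefree.2 (Polynomial.squarefree_map_of_squarefree hf)
  obtain ⟨u, v, h⟩ := h1
  obtain ⟨s, hs⟩ := IsLocalization.integerNormalization_spec (nonZeroDivisors R) u
  obtain ⟨t, ht⟩ := IsLocalization.integerNormalization_spec (nonZeroDivisors R) v
  refine ⟨Polynomial.C t * IsLocalization.integerNormalization (nonZeroDivisors R) u,
    Polynomial.C s * IsLocalization.integerNormalization (nonZeroDivisors R) v, s * t,
    mul_ne_zero (nonZeroDivisors.ne_zero hs.1) (nonZeroDivisors.ne_zero ht.1), ?_⟩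
  refine Polynomial.map_injective _ hinj ?_
  rw [algebra_compatible_smul K, Polynomial.smul_eq_C_mul] at hs ht
  simp only [Polynomial.map_add, Polynomial.map_mul, Polynomial.map_C, hs.2, ht.2, map_mul,
    ← Polynomial.derivative_map]
  linear_combination Polynomial.C (algebraMap R K s) * Polynomial.C (algebraMap R K t) * h

namespace Poly2

/-- `p` as a polynomial in `z` with coefficients in `ℂ[w]`. -/
noncomputable def nested : Poly2 ≃+* Polynomial (Polynomial ℂ) :=
  ((finSuccEquiv ℂ 1).trans (Polynomial.mapAlgEquiv (uniqueAlgEquiv ℂ (Fin 1)))).toRingEquiv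

theorem eval_nested (p : Poly2) (z w : ℂ) :
    ((nested p).map (Polynomial.evalRingHom w)).eval z = p.at z w := by
  have : (Polynomial.evalRingHom z).comp ((Polynomial.mapRingHom (Polynomial.evalRingHom w)).comp
      (nested : Poly2 →+* Polynomial (Polynomial ℂ))) = MvPolynomial.eval ![z, w] := by
    refine MvPolynomial.ringHom_ext (fun c => ?_) fun i => ?_
    · simp [nested, finSuccEquiv_apply]
    · fin_cases i
      · simp [nested, finSuccEquiv_apply]
      · have := finSuccEquiv_X_succ (R := ℂ) (n := 1) (j := 0)
        rw [Fin.succ_zero_eq_one] at this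
        simp [nested, this]
  exact RingHom.congr_fun this p

theorem eval_derivative_nested (p : Poly2) (z w : ℂ) :
    ((Polynomial.derivative (nested p)).map (Polynomial.evalRingHom w)).eval z = p.dz.at z w := by
  rw [← Polynomial.derivative_map]
  have h1 := ((nested p).map (Polynomial.evalRingHom w)).hasDerivAt z
  have h2 := p.hasDerivAt_at (hasDerivAt_id z) (hasDerivAt_const z w)
  simp only [id, mul_one, mul_zero, add_zero] at h2
  exact h1.unique (h2.congr_of_eventuallyEq (Filter.Eventually.of_forall fun t => eval_nested p t w))

theorem squarefree_of_ringEquiv {A B : Type*} [CommRing A] [CommRing B] (e : A ≃+* B) {f : A}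
    (hf : Squarefree f) : Squarefree (e f) := by
  intro g hg
  have h := hf (e.symm g) (by simpa using map_dvd e.symm hg)
  simpa using h.map e

/-- A squarefree `p` has only finitely many horizontal lines tangent to its zero set. -/
theorem finite_critical_w {p : Poly2} (hp : Squarefree p) :
    {w : ℂ | ∃ z, p.at z w = 0 ∧ p.dz.at z w = 0}.Finite := by
  -- Here `d` is a nonzero polynomial in `w` that vanishes wherever `p` and `p_z` have a common
  -- zero.
  obtain ⟨u, v, d, hd, h⟩ := Polynomial.exists_mul_add_derivative_mul_eq_C
    (squarefree_of_ringEquiv nested hp)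
  refine d.roots.toFinset.finite_toSet.subset ?_
  rintro w ⟨z, h1, h2⟩
  rw [Finset.mem_coe, Multiset.mem_toFinset, Polynomial.mem_roots hd, Polynomial.IsRoot]
  have := congrArg (fun F => (F.map (Polynomial.evalRingHom w)).eval z) h
  simpa [eval_nested, eval_derivative_nested, h1, h2] using this.symm

end Poly2

/-! ### Nonvanishing of the entries -/

namespace Poly2

theorem dz_swap (p : Poly2) : p.swap.dz = p.dw.swap := by
  have := pderiv_rename (R := ℂ) (Equiv.swap (0 : Fin 2) 1).injective 1 p
  rwa [Equiv.swap_apply_right] at this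

theorem dw_swap (p : Poly2) : p.swap.dw = p.dz.swap := by
  have := pderiv_rename (R := ℂ) (Equiv.swap (0 : Fin 2) 1).injective 0 p
  rwa [Equiv.swap_apply_left] at this

theorem hasDegreeAtMost_swap {f : Poly2} {n m : ℕ} (h : f.HasDegreeAtMost n m) :
    f.swap.HasDegreeAtMost m n := by
  obtain ⟨h0, h1⟩ := hasDegree_swap (f := f) ⟨rfl, rfl⟩
  exact ⟨h0.trans_le h.2, h1.trans_le h.1⟩

theorem squarefree_swap {f : Poly2} (hf : Squarefree f) : Squarefree f.swap :=
  squarefree_of_ringEquiv (renameEquiv ℂ (Equiv.swap (0 : Fin 2) 1)).toRingEquiv hf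

variable {p : Poly2} {n m : ℕ} {a b : ℝ} {P : Fin n → Poly2} {Q : Fin m → Poly2}

/-- The weighted form changes sign when the variables and the weights are exchanged, which matches
moving `P` and `Q` across the equation. Statements about `P` thus transfer to `Q`. -/
theorem IsSOSPair.swap (h : IsSOSPair p n m a b P Q) :
    IsSOSPair p.swap m n b a (fun j => (Q j).swap) (fun i => (P i).swap) := by
  refine ⟨fun j => hasDegreeAtMost_swap (h.2.1 j), fun i => hasDegreeAtMost_swap (h.1 i),
    fun z w => ?_⟩
  have h1 := h.2.2 w z
  have e1 : vecNormSq (fun j => (Q j).swap) z w = vecNormSq Q w z := by simp [vecNormSq]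
  have e2 : vecNormSq (fun j => (P j).swap) z w = vecNormSq P w z := by simp [vecNormSq]
  have e3 : (((b : ℂ) * z * p.dw.at w z - (a : ℂ) * w * p.dz.at w z) * (starRingEnd ℂ) (p.at w z)).re
      = -(((a : ℂ) * w * p.dz.at w z - (b : ℂ) * z * p.dw.at w z) *
        (starRingEnd ℂ) (p.at w z)).re := by
    rw [← Complex.neg_re]; congr 1; ring
  rw [e1, e2, dz_swap, dw_swap, at_swap, at_swap, at_swap, e3]
  linarith

/-- On a generic horizontal line through the circle, the zeros of `p` are simple and the zero set is
nowhere tangent to a coordinate direction. -/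
theorem DefinesDistinguishedVariety.exists_simple_roots (hp : p.DefinesDistinguishedVariety)
    (hdeg : p.HasDegree n m) (hsq : Squarefree p) : ∃ (w : ℂ) (ζ : Fin n → ℂ), ‖w‖ = 1 ∧
      Function.Injective ζ ∧ ∀ k, p.at (ζ k) w = 0 ∧ ‖ζ k‖ = 1 ∧ p.dz.at (ζ k) w ≠ 0 ∧
        p.dw.at (ζ k) w ≠ 0 := by
  have hb := mem_box_of_hasDegree hdeg
  have hb' := mem_box_of_hasDegree (hasDegree_swap hdeg)
  have hfin1 := finite_critical_w hsq
  have hfin2 := finite_critical_w (squarefree_swap hsq)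
  -- Points of `V` with `p_w = 0` have finitely many `z`-coordinates, and `V` has finitely many
  -- points over each, so only finitely many `w` must be avoided.
  have hfin3 : {w : ℂ | ∃ z ∈ {z : ℂ | ∃ w, p.swap.at w z = 0 ∧ p.swap.dz.at w z = 0},
      p.at z w = 0}.Finite := by
    have : {w : ℂ | ∃ z ∈ {z : ℂ | ∃ w, p.swap.at w z = 0 ∧ p.swap.dz.at w z = 0}, p.at z w = 0}
        = ⋃ z ∈ {z : ℂ | ∃ w, p.swap.at w z = 0 ∧ p.swap.dz.at w z = 0}, {w | p.at z w = 0} := by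
      ext w; simp
    rw [this]
    refine hfin2.biUnion fun z _ => ?_
    obtain ⟨w₁, hw₁⟩ := hp.exists_at_ne_zero z
    have hne : p.slice (n + 1) (m + 1) z ≠ 0 := by
      intro h0
      rw [← eval_slice hb, h0] at hw₁
      simp at hw₁
    refine (p.slice (n + 1) (m + 1) z).roots.toFinset.finite_toSet.subset fun w hw => ?_
    rw [Finset.mem_coe, Multiset.mem_toFinset, Polynomial.mem_roots hne, Polynomial.IsRoot,
      eval_slice hb]
    exact hw
  obtain ⟨w, hw, hw'⟩ := (infinite_unit_sphere.sdiff (hfin1.union hfin3)).nonempty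
  rw [mem_sphere_zero_iff_norm] at hw
  rw [Set.mem_union, not_or] at hw'
  set F := p.swap.slice (m + 1) (n + 1) w with hF
  have hFe : ∀ z, F.eval z = p.at z w := fun z => by rw [hF, eval_slice hb', at_swap]
  obtain ⟨-, hcard⟩ := slice_eq_prod (hp.swap.wc_ne_zero (hasDegree_swap hdeg) hw.le)
  rw [← hF] at hcard
  have hroot : ∀ z ∈ F.roots, p.at z w = 0 := fun z hz => by
    rw [← hFe]; exact Polynomial.isRoot_of_mem_roots hz
  have hdz : ∀ z ∈ F.roots, p.dz.at z w ≠ 0 := fun z hz h0 => hw'.1 ⟨z, hroot z hz, h0⟩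
  have hdw : ∀ z ∈ F.roots, p.dw.at z w ≠ 0 := fun z hz h0 =>
    hw'.2 ⟨z, ⟨w, by rw [at_swap]; exact hroot z hz, by rw [dz_swap, at_swap]; exact h0⟩, hroot z hz⟩
  have hF' : ∀ z, (Polynomial.derivative F).eval z = p.dz.at z w := by
    intro z
    have h2 := p.hasDerivAt_at (hasDerivAt_id z) (hasDerivAt_const z w)
    simp only [id, mul_one, mul_zero, add_zero] at h2
    exact (F.hasDerivAt z).unique (h2.congr_of_eventuallyEq (Filter.Eventually.of_forall hFe))
  -- A multiple root would be a zero of `p_z`, excluded by the choice of `w`. The leading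
  -- coefficient in `z` does not vanish, so there are exactly `n` roots.
  have hnodup : F.roots.Nodup := by
    rw [Multiset.nodup_iff_count_le_one]
    intro z
    by_contra! hz
    have hz0 : z ∈ F.roots := Multiset.count_pos.1 (zero_lt_one.trans hz)
    rw [Polynomial.count_roots,
      Polynomial.one_lt_rootMultiplicity_iff_isRoot (Polynomial.ne_zero_of_mem_roots hz0)] at hz
    exact hdz z hz0 ((hF' z).symm.trans hz.2)
  have hc : F.roots.toFinset.card = n := by rw [Multiset.toFinset_card_of_nodup hnodup, hcard]
  let e := F.roots.toFinset.equivFinOfCardEq hc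
  have hmem : ∀ k, ((e.symm k : F.roots.toFinset) : ℂ) ∈ F.roots := fun k =>
    Multiset.mem_toFinset.1 (e.symm k).2
  refine ⟨w, fun k => (e.symm k : F.roots.toFinset), hw,
    Subtype.val_injective.comp e.symm.injective, fun k => ⟨hroot _ (hmem k), ?_, hdz _ (hmem k),
      hdw _ (hmem k)⟩⟩
  rcases hp.cases (hroot _ (hmem k)) with h | h | h
  · exact absurd hw h.2.ne
  · exact h.1
  · exact absurd hw h.2.ne'

/-- At torus points of the zero set where no coordinate direction is tangent, `P` does not vanish. -/
theorem DefinesDistinguishedVariety.vecNormSq_left_ne_zero (hp : p.DefinesDistinguishedVariety)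
    (hdeg : p.HasDegree n m) (ha : 0 ≤ a) (hb : 0 ≤ b) (hab : ¬ (a = 0 ∧ b = 0))
    (h : IsSOSPair p n m a b P Q) {z w : ℂ} (h0 : p.at z w = 0) (hz : ‖z‖ = 1) (hw : ‖w‖ = 1)
    (hdz : p.dz.at z w ≠ 0) (hdw : p.dw.at z w ≠ 0) : vecNormSq P z w ≠ 0 := by
  intro hP
  -- An auxiliary pair with weights `(1, 0)` shows that `β conj α` is a nonpositive real, where `α =
  -- z p_z` and `β = w p_w`. If `P` vanished, then `aα = bβ`, so `a|α|² = b β conj α ≤ 0`; this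
  -- forces `a = 0` and then `b = 0`.
  obtain ⟨P₁, Q₁, h₁⟩ := hp.exists_isSOSPair hdeg 1 0 zero_le_one le_rfl (by simp)
  have hz0 : z ≠ 0 := norm_ne_zero_iff.1 (by rw [hz]; exact one_ne_zero)
  have hw0 : w ≠ 0 := norm_ne_zero_iff.1 (by rw [hw]; exact one_ne_zero)
  have e1 := IsSOSPair.left_deriv h h0 hz hw
  have e2 := IsSOSPair.right_deriv h₁ h0 hz hw
  rw [hP, Complex.ofReal_zero, mul_eq_zero, map_eq_zero] at e1
  have e3 := e1.resolve_left (mul_ne_zero hz0 hdz)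
  set α := z * p.dz.at z w with hα
  set β := w * p.dw.at z w with hβ
  have hα0 : α ≠ 0 := mul_ne_zero hz0 hdz
  have hβ0 : β ≠ 0 := mul_ne_zero hw0 hdw
  have e4 : (a : ℂ) * α = b * β := by
    rw [weightedDeriv] at e3; linear_combination e3
  have e5 : β * (starRingEnd ℂ) α = -(vecNormSq Q₁ z w : ℂ) := by
    rw [weightedDeriv] at e2; simpa [hα, mul_assoc] using e2
  have hN : 0 ≤ vecNormSq Q₁ z w := Finset.sum_nonneg fun _ _ => by positivity
  have e6 : a * ‖α‖ ^ 2 = -(b * vecNormSq Q₁ z w) := by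
    have := Complex.mul_conj' α
    have : (a : ℂ) * (‖α‖ : ℂ) ^ 2 = -(b * (vecNormSq Q₁ z w : ℂ)) := by
      linear_combination (starRingEnd ℂ) α * e4 + b * e5 - a * this
    exact_mod_cast this
  have e7 : 0 < ‖α‖ ^ 2 := by positivity
  have ha0 : a = 0 := by
    by_contra hne
    have h1 : 0 < a * ‖α‖ ^ 2 := mul_pos (lt_of_le_of_ne ha (Ne.symm hne)) e7
    have h2 : 0 ≤ b * vecNormSq Q₁ z w := mul_nonneg hb hN
    linarith
  rw [ha0, Complex.ofReal_zero, zero_mul, eq_comm, mul_eq_zero] at e4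
  exact hab ⟨ha0, by exact_mod_cast e4.resolve_right hβ0⟩

/-- No entry of `P` vanishes identically on the zero set. -/
theorem DefinesDistinguishedVariety.exists_left_ne_zero (hp : p.DefinesDistinguishedVariety)
    (hdeg : p.HasDegree n m) (ha : 0 ≤ a) (hb : 0 ≤ b) (hab : ¬ (a = 0 ∧ b = 0))
    (hsq : Squarefree p) (h : IsSOSPair p n m a b P Q) (i : Fin n) :
    ∃ x ∈ p.zeroSet, (P i).at x.1 x.2 ≠ 0 := by
  obtain ⟨w, ζ, hw, hinj, hζ⟩ := hp.exists_simple_roots hdeg hsq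
  let v : Fin n → EuclideanSpace ℂ (Fin n) := fun k => WithLp.toLp 2 fun j => (P j).at (ζ k) w
  have hw1 : w * (starRingEnd ℂ) w = 1 := by rw [Complex.mul_conj', hw]; simp
  have hne : ∀ k, v k ≠ 0 := by
    intro k hk
    obtain ⟨h0, hz, hdz, hdw⟩ := hζ k
    refine hp.vecNormSq_left_ne_zero hdeg ha hb hab h h0 hz hw hdz hdw ?_
    refine Finset.sum_eq_zero fun j _ => ?_
    have : (P j).at (ζ k) w = 0 := congrArg (fun x : EuclideanSpace ℂ (Fin n) => x j) hk
    simp [this]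
  -- The two points share `w` with `|w| = 1`, so the right side of the formula on `V` is zero, while
  -- `1 - ζ_l conj ζ_k ≠ 0` for distinct points of the circle.
  have horth : Pairwise fun k l => inner ℂ (v k) (v l) = 0 := by
    intro k l hkl
    have h1 := IsSOSPair.inner_eq h (hζ l).1 (hζ k).1
    rw [hw1, sub_self, zero_mul, mul_eq_zero] at h1
    refine Eq.trans ?_ (h1.resolve_left fun h2 => hkl (hinj ?_))
    · simp [v, vecInner, PiLp.inner_apply]
    · have h3 : ζ k * (starRingEnd ℂ) (ζ k) = 1 := by rw [Complex.mul_conj', (hζ k).2.1]; simp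
      linear_combination ζ k * h2 + ζ l * h3
  have hli := linearIndependent_of_ne_zero_of_inner_eq_zero hne horth
  have : Nonempty (Fin n) := ⟨i⟩
  have hspan := hli.span_eq_top_of_card_eq_finrank (by simp)
  by_contra! hzero
  -- The `n` nonzero orthogonal vectors span `ℂⁿ`, so they cannot all lie in a coordinate
  -- hyperplane.
  have hle : (⊤ : Submodule ℂ (EuclideanSpace ℂ (Fin n))) ≤
      LinearMap.ker (EuclideanSpace.proj (𝕜 := ℂ) i).toLinearMap := by
    rw [← hspan, Submodule.span_le]
    rintro _ ⟨k, rfl⟩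
    exact hzero (ζ k, w) (hζ k).1
  have := hle (Submodule.mem_top (x := EuclideanSpace.single i (1 : ℂ)))
  simp at this

/-- No entry of `Q` vanishes identically on the zero set. -/
theorem DefinesDistinguishedVariety.exists_right_ne_zero (hp : p.DefinesDistinguishedVariety)
    (hdeg : p.HasDegree n m) (ha : 0 ≤ a) (hb : 0 ≤ b) (hab : ¬ (a = 0 ∧ b = 0))
    (hsq : Squarefree p) (h : IsSOSPair p n m a b P Q) (j : Fin m) :
    ∃ x ∈ p.zeroSet, (Q j).at x.1 x.2 ≠ 0 := by
  obtain ⟨x, hx, hne⟩ := hp.swap.exists_left_ne_zero (hasDegree_swap hdeg) hb ha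
    (fun h => hab h.symm) (squarefree_swap hsq) (IsSOSPair.swap h) j
  rw [at_swap] at hne
  exact ⟨(x.2, x.1), (at_swap p x.1 x.2).symm.trans hx, hne⟩

end Poly2

theorem mainTheorem4 (p : Poly2) (n m : ℕ) (hdeg : p.HasDegree n m)
    (hp : p.DefinesDistinguishedVariety)
    (a b : ℝ) (ha : 0 ≤ a) (hb : 0 ≤ b) (hab : ¬ (a = 0 ∧ b = 0)) :
    (∃ (P : Fin n → Poly2) (Q : Fin m → Poly2), IsSOSPair p n m a b P Q) ∧
    ∀ (P : Fin n → Poly2) (Q : Fin m → Poly2), IsSOSPair p n m a b P Q →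
      (Squarefree p →
        (∀ i, ∃ x ∈ p.zeroSet, (P i).at x.1 x.2 ≠ 0) ∧
        (∀ j, ∃ x ∈ p.zeroSet, (Q j).at x.1 x.2 ≠ 0)) ∧
      (∀ x ∈ p.zeroSet, ∀ y ∈ p.zeroSet,
        (1 - x.1 * (starRingEnd ℂ) y.1) * vecInner P x.1 x.2 y.1 y.2
          = (1 - x.2 * (starRingEnd ℂ) y.2) * vecInner Q x.1 x.2 y.1 y.2) := by
  refine ⟨hp.exists_isSOSPair hdeg a b ha hb hab, fun P Q h => ⟨fun hsq => ⟨fun i => ?_, fun j => ?_⟩,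
    fun x hx y hy => Poly2.IsSOSPair.inner_eq h hx hy⟩⟩
  · exact hp.exists_left_ne_zero hdeg ha hb hab hsq h i
  · exact hp.exists_right_ne_zero hdeg ha hb hab hsq h j
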